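/- **Setting.** An electron spin $S=1/2$ is coupled to $N\ge 1$ nuclear spins $1/2$, with spin operators $\mathbf S=\tfrac{\hbar}{2}\boldsymbol\sigma$, $\mathbf I_j=\tfrac{\hbar}{2}\boldsymbol\sigma$ and Hamiltonian $$H=H_0+V,\quad H_0=\gamma_SBS_z+\gamma_IB\sum_jI_{jz}+\sum_jA_jS_zI_{jz},\quad V=\sum_j\tfrac12A_j(S_+I_{j-}+S_-I_{j+}),$$ where $\hbar>0$, $\gamma_S>\gamma_I$, $A_j\ge0$, and $B>B_c:=\hbar A_{max}/(\gamma_S-\gamma_I)$ with $A_{max}=\sum_jA_j$. $H$ commutes with $J_z=S_z+\sum_jI_{jz}$, hence preserves the block of states with $L$ down spins in total (electron included). Let $A[k]$ be the sum of the $k$ largest $A_j$. For $1\le L\le N$ (blocks containing both electron polarizations) put $$E^{\Uparrow}_{0,min/max}=\tfrac12\hbar\gamma_SB+\tfrac12(N-2L)\hbar\gamma_IB\mp\tfrac14\hbar^2(2A[L\,/\,N-L]-A_{max}),$$ $$E^{\Downarrow}_{0,min/max}=-\tfrac12\hbar\gamma_SB+\tfrac12(N-2L+2)\hbar\gamma_IB\mp\tfrac14\hbar^2(2A[N-L+1\,/\,L-1]-A_{max}),$$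 (in each formula the first alternative of $A[\cdot]$ and the upper sign belong to $min$, the second alternative and the lower sign to $max$), and $V_{max}=\tfrac12\hbar^2\sqrt{A[L]A[N+1-L]}$, $$\xi_2=\tfrac12-\tfrac12\sqrt{1-\frac{4V_{max}^2}{(E^\Uparrow_{0,min}-E^\Downarrow_{0,max})^2}}$$ (with $\xi_2=\tfrac12$ if the radicand is negative), $E^-_{max}=E^\Downarrow_{0,max}+V_{max}$, $E^+_{min}=E^\Uparrow_{0,min}-V_{max}$, $\epsilon=\max\{\epsilon_\Uparrow,\epsilon_\Downarrow\}$ with $$\epsilon_\Uparrow^2=\frac{\frac14(E^\Uparrow_{0,max}-E^\Uparrow_{0,min})^2+V_{max}^2}{(E^-_{max}-E^\Uparrow_{0,min})^2},\qquad \epsilon_\Downarrow^2=\frac{\frac14(E^\Downarrow_{0,max}-E^\Downarrow_{0,min})^2+V_{max}^2}{(E^+_{min}-E^\Downarrow_{0,max})^2}.$$ Let $\Pi_\Uparrow,\Pi_\Downarrow$ be the projections onto electron up, down and $R_\pi=|\Downarrow\rangle\langle\Uparrow|+|\Uparrow\rangle\langle\Downarrow|$ (tensored with the nuclear identity). Write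 $H_0'=H_0-\gamma_IBJ_z$. Let $E_i^-$ run over the eigenvalues of $H_0'+V$ that have a normalized eigenvector $\psi$ in the block $L$ with $\langle\psi|\Pi_\Downarrow|\psi\rangle>\tfrac12$, and let $\|W\|_2$ be the largest spectral norm, over these $E_i^-$, of $$W=\Pi_\Uparrow\Big(R_\pi V\frac1{E_i^--H_0'}VR_\pi+V\frac1{-E_i^--H_0'}V\Big)\Pi_\Uparrow$$ on the states with $L-1$ nuclear spins down. **Echo.** Let $U(t)=e^{iHt/\hbar}$, $\tilde U=U(t)R_\pi U(t)$, $R_{\pi/2}=|\Rightarrow\rangle\langle\Uparrow|+|\Leftarrow\rangle\langle\Downarrow|$ with $|\Rightarrow\rangle=\frac{1}{\sqrt2}(|\Uparrow\rangle-|\Downarrow\rangle)$, $|\Leftarrow\rangle=\frac{1}{\sqrt2}(|\Uparrow\rangle+|\Downarrow\rangle)$, and, for an initial state $\rho_0$, $$v(2t)=\big|\mathrm{Tr}[R_{\pi/2}^\dagger\tilde U^\dagger\,(|\Uparrow\rangle\langle\Downarrow|)\,\tilde UR_{\pi/2}\rho_0]\big|$$ (that is, $|\langle S_+\rangle|/\hbar$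 after the Hahn spin-echo sequence). Let $T_2$ be the infimum of the $t\ge0$ with $v(2t)=\frac1{2e}$ ($+\infty$ if there is none). **Theorem.** For each of the following two choices of $\rho_0$ and of the constants $\xi_2,\epsilon,\|W\|_2$: (a) for any $1\le L\le N$, $\rho_0$ is the state with the electron down and the nuclei completely mixed over the $\binom{N}{L-1}$ configurations with $L-1$ down spins, and $\xi_2,\epsilon,\|W\|_2$ are those of the block $L$; (b) $\rho_0=2^{-N}|\Downarrow\rangle\langle\Downarrow|\otimes\mathcal I_I$ (electron down, nuclei completely mixed), and each of $\xi_2,\epsilon,\|W\|_2$ is replaced by its maximum over $1\le L\le N$; the following hold. 1. For every $\alpha>1$ and every $t\ge0$ with $2\alpha\|W\|_2t<\hbar\pi$, $$v(2t)\ \ge\ \tfrac12\left(1-2\xi_2-4\epsilon^2-4\epsilon\sqrt{\xi_2}-4\epsilon^2\xi_2-\epsilon\,c-2c^2\right),$$ where $c\ge0$ is given by $c^2=1-\left(1-\frac1{\alpha^2}\right)\cos\left(\frac{\alpha\|W\|_2t}{\hbar}\right)+\frac1{\alpha^2}$. 2. If $\|W\|_2>0$ and $c_{max}>0$ satisfies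 $c_{max}^2+\epsilon c_{max}+\xi_2+2\epsilon^2+2\epsilon\sqrt{\xi_2}+2\epsilon^2\xi_2+\frac1{2e}-\frac12=0$, then the maximum $$t_b=\max_{\alpha}\ \frac{\hbar}{\alpha\|W\|_2}\cos^{-1}\left(\frac{1-c_{max}^2+\frac1{\alpha^2}}{1-\frac1{\alpha^2}}\right)$$ over the $\alpha>1$ for which the argument of $\cos^{-1}$ is at most $1$ (equivalently $2/\alpha^2\le c_{max}^2$) exists, and $T_2\ge t_b$. -/

import Mathlib

namespace SpinEcho

open scoped Kronecker

/-- The parameters of one electron spin-1/2 coupled to `N` nuclear spins-1/2 in a field along `z`: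
Planck's constant, the two gyromagnetic ratios, the field and the hyperfine couplings. -/
structure SpinBath (N : ℕ) where
  hbar : ℝ
  gammaS : ℝ
  gammaI : ℝ
  B : ℝ
  A : Fin N → ℝ

/-- Basis states: `true` is spin up, `false` is spin down; the first factor is the electron. -/
abbrev State (N : ℕ) : Type := Bool × (Fin N → Bool)

/-- Operators, written as matrices in the joint `z` basis. -/
abbrev Op (N : ℕ) : Type := Matrix (State N) (State N) ℂ

noncomputable section

/-! ### Spin operators -/

def ketUp : Bool → ℂ := Pi.single true 1

def ketDown : Bool → ℂ := Pi.single false 1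

/-- The state `(up - down) / √2`. -/
def ketRight : Bool → ℂ := ((√2 : ℝ) : ℂ)⁻¹ • (ketUp - ketDown)

/-- The state `(up + down) / √2`. -/
def ketLeft : Bool → ℂ := ((√2 : ℝ) : ℂ)⁻¹ • (ketUp + ketDown)

/-- `ketBra a b` is the operator `|a⟩⟨b|`. -/
def ketBra (a b : Bool → ℂ) : Matrix Bool Bool ℂ := Matrix.vecMulVec a (star b)

/-- `S_z` of a single spin-1/2. -/
def spinZ (hbar : ℝ) : Matrix Bool Bool ℂ :=
  ((hbar / 2 : ℝ) : ℂ) • (ketBra ketUp ketUp - ketBra ketDown ketDown)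

/-- `S_+` of a single spin-1/2. -/
def spinPlus (hbar : ℝ) : Matrix Bool Bool ℂ := (hbar : ℂ) • ketBra ketUp ketDown

/-- `S_-` of a single spin-1/2. -/
def spinMinus (hbar : ℝ) : Matrix Bool Bool ℂ := (hbar : ℂ) • ketBra ketDown ketUp

/-- A one-spin operator acting on the electron. -/
def onElectron (N : ℕ) (M : Matrix Bool Bool ℂ) : Op N :=
  M ⊗ₖ (1 : Matrix (Fin N → Bool) (Fin N → Bool) ℂ)

/-- A one-spin operator acting on the `j`-th nucleus. -/
def onNucleus {N : ℕ} (j : Fin N) (M : Matrix Bool Bool ℂ) : Op N :=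
  (1 : Matrix Bool Bool ℂ) ⊗ₖ
    (Matrix.of fun z z' : Fin N → Bool => if ∀ i, i ≠ j → z i = z' i then M (z j) (z' j) else 0)

/-- The total number of down spins, electron included. -/
def numDown {N : ℕ} (s : State N) : ℕ :=
  (if s.1 = false then 1 else 0) + (Finset.univ.filter fun j => s.2 j = false).card

namespace SpinBath

variable {N : ℕ} (P : SpinBath N)

/-! ### The Hamiltonian -/

/-- `H₀ = γ_S B S_z + γ_I B ∑ⱼ I_{jz} + ∑ⱼ Aⱼ S_z I_{jz}`. -/
def H0 : Op N :=
  ((P.gammaS * P.B : ℝ) : ℂ) • onElectron N (spinZ P.hbar)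
    + ((P.gammaI * P.B : ℝ) : ℂ) • ∑ j, onNucleus j (spinZ P.hbar)
    + ∑ j, (P.A j : ℂ) • (onElectron N (spinZ P.hbar) * onNucleus j (spinZ P.hbar))

/-- The flip-flop term `V = ∑ⱼ (Aⱼ / 2) (S_+ I_{j-} + S_- I_{j+})`. -/
def V : Op N :=
  ∑ j, ((P.A j / 2 : ℝ) : ℂ) •
    (onElectron N (spinPlus P.hbar) * onNucleus j (spinMinus P.hbar)
      + onElectron N (spinMinus P.hbar) * onNucleus j (spinPlus P.hbar))

def H : Op N := P.H0 + P.V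

/-- The conserved total `J_z = S_z + ∑ⱼ I_{jz}`. -/
def Jz : Op N := onElectron N (spinZ P.hbar) + ∑ j, onNucleus j (spinZ P.hbar)

/-- `H₀ - γ_I B J_z`: the unperturbed energies counted from those of the conserved `γ_I B J_z`.
It is diagonal in the `z` basis. -/
def H0rot : Op N := P.H0 - ((P.gammaI * P.B : ℝ) : ℂ) • P.Jz

/-! ### The spin-echo signal -/

/-- Free evolution `U(t) = exp(i H t / ħ)`. -/
def U (t : ℝ) : Op N := NormedSpace.exp ((Complex.I * ((t / P.hbar : ℝ) : ℂ)) • P.H)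

end SpinBath

/-- The initial `π/2` pulse. -/
def Rhalf (N : ℕ) : Op N :=
  onElectron N (ketBra ketRight ketUp + ketBra ketLeft ketDown)

/-- The `π` pulse. -/
def Rpi (N : ℕ) : Op N :=
  onElectron N (ketBra ketDown ketUp + ketBra ketUp ketDown)

/-- Electron down, nuclei completely mixed: `2^{-N} |⇓⟩⟨⇓| ⊗ 1`. -/
def rhoMixed (N : ℕ) : Op N :=
  ((2 : ℂ) ^ N)⁻¹ • onElectron N (ketBra ketDown ketDown)

/-- Electron down, nuclei completely mixed within the block of `L` down spins in total, that is,
over the `N.choose (L - 1)` nuclear configurations with `L - 1` down spins. -/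
def rhoBlock (N L : ℕ) : Op N :=
  ((N.choose (L - 1) : ℕ) : ℂ)⁻¹ •
    Matrix.diagonal fun s => if s.1 = false ∧ numDown s = L then 1 else 0

namespace SpinBath

variable {N : ℕ} (P : SpinBath N)

/-- The spin-echo evolution `U(t) R_π U(t)`. -/
def Uecho (t : ℝ) : Op N := P.U t * Rpi N * P.U t

/-- `P.echo rho t` is the echo signal `v(2t) = |Tr[R_{π/2}† Ũ† S_+ Ũ R_{π/2} ρ]|`, with the
factor `ħ` of `S_+` dropped. -/
def echo (rho : Op N) (t : ℝ) : ℝ :=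
  ‖((Rhalf N).conjTranspose * (P.Uecho t).conjTranspose * onElectron N (ketBra ketUp ketDown)
    * P.Uecho t * Rhalf N * rho).trace‖

/-- `T₂`: the infimum of the times `t ≥ 0` with `v(2t) = 1/(2e)` (`⊤` if there is none). -/
def T2 (rho : Op N) : EReal :=
  sInf ((fun t : ℝ => (t : EReal)) '' {t : ℝ | 0 ≤ t ∧ P.echo rho t = 1 / (2 * Real.exp 1)})

/-! ### The constants -/

/-- `A[k]`, the sum of the `k` largest couplings (for `k ≤ N`). -/
def Atop (k : ℕ) : ℝ := ⨆ s : {s : Finset (Fin N) // s.card = k}, ∑ j ∈ s.1, P.A j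

def Amax : ℝ := ∑ j, P.A j

/-- The critical field. -/
def Bc : ℝ := P.hbar * P.Amax / (P.gammaS - P.gammaI)

def E0minUp (L : ℕ) : ℝ :=
  1 / 2 * P.hbar * P.gammaS * P.B + 1 / 2 * ((N : ℝ) - 2 * L) * P.hbar * P.gammaI * P.B
    - 1 / 4 * P.hbar ^ 2 * (2 * P.Atop L - P.Amax)

def E0maxUp (L : ℕ) : ℝ :=
  1 / 2 * P.hbar * P.gammaS * P.B + 1 / 2 * ((N : ℝ) - 2 * L) * P.hbar * P.gammaI * P.B
    + 1 / 4 * P.hbar ^ 2 * (2 * P.Atop (N - L) - P.Amax)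

def E0minDown (L : ℕ) : ℝ :=
  -(1 / 2 * P.hbar * P.gammaS * P.B)
    + 1 / 2 * ((N : ℝ) - 2 * L + 2) * P.hbar * P.gammaI * P.B
    - 1 / 4 * P.hbar ^ 2 * (2 * P.Atop (N - L + 1) - P.Amax)

def E0maxDown (L : ℕ) : ℝ :=
  -(1 / 2 * P.hbar * P.gammaS * P.B)
    + 1 / 2 * ((N : ℝ) - 2 * L + 2) * P.hbar * P.gammaI * P.B
    + 1 / 4 * P.hbar ^ 2 * (2 * P.Atop (L - 1) - P.Amax)

def Vmax (L : ℕ) : ℝ := 1 / 2 * P.hbar ^ 2 * √(P.Atop L * P.Atop (N + 1 - L))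

/-- `ξ₂`. Where the radicand is negative, `√` is `0` and `ξ₂ = 1/2`. -/
def xi2 (L : ℕ) : ℝ :=
  1 / 2 - 1 / 2 * √(1 - 4 * P.Vmax L ^ 2 / (P.E0minUp L - P.E0maxDown L) ^ 2)

def EmaxMinus (L : ℕ) : ℝ := P.E0maxDown L + P.Vmax L

def EminPlus (L : ℕ) : ℝ := P.E0minUp L - P.Vmax L

def epsUpSq (L : ℕ) : ℝ :=
  (1 / 4 * (P.E0maxUp L - P.E0minUp L) ^ 2 + P.Vmax L ^ 2) / (P.EmaxMinus L - P.E0minUp L) ^ 2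

def epsDownSq (L : ℕ) : ℝ :=
  (1 / 4 * (P.E0maxDown L - P.E0minDown L) ^ 2 + P.Vmax L ^ 2)
    / (P.EminPlus L - P.E0maxDown L) ^ 2

/-- `ε = max{ε_⇑, ε_⇓}`. -/
def eps (L : ℕ) : ℝ := max √(P.epsUpSq L) √(P.epsDownSq L)

/-! ### The operator `W` -/

/-- The energies `E_i^-` of the `-` eigenstates in the block of `L` down spins: eigenvalues having
a normalized eigenvector in the block whose electron is down with probability more than `1/2`.
Energies are counted from those of the conserved `γ_I B J_z`, which is constant on a block. -/
def minusEnergies (L : ℕ) : Set ℝ :=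
  {E | ∃ psi : State N → ℂ,
    (∀ s, numDown s ≠ L → psi s = 0) ∧
    ∑ s, ‖psi s‖ ^ 2 = 1 ∧
    (P.H0rot + P.V).mulVec psi = (E : ℂ) • psi ∧
    1 / 2 < ∑ z, ‖psi (false, z)‖ ^ 2}

/-- `1 / (E - H₀)`, energies counted as above. `H₀` being diagonal in the `z` basis, the inverse is
entrywise (and `0` on a state where `E - H₀` vanishes). -/
def resolvent (E : ℝ) : Op N := Matrix.diagonal fun s => ((E : ℂ) - P.H0rot s s)⁻¹

/-- The projection onto electron up and `L - 1` nuclear spins down. -/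
def projUp (N L : ℕ) : Op N :=
  Matrix.diagonal fun s => if s.1 = true ∧ numDown s + 1 = L then 1 else 0

/-- `W = Π_⇑ (R_π V (E - H₀)⁻¹ V R_π + V (-E - H₀)⁻¹ V) Π_⇑`, on the nuclear configurations with
`L - 1` down spins, for an energy `E = E_i^-` of the block `L`. -/
def W (L : ℕ) (E : ℝ) : Op N :=
  projUp N L *
    (Rpi N * P.V * P.resolvent E * P.V * Rpi N + P.V * P.resolvent (-E) * P.V) * projUp N L

/-- `‖W‖₂`: the spectral norm of `W`, uniformly over the `-` eigenstates of the block. -/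
def normW (L : ℕ) : ℝ :=
  sSup ((fun E => ‖Matrix.toEuclideanCLM (𝕜 := ℂ) (P.W L E)‖) '' P.minusEnergies L)

/-! ### The largest constants over all blocks containing both electron polarizations -/

def xi2All : ℝ := ⨆ L : Set.Icc 1 N, P.xi2 L

def epsAll : ℝ := ⨆ L : Set.Icc 1 N, P.eps L

def normWAll : ℝ := ⨆ L : Set.Icc 1 N, P.normW L

end SpinBath

/-! ### The bound -/

/-- `c(w, t)`, with `c(w, t)² = 1 - (1 - 1/α²) cos(α w t / ħ) + 1/α²`. -/
def cFun (hbar alpha w t : ℝ) : ℝ :=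
  √(1 - (1 - 1 / alpha ^ 2) * Real.cos (alpha * w * t / hbar) + 1 / alpha ^ 2)

def lowerBound (xi eps c : ℝ) : ℝ :=
  1 / 2 * (1 - 2 * xi - 4 * eps ^ 2 - 4 * eps * √xi - 4 * eps ^ 2 * xi - eps * c - 2 * c ^ 2)

/-- `c_max` is the positive root of
`c² + ε c + ξ₂ + 2ε² + 2ε√ξ₂ + 2ε²ξ₂ + 1/(2e) - 1/2 = 0`. -/
def IsCMax (xi eps cmax : ℝ) : Prop :=
  0 < cmax ∧
    cmax ^ 2 + eps * cmax + xi + 2 * eps ^ 2 + 2 * eps * √xi + 2 * eps ^ 2 * xi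
      + 1 / (2 * Real.exp 1) - 1 / 2 = 0

/-- The times `(ħ / (w α)) arccos((1 - c_max² + 1/α²) / (1 - 1/α²))`, for all `α > 1` for which the
argument of `arccos` is at most `1`. -/
def boundTimes (hbar w cmax : ℝ) : Set ℝ :=
  (fun alpha => hbar / (w * alpha) *
      Real.arccos ((1 - cmax ^ 2 + 1 / alpha ^ 2) / (1 - 1 / alpha ^ 2))) ''
    {alpha | 1 < alpha ∧ 2 / alpha ^ 2 ≤ cmax ^ 2}

end

end SpinEcho

/-! Write a and b for the up-up and down-down blocks of U(t) in the electron polarization. Since J_z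
is conserved, only two overlaps survive in the echo trace over the nuclear configurations with n
down spins: that of ab with ba, and that of the two diagonal blocks of U R_π U. The polarization
identity turns the first into squared norms minus half the squared Hilbert-Schmidt norm of [a, b].
Unitarity bounds the second by the weight that ab and ba have lost to electron transfer. Hence the
signal can decay only through transfer between the polarizations and through [a, b]
(`re_sum_echoTerm_ge`).

Transfer is governed by r = V_max / Δ with Δ = E⇑_min - E⇓_max; the field condition gives r < 1.
Because U commutes with the Hamiltonian, its off-diagonal blocks solve a Sylvester equation with gap
Δ, so they are of order r uniformly in time (`hs_transfer_le`, `opn_transfer_le`).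

For the commutator, let φ be the electron-down part of a low-energy eigenvector, of energy E, in the
block L = n + 1. Under b it is stationary up to order r². Turning the electron up and adding the
first-order admixture gives a vector that fails to be an eigenvector of energy -E by exactly Wφ
(`hs_dressed_le`), so under a it is stationary up to ‖W‖t/ħ plus order r². The two blocks are thus
almost diagonal on the same vectors and almost commute (`hs_blkComm_sq_le`); the remaining
eigenvectors have little electron-down weight.

With x = ‖W‖t/ħ, the relative loss is at most 10r² + 2(x + 7r²/2)² (`loss_le`). Where the claimed
bound is positive, twice that bound is at most one minus this loss (`two_mul_lowerBound_le`),
because ξ₂ ≥ r², ε ≥ r/(1 - r), and c² ≥ 1.1x whatever α is (`le_cFun_sq`). The fully mixed state is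
a sum over n; the configuration with all nuclei down lies in no block with both polarizations and is
treated separately. The bound on T₂ follows since the lower bound exceeds 1/(2e) before every time
in `boundTimes`. -/

namespace SpinEcho

open Matrix

noncomputable section

/-! ### Hilbert-Schmidt and operator norms of matrices -/

section Norms

variable {m n k : Type*} [Fintype m] [Fintype n] [Fintype k]

/-- A matrix as a vector of its entries. -/
def hsVec (X : Matrix m n ℂ) : EuclideanSpace ℂ (m × n) := WithLp.toLp 2 fun p => X p.1 p.2

/-- The Hilbert-Schmidt (Frobenius) norm. -/
def hs (X : Matrix m n ℂ) : ℝ := ‖hsVec X‖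

/-- The spectral norm. -/
def opn [DecidableEq n] (X : Matrix n n ℂ) : ℝ := ‖Matrix.toEuclideanCLM (𝕜 := ℂ) X‖

lemma hs_sq (X : Matrix m n ℂ) : hs X ^ 2 = ∑ i, ∑ j, ‖X i j‖ ^ 2 := by
  rw [hs, EuclideanSpace.norm_sq_eq, Fintype.sum_prod_type]; rfl

lemma hs_sq' (X : Matrix m n ℂ) : hs X ^ 2 = ∑ j, ∑ i, ‖X i j‖ ^ 2 := by
  rw [hs_sq, Finset.sum_comm]

lemma hs_nonneg (X : Matrix m n ℂ) : 0 ≤ hs X := norm_nonneg _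

lemma hs_add_le (X Y : Matrix m n ℂ) : hs (X + Y) ≤ hs X + hs Y := norm_add_le (hsVec X) (hsVec Y)

lemma hs_sub_le (X Y : Matrix m n ℂ) : hs (X - Y) ≤ hs X + hs Y := norm_sub_le (hsVec X) (hsVec Y)

lemma hs_neg (X : Matrix m n ℂ) : hs (-X) = hs X := norm_neg (hsVec X)

lemma hs_zero : hs (0 : Matrix m n ℂ) = 0 := norm_zero (E := EuclideanSpace ℂ (m × n))

lemma hs_conjTranspose (X : Matrix m n ℂ) : hs Xᴴ = hs X := by
  rw [← sq_eq_sq₀ (hs_nonneg _) (hs_nonneg _), hs_sq, hs_sq']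
  simp [conjTranspose_apply]

lemma hs_le_of_norm_le {X K : Matrix m n ℂ} {c : ℝ} (hc : 0 ≤ c)
    (h : ∀ i j, ‖X i j‖ ≤ c * ‖K i j‖) : hs X ≤ c * hs K := by
  refine le_of_sq_le_sq ?_ (mul_nonneg hc (hs_nonneg _))
  rw [mul_pow, hs_sq, hs_sq, Finset.mul_sum]
  refine Finset.sum_le_sum fun i _ => ?_
  rw [Finset.mul_sum]
  refine Finset.sum_le_sum fun j _ => ?_
  rw [← mul_pow]
  exact pow_le_pow_left₀ (norm_nonneg _) (h i j) 2

lemma inner_hsVec (X Y : Matrix m n ℂ) : inner ℂ (hsVec X) (hsVec Y) = (Xᴴ * Y).trace := by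
  simp only [PiLp.inner_apply, hsVec, Fintype.sum_prod_type, Matrix.trace, Matrix.diag_apply,
    Matrix.mul_apply, conjTranspose_apply, RCLike.inner_apply, starRingEnd_apply]
  rw [Finset.sum_comm]
  simp only [mul_comm]

lemma norm_trace_conjTranspose_mul_le (X Y : Matrix m n ℂ) : ‖(Xᴴ * Y).trace‖ ≤ hs X * hs Y := by
  rw [← inner_hsVec]
  exact norm_inner_le_norm _ _

/-- Polarization. Taken with X = ab and Y = ba, it makes the commutator of the diagonal blocks
appear in the echo signal. -/
lemma re_trace_conjTranspose_mul (X Y : Matrix m n ℂ) :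
    (Xᴴ * Y).trace.re = (hs X ^ 2 + hs Y ^ 2 - hs (X - Y) ^ 2) / 2 := by
  have h := @norm_sub_sq ℂ _ _ _ _ (hsVec X) (hsVec Y)
  rw [inner_hsVec] at h
  have h' : hs (X - Y) = ‖hsVec X - hsVec Y‖ := rfl
  rw [h', h]
  simp only [hs, RCLike.re_to_complex]
  ring

lemma trace_conjTranspose_mul_self (X : Matrix m n ℂ) : (Xᴴ * X).trace = ((hs X ^ 2 : ℝ) : ℂ) := by
  rw [← inner_hsVec, inner_self_eq_norm_sq_to_K]
  simp [hs]

lemma hs_sq_add_of_trace_eq_zero {X Y : Matrix m n ℂ} (h : (Xᴴ * Y).trace = 0) :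
    hs (X + Y) ^ 2 = hs X ^ 2 + hs Y ^ 2 := by
  have h' := re_trace_conjTranspose_mul X (-Y)
  rw [Matrix.mul_neg, Matrix.trace_neg, h, sub_neg_eq_add, hs_neg] at h'
  simp at h'
  linarith

/-- Hilbert-Schmidt norms are unchanged by left multiplication with an isometry. -/
lemma hs_mul_of_isometry [DecidableEq n] {U : Matrix m n ℂ} (hU : Uᴴ * U = 1) (X : Matrix n k ℂ) :
    hs (U * X) = hs X := by
  rw [← sq_eq_sq₀ (hs_nonneg _) (hs_nonneg _), ← Complex.ofReal_inj,
    ← trace_conjTranspose_mul_self, ← trace_conjTranspose_mul_self, conjTranspose_mul,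
    Matrix.mul_assoc, ← Matrix.mul_assoc Uᴴ, hU, Matrix.one_mul]

variable [DecidableEq n]

lemma opn_nonneg (X : Matrix n n ℂ) : 0 ≤ opn X := norm_nonneg _

lemma sum_sq_mulVec_le (X : Matrix n n ℂ) (v : n → ℂ) :
    ∑ i, ‖(X *ᵥ v) i‖ ^ 2 ≤ opn X ^ 2 * ∑ i, ‖v i‖ ^ 2 := by
  have h := (Matrix.toEuclideanCLM (𝕜 := ℂ) X).le_opNorm (WithLp.toLp 2 v)
  have h2 := pow_le_pow_left₀ (norm_nonneg _) h 2
  rw [mul_pow, EuclideanSpace.norm_sq_eq, EuclideanSpace.norm_sq_eq] at h2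
  exact h2

lemma opn_le {X : Matrix n n ℂ} {c : ℝ} (hc : 0 ≤ c)
    (h : ∀ v : n → ℂ, ∑ i, ‖(X *ᵥ v) i‖ ^ 2 ≤ c ^ 2 * ∑ i, ‖v i‖ ^ 2) : opn X ≤ c := by
  refine ContinuousLinearMap.opNorm_le_bound _ hc fun v => ?_
  refine le_of_sq_le_sq ?_ (mul_nonneg hc (norm_nonneg _))
  rw [mul_pow, EuclideanSpace.norm_sq_eq, EuclideanSpace.norm_sq_eq]
  exact h v

lemma opn_mul_le (X Y : Matrix n n ℂ) : opn (X * Y) ≤ opn X * opn Y := by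
  unfold opn; rw [map_mul]; exact norm_mul_le _ _

lemma opn_add_le (X Y : Matrix n n ℂ) : opn (X + Y) ≤ opn X + opn Y := by
  unfold opn; rw [map_add]; exact norm_add_le _ _

lemma opn_sub_le (X Y : Matrix n n ℂ) : opn (X - Y) ≤ opn X + opn Y := by
  unfold opn; rw [map_sub]; exact norm_sub_le _ _

lemma opn_conjTranspose (X : Matrix n n ℂ) : opn Xᴴ = opn X := by
  unfold opn; rw [← Matrix.star_eq_conjTranspose, map_star]; exact norm_star (Matrix.toEuclideanCLM (𝕜 := ℂ) X)

lemma opn_diagonal_le {d : n → ℂ} {c : ℝ} (hc : 0 ≤ c) (h : ∀ i, ‖d i‖ ≤ c) :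
    opn (diagonal d) ≤ c := by
  refine opn_le hc fun v => ?_
  rw [Finset.mul_sum]
  refine Finset.sum_le_sum fun i _ => ?_
  rw [mulVec_diagonal, norm_mul, mul_pow]
  gcongr
  exact h i

lemma hs_mul_le (X : Matrix n n ℂ) (Y : Matrix n k ℂ) : hs (X * Y) ≤ opn X * hs Y := by
  refine le_of_sq_le_sq ?_ (mul_nonneg (opn_nonneg _) (hs_nonneg _))
  rw [mul_pow, hs_sq', hs_sq', Finset.mul_sum]
  exact Finset.sum_le_sum fun j _ => sum_sq_mulVec_le X fun i => Y i j

lemma hs_mul_le' (X : Matrix m n ℂ) (Y : Matrix n n ℂ) : hs (X * Y) ≤ hs X * opn Y := by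
  rw [← hs_conjTranspose, conjTranspose_mul, mul_comm (hs X), ← opn_conjTranspose,
    ← hs_conjTranspose X]
  exact hs_mul_le _ _

/-- The Schur test. -/
lemma opn_le_of_sum_le {X : Matrix n n ℂ} {r c : ℝ} (hr : 0 ≤ r)
    (hrow : ∀ i, ∑ j, ‖X i j‖ ≤ r) (hcol : ∀ j, ∑ i, ‖X i j‖ ≤ c) : opn X ≤ √(r * c) := by
  cases isEmpty_or_nonempty n with
  | inl h => exact opn_le (Real.sqrt_nonneg _) fun v => by simp
  | inr h =>
  have hc : 0 ≤ c := le_trans (Finset.sum_nonneg fun i _ => norm_nonneg _) (hcol h.some)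
  refine opn_le (Real.sqrt_nonneg _) fun v => ?_
  rw [Real.sq_sqrt (mul_nonneg hr hc)]
  have h1 : ∀ i, ‖(X *ᵥ v) i‖ ^ 2 ≤ r * ∑ j, ‖X i j‖ * ‖v j‖ ^ 2 := fun i => by
    have h2 : ‖(X *ᵥ v) i‖ ≤ ∑ j, ‖X i j‖ * ‖v j‖ := by
      refine (norm_sum_le _ _).trans (le_of_eq ?_)
      simp
    -- Cauchy-Schwarz with the moduli of the row entries as weights.
    have h3 : (∑ j, ‖X i j‖ * ‖v j‖) ^ 2 ≤ (∑ j, ‖X i j‖) * ∑ j, ‖X i j‖ * ‖v j‖ ^ 2 := by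
      refine Finset.sum_sq_le_sum_mul_sum_of_sq_le_mul _ (fun _ _ => norm_nonneg _)
        (fun _ _ => by positivity) fun j _ => le_of_eq (by ring)
    calc ‖(X *ᵥ v) i‖ ^ 2 ≤ (∑ j, ‖X i j‖ * ‖v j‖) ^ 2 := pow_le_pow_left₀ (norm_nonneg _) h2 2
      _ ≤ _ := h3
      _ ≤ _ := mul_le_mul_of_nonneg_right (hrow i) (Finset.sum_nonneg fun j _ => by positivity)
  calc ∑ i, ‖(X *ᵥ v) i‖ ^ 2 ≤ ∑ i, r * ∑ j, ‖X i j‖ * ‖v j‖ ^ 2 := Finset.sum_le_sum fun i _ => h1 i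
    _ = r * ∑ j, (∑ i, ‖X i j‖) * ‖v j‖ ^ 2 := by
      rw [← Finset.mul_sum, Finset.sum_comm]; simp only [Finset.sum_mul]
    _ ≤ r * ∑ j, c * ‖v j‖ ^ 2 := by
      gcongr with j
      exact hcol j
    _ = _ := by rw [← Finset.mul_sum, mul_assoc]

/-- A Sylvester equation `D₁ X - X D₂ = K` with diagonal `D₁ ≥ p > q ≥ D₂`. -/
lemma sub_mul_opn_le_of_sylvester {X K : Matrix n n ℂ} {d₁ d₂ : n → ℝ} {p q : ℝ} (hpq : q < p)
    (h₁ : ∀ i, p ≤ d₁ i) (h₂ : ∀ j, d₂ j ≤ q)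
    (h : ∀ i j, ((d₁ i : ℂ) - d₂ j) * X i j = K i j) : (p - q) * opn X ≤ opn K := by
  -- `R` dominates the spread of `d₂` below `q`. Measured from q - R, the spectrum of D₂ lies in [0,
  -- R] and that of D₁ above p - q + R. Solving for X through the inverse of the shifted D₁ then
  -- gives (p - q + R)‖X‖ ≤ R‖X‖ + ‖K‖, and R cancels.
  set R : ℝ := ∑ j, (q - d₂ j) with hR
  have hRj : ∀ j, q - d₂ j ≤ R := fun j =>
    Finset.single_le_sum (f := fun j => q - d₂ j) (fun i _ => sub_nonneg.2 (h₂ i))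
      (Finset.mem_univ j)
  have hR0 : 0 ≤ R := Finset.sum_nonneg fun i _ => sub_nonneg.2 (h₂ i)
  have hX : X = diagonal (fun i => (((d₁ i - (q - R))⁻¹ : ℝ) : ℂ)) *
      (X * diagonal (fun j => ((d₂ j - (q - R) : ℝ) : ℂ)) + K) := by
    ext i j
    rw [diagonal_mul, Matrix.add_apply, mul_diagonal, ← h i j]
    have hne : ((d₁ i - (q - R) : ℝ) : ℂ) ≠ 0 := by
      have := h₁ i
      exact_mod_cast (by linarith : 0 < d₁ i - (q - R)).ne'
    rw [Complex.ofReal_inv, eq_inv_mul_iff_mul_eq₀ hne]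
    push_cast
    ring
  have hD : opn (diagonal (fun i => (((d₁ i - (q - R))⁻¹ : ℝ) : ℂ))) ≤ (p - (q - R))⁻¹ := by
    refine opn_diagonal_le (inv_nonneg.2 (by linarith)) fun i => ?_
    have := h₁ i
    rw [Complex.norm_real, Real.norm_of_nonneg (inv_nonneg.2 (by linarith))]
    exact inv_anti₀ (by linarith) (by linarith)
  have hE : opn (diagonal (fun j => ((d₂ j - (q - R) : ℝ) : ℂ))) ≤ R := by
    refine opn_diagonal_le hR0 fun i => ?_
    have := h₂ i
    have := hRj i
    rw [Complex.norm_real, Real.norm_of_nonneg (by linarith)]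
    linarith
  have hle : opn X ≤ (p - (q - R))⁻¹ * (opn X * R + opn K) := by
    conv_lhs => rw [hX]
    refine (opn_mul_le _ _).trans (mul_le_mul hD ?_ (opn_nonneg _) (inv_nonneg.2 (by linarith)))
    refine (opn_add_le _ _).trans (add_le_add_left ((opn_mul_le _ _).trans ?_) _)
    exact mul_le_mul_of_nonneg_left hE (opn_nonneg _)
  rw [le_inv_mul_iff₀ (by linarith)] at hle
  linarith

end Norms

/-! ### Unitary evolution -/

section Evolution

variable {n k : Type*} [Fintype n] [DecidableEq n] [Fintype k] [DecidableEq k]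

/-- The diagonal form of a Hermitian matrix and of the evolution it generates. -/
lemma exists_diagonal_evolution {H : Matrix n n ℂ} (hH : H.IsHermitian) (τ : ℝ) :
    ∃ (T : Matrix n n ℂ) (E : n → ℝ), Tᴴ * T = 1 ∧ T * Tᴴ = 1 ∧
      H = T * diagonal (fun i => (E i : ℂ)) * Tᴴ ∧
      NormedSpace.exp ((Complex.I * (τ : ℂ)) • H)
        = T * diagonal (fun i => Complex.exp (Complex.I * ((τ * E i : ℝ) : ℂ))) * Tᴴ := by
  set T : Matrix n n ℂ := hH.eigenvectorUnitary.1 with hT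
  have h1 : Tᴴ * T = 1 := Unitary.coe_star_mul_self hH.eigenvectorUnitary
  have h2 : T * Tᴴ = 1 := Unitary.coe_mul_star_self hH.eigenvectorUnitary
  have h3 : H = T * diagonal (fun i => (hH.eigenvalues i : ℂ)) * Tᴴ := by
    have := hH.spectral_theorem
    rw [Unitary.conjStarAlgAut_apply] at this
    exact this
  refine ⟨T, hH.eigenvalues, h1, h2, h3, ?_⟩
  have hTu : IsUnit T := IsUnit.of_mul_eq_one _ h2
  have hinv : T⁻¹ = Tᴴ := Matrix.inv_eq_right_inv h2
  have h4 : (Complex.I * (τ : ℂ)) • H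
      = T * diagonal (fun i => Complex.I * ((τ * hH.eigenvalues i : ℝ) : ℂ)) * T⁻¹ := by
    conv_lhs => rw [h3]
    rw [hinv, ← Matrix.smul_mul, ← Matrix.mul_smul]
    congr 2
    ext i j
    by_cases hij : i = j
    · subst hij; simp [mul_assoc]
    · simp [hij]
  rw [h4, Matrix.exp_conj _ _ hTu, Matrix.exp_diagonal, hinv]
  congr 2
  ext i j
  by_cases hij : i = j
  · subst hij; simp [Pi.coe_exp, Complex.exp_eq_exp_ℂ]
  · simp [hij]

lemma norm_exp_sub_exp_le (x y : ℝ) :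
    ‖Complex.exp (Complex.I * x) - Complex.exp (Complex.I * y)‖ ≤ |x - y| := by
  have h : Complex.exp (Complex.I * x) - Complex.exp (Complex.I * y)
      = Complex.exp (Complex.I * y) * (Complex.exp (Complex.I * ((x - y : ℝ) : ℂ)) - 1) := by
    rw [mul_sub, ← Complex.exp_add, mul_one]
    congr 2
    push_cast
    ring
  rw [h, norm_mul, mul_comm Complex.I (y : ℂ), Complex.norm_exp_ofReal_mul_I, one_mul]
  simpa using Real.norm_exp_I_mul_ofReal_sub_one_le (x := x - y)

/-- The evolution of approximate eigenvectors stays close to a phase. -/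
lemma hs_evolution_sub_le {H : Matrix n n ℂ} (hH : H.IsHermitian) (τ : ℝ) (X : Matrix n k ℂ)
    (l : k → ℝ) :
    hs (NormedSpace.exp ((Complex.I * (τ : ℂ)) • H) * X
        - X * diagonal (fun i => Complex.exp (Complex.I * ((τ * l i : ℝ) : ℂ))))
      ≤ |τ| * hs (H * X - X * diagonal (fun i => (l i : ℂ))) := by
  obtain ⟨T, E, h1, h2, h3, h4⟩ := exists_diagonal_evolution hH τ
  have hT' : Tᴴᴴ * Tᴴ = 1 := by rw [conjTranspose_conjTranspose]; exact h2
  rw [← hs_mul_of_isometry hT', ← hs_mul_of_isometry hT' (H * X - _)]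
  -- In the eigenbasis of `H` both sides act entrywise, by a difference of phases and by the
  -- difference of the corresponding energies; the first is at most |τ| times the second, so no
  -- Duhamel integral is needed.
  refine hs_le_of_norm_le (abs_nonneg _) fun i j => ?_
  rw [h4]
  conv_rhs => rw [h3]
  have e1 : ∀ D : Matrix n n ℂ, ∀ D' : Matrix k k ℂ,
      Tᴴ * (T * D * Tᴴ * X - X * D') = D * (Tᴴ * X) - (Tᴴ * X) * D' := fun D D' => by
    rw [Matrix.mul_sub, Matrix.mul_assoc T, Matrix.mul_assoc T, ← Matrix.mul_assoc Tᴴ T, h1,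
      Matrix.one_mul, Matrix.mul_assoc, Matrix.mul_assoc]
  rw [e1, e1, Matrix.sub_apply, Matrix.sub_apply, diagonal_mul, mul_diagonal, diagonal_mul,
    mul_diagonal, mul_comm _ (Complex.exp _), ← sub_mul, mul_comm _ (l j : ℂ), ← sub_mul, norm_mul,
    norm_mul, ← mul_assoc]
  refine mul_le_mul_of_nonneg_right ((norm_exp_sub_exp_le _ _).trans (le_of_eq ?_)) (norm_nonneg _)
  rw [← mul_sub, abs_mul, ← Complex.ofReal_sub, Complex.norm_real, Real.norm_eq_abs]

lemma evolution_isometry {H : Matrix n n ℂ} (hH : H.IsHermitian) (τ : ℝ) :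
    (NormedSpace.exp ((Complex.I * (τ : ℂ)) • H))ᴴ * NormedSpace.exp ((Complex.I * (τ : ℂ)) • H)
      = 1 := by
  obtain ⟨T, E, h1, h2, h3, h4⟩ := exists_diagonal_evolution hH τ
  rw [h4, conjTranspose_mul, conjTranspose_mul, conjTranspose_conjTranspose]
  have : T * ((diagonal fun i => Complex.exp (Complex.I * ((τ * E i : ℝ) : ℂ)))ᴴ * Tᴴ)
      * (T * (diagonal fun i => Complex.exp (Complex.I * ((τ * E i : ℝ) : ℂ))) * Tᴴ)
      = T * ((diagonal fun i => Complex.exp (Complex.I * ((τ * E i : ℝ) : ℂ)))ᴴ * (Tᴴ * T)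
      * (diagonal fun i => Complex.exp (Complex.I * ((τ * E i : ℝ) : ℂ)))) * Tᴴ := by
    simp only [Matrix.mul_assoc]
  rw [this, h1, Matrix.mul_one, diagonal_conjTranspose, diagonal_mul_diagonal]
  have : (fun i => star (fun i => Complex.exp (Complex.I * ((τ * E i : ℝ) : ℂ))) i
      * Complex.exp (Complex.I * ((τ * E i : ℝ) : ℂ))) = fun _ => 1 := by
    ext i
    rw [Pi.star_apply, RCLike.star_def, ← Complex.exp_conj, ← Complex.exp_add]
    simp
  rw [this, diagonal_one, Matrix.mul_one, h2]

lemma evolution_commute {H D : Matrix n n ℂ} (h : Commute H D) (τ : ℂ) :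
    NormedSpace.exp (τ • H) * D = D * NormedSpace.exp (τ • H) := by
  open scoped Matrix.Norms.L2Operator in
  exact ((h.smul_left τ).exp_left).eq

end Evolution

end

end SpinEcho

namespace SpinEcho

open Matrix

noncomputable section

/-! ### The Hamiltonian in the joint `z` basis -/

/-- The number of down spins of a nuclear configuration. -/
def downs {N : ℕ} (z : Fin N → Bool) : ℕ := (Finset.univ.filter fun j => z j = false).card

lemma numDown_true {N : ℕ} (z : Fin N → Bool) : numDown (true, z) = downs z := by
  simp [numDown, downs]

lemma numDown_false {N : ℕ} (z : Fin N → Bool) : numDown (false, z) = downs z + 1 := by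
  simp [numDown, downs, add_comm]

def sgn (b : Bool) : ℝ := if b then 1 else -1

lemma spinZ_apply (h : ℝ) (b b' : Bool) :
    spinZ h b b' = if b = b' then ((h / 2 * sgn b : ℝ) : ℂ) else 0 := by
  cases b <;> cases b' <;> simp [spinZ, ketBra, ketUp, ketDown, vecMulVec_apply, sgn]

lemma onElectron_apply {N : ℕ} (M : Matrix Bool Bool ℂ) (s s' : Bool) (z z' : Fin N → Bool) :
    onElectron N M (s, z) (s', z') = if z = z' then M s s' else 0 := by
  simp [onElectron, kroneckerMap_apply, Matrix.one_apply]

lemma onElectron_spinZ {N : ℕ} (h : ℝ) :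
    onElectron N (spinZ h) = diagonal fun s => ((h / 2 * sgn s.1 : ℝ) : ℂ) := by
  ext ⟨s, z⟩ ⟨s', z'⟩
  rw [onElectron_apply, spinZ_apply, diagonal_apply]
  by_cases h1 : s = s' <;> by_cases h2 : z = z' <;> simp [h1, h2]

lemma onNucleus_spinZ {N : ℕ} (h : ℝ) (j : Fin N) :
    onNucleus j (spinZ h) = diagonal fun s => ((h / 2 * sgn (s.2 j) : ℝ) : ℂ) := by
  ext ⟨s, z⟩ ⟨s', z'⟩
  rw [diagonal_apply]
  simp only [onNucleus, kroneckerMap_apply, Matrix.one_apply, Matrix.of_apply, spinZ_apply,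
    Prod.mk.injEq]
  by_cases h1 : s = s'
  · by_cases h2 : z = z'
    · simp [h1, h2]
    · have : ¬ ((∀ i, i ≠ j → z i = z' i) ∧ z j = z' j) := fun hh => h2 <| by
        ext i
        by_cases hi : i = j
        · rw [hi, hh.2]
        · rw [hh.1 i hi]
      by_cases h3 : ∀ i, i ≠ j → z i = z' i
      · have h4 : z j ≠ z' j := fun h4 => this ⟨h3, h4⟩
        simp [h2, h4]
      · simp [h2, h3]
  · simp [h1]

lemma sum_sgn {N : ℕ} (z : Fin N → Bool) : ∑ j, sgn (z j) = N - 2 * (downs z : ℝ) := by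
  have h : ∀ j, sgn (z j) = 1 - 2 * (if z j = false then (1 : ℝ) else 0) := fun j => by
    cases z j <;> norm_num [sgn]
  simp_rw [h, Finset.sum_sub_distrib, ← Finset.mul_sum]
  simp [downs]

namespace SpinBath

variable {N : ℕ} (P : SpinBath N)

/-- The energy `H₀ - γ_I B J_z` of a configuration with electron up. -/
def upEnergy (z : Fin N → Bool) : ℝ :=
  (P.gammaS - P.gammaI) * P.B * P.hbar / 2 + P.hbar ^ 2 / 4 * ∑ j, P.A j * sgn (z j)

lemma Jz_eq : P.Jz = diagonal fun s =>
    ((P.hbar / 2 * (N + 1 - 2 * numDown s) : ℝ) : ℂ) := by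
  rw [Jz, onElectron_spinZ]
  simp_rw [onNucleus_spinZ]
  ext ⟨s, z⟩ ⟨s', z'⟩
  rw [Matrix.add_apply, Matrix.sum_apply]
  by_cases h : (s, z) = (s', z')
  · cases h
    simp only [diagonal_apply_eq]
    rw [← Complex.ofReal_sum, ← Complex.ofReal_add, ← Finset.mul_sum, sum_sgn]
    congr 1
    cases s
    · rw [numDown_false]; simp [sgn]; ring
    · rw [numDown_true]; simp [sgn]; ring
  · simp [diagonal_apply_ne _ h]

/-- Subtracting γ_I B J_z removes the nuclear Zeeman terms, so what remains is odd under the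
electron flip. This antisymmetry lets a reflected state of energy E be compared with energy -E. -/
lemma H0rot_eq : P.H0rot = diagonal fun s => ((sgn s.1 * P.upEnergy s.2 : ℝ) : ℂ) := by
  rw [H0rot, H0, Jz, onElectron_spinZ]
  simp_rw [onNucleus_spinZ, diagonal_mul_diagonal]
  ext ⟨s, z⟩ ⟨s', z'⟩
  simp only [Matrix.add_apply, Matrix.sub_apply, Matrix.smul_apply, Matrix.sum_apply]
  by_cases h : (s, z) = (s', z')
  · cases h
    simp only [diagonal_apply_eq, smul_eq_mul, upEnergy]
    have : ∑ x, (P.A x : ℂ) * (((P.hbar / 2 * sgn s : ℝ) : ℂ) * ((P.hbar / 2 * sgn (z x) : ℝ) : ℂ))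
        = (((P.hbar ^ 2 / 4 * sgn s) * ∑ j, P.A j * sgn (z j) : ℝ) : ℂ) := by
      push_cast
      rw [Finset.mul_sum]
      exact Finset.sum_congr rfl fun i _ => by ring
    rw [this]
    push_cast
    ring
  · simp [diagonal_apply_ne _ h]

/-- The part of the flip-flop term that turns electron down into electron up. -/
def flip : Matrix (Fin N → Bool) (Fin N → Bool) ℂ := fun w z =>
  ((∑ j, P.hbar ^ 2 / 2 * P.A j *
    (if (∀ i, i ≠ j → w i = z i) ∧ w j = false ∧ z j = true then 1 else 0) : ℝ) : ℂ)

end SpinBath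

/-- The block of an operator between given electron polarizations. -/
def blk {N : ℕ} (X : Op N) (s s' : Bool) : Matrix (Fin N → Bool) (Fin N → Bool) ℂ :=
  fun z z' => X (s, z) (s', z')

/-! ### Blocks between electron polarizations -/

section Blk

variable {N : ℕ}

lemma blk_add (X Y : Op N) (s s' : Bool) : blk (X + Y) s s' = blk X s s' + blk Y s s' := rfl

lemma blk_mul (X Y : Op N) (s s' : Bool) :
    blk (X * Y) s s' = blk X s true * blk Y true s' + blk X s false * blk Y false s' := by
  ext z z'
  simp [blk, Matrix.mul_apply, Fintype.sum_prod_type]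

lemma blk_conjTranspose (X : Op N) (s s' : Bool) : blk Xᴴ s s' = (blk X s' s)ᴴ := rfl

lemma blk_onElectron (M : Matrix Bool Bool ℂ) (s s' : Bool) :
    blk (onElectron N M) s s' = M s s' • (1 : Matrix (Fin N → Bool) (Fin N → Bool) ℂ) := by
  ext z z'
  simp [blk, onElectron_apply, Matrix.one_apply]

lemma blk_diagonal_self (d : State N → ℂ) (s : Bool) :
    blk (diagonal d) s s = diagonal fun z => d (s, z) := by
  ext z z'
  by_cases h : z = z' <;> simp [blk, h]

lemma blk_diagonal_ne (d : State N → ℂ) {s s' : Bool} (h : s ≠ s') :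
    blk (diagonal d) s s' = 0 := by
  ext z z'
  simp [blk, h]

lemma trace_eq_blk (X : Op N) : X.trace = (blk X true true).trace + (blk X false false).trace := by
  simp [Matrix.trace, blk, Fintype.sum_prod_type]

end Blk

namespace SpinBath

variable {N : ℕ} (P : SpinBath N)

lemma V_apply (s s' : Bool) (w z : Fin N → Bool) :
    P.V (s, w) (s', z) = if s = true ∧ s' = false then P.flip w z
      else if s = false ∧ s' = true then P.flip z w else 0 := by
  have h1 : ∀ (M M' : Matrix Bool Bool ℂ) (j : Fin N),
      (onElectron N M * onNucleus j M') (s, w) (s', z)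
        = M s s' * if ∀ i, i ≠ j → w i = z i then M' (w j) (z j) else 0 := fun M M' j => by
    rw [onElectron, onNucleus, ← Matrix.mul_kronecker_mul, Matrix.mul_one, Matrix.one_mul,
      kroneckerMap_apply, Matrix.of_apply]
  rw [V, Matrix.sum_apply]
  simp only [Matrix.smul_apply, Matrix.add_apply, h1, spinPlus, spinMinus, ketBra, vecMulVec_apply,
    ketUp, ketDown, smul_eq_mul, flip]
  push_cast
  cases s <;> cases s'
  · simp
  · simp only [Bool.false_eq_true, false_and, if_false, true_and, if_true]
    refine Finset.sum_congr rfl fun j _ => ?_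
    have : (∀ i, i ≠ j → z i = w i) ↔ ∀ i, i ≠ j → w i = z i :=
      forall₂_congr fun _ _ => eq_comm
    simp only [this]
    by_cases h : ∀ i, i ≠ j → w i = z i
    · simp only [eq_true h, if_true, true_and]
      cases w j <;> cases z j <;> simp
      ring
    · simp only [h, if_false, false_and]
      simp
  · simp only [true_and, if_true]
    refine Finset.sum_congr rfl fun j _ => ?_
    by_cases h : ∀ i, i ≠ j → w i = z i
    · simp only [eq_true h, if_true, true_and]
      cases w j <;> cases z j <;> simp
      ring
    · simp only [h, if_false, false_and]
      simp
  · simp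

lemma blk_V_up_down : blk P.V true false = P.flip := by
  ext w z; simp [blk, V_apply]

lemma blk_V_down_up : blk P.V false true = P.flipᴴ := by
  ext w z; simp [blk, V_apply, conjTranspose_apply, flip]

lemma blk_V_self (s : Bool) : blk P.V s s = 0 := by
  ext w z; cases s <;> simp [blk, V_apply]

lemma V_isHermitian : P.V.IsHermitian := by
  ext ⟨s, w⟩ ⟨s', z⟩
  cases s <;> cases s' <;> simp [V_apply, conjTranspose_apply, flip]

lemma H_eq : P.H = P.H0rot + P.V + ((P.gammaI * P.B : ℝ) : ℂ) • P.Jz := by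
  rw [H, H0rot]; abel

lemma flip_apply_ne_zero {w z : Fin N → Bool} (h : P.flip w z ≠ 0) : downs w = downs z + 1 := by
  unfold flip at h
  rw [Complex.ofReal_ne_zero] at h
  obtain ⟨j, _, hj⟩ := Finset.exists_ne_zero_of_sum_ne_zero h
  have hj' : (∀ i, i ≠ j → w i = z i) ∧ w j = false ∧ z j = true := by
    by_contra hh; simp [hh] at hj
  obtain ⟨h1, h2, h3⟩ := hj'
  have : (Finset.univ.filter fun i => w i = false)
      = insert j (Finset.univ.filter fun i => z i = false) := by
    ext i
    by_cases hi : i = j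
    · simp [hi, h2]
    · simp [hi, h1 i hi]
  rw [downs, this, Finset.card_insert_of_notMem (by simp [h3]), downs]

end SpinBath

end

end SpinEcho

namespace SpinEcho

open Matrix

noncomputable section

/-! ### Sectors of nuclear configurations -/

section Sectors

variable {N : ℕ} {ι : Type*} [Fintype ι]

/-- The projection onto the nuclear configurations with `k` down spins. -/
def sector (N : ℕ) (k : ℤ) : Matrix (Fin N → Bool) (Fin N → Bool) ℂ :=
  diagonal fun z => if (downs z : ℤ) = k then 1 else 0

/-- `X` changes the number of down spins by `k`. -/
def Raises (k : ℤ) (X : Matrix (Fin N → Bool) (Fin N → Bool) ℂ) : Prop :=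
  ∀ w z, X w z ≠ 0 → (downs w : ℤ) = downs z + k

lemma Raises.mul_sector {k : ℤ} {X : Matrix (Fin N → Bool) (Fin N → Bool) ℂ} (h : Raises k X)
    (j : ℤ) : X * sector N j = sector N (j + k) * X := by
  ext w z
  rw [sector, sector, mul_diagonal, diagonal_mul]
  by_cases hX : X w z = 0
  · simp [hX]
  · have := h w z hX
    by_cases hj : (downs z : ℤ) = j
    · rw [if_pos hj, if_pos (by omega), mul_one, one_mul]
    · rw [if_neg hj, if_neg (by omega), mul_zero, zero_mul]

lemma Raises.mul {j k : ℤ} {X Y : Matrix (Fin N → Bool) (Fin N → Bool) ℂ} (hX : Raises j X)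
    (hY : Raises k Y) : Raises (k + j) (X * Y) := fun w z h => by
  rw [Matrix.mul_apply] at h
  obtain ⟨u, _, hu⟩ := Finset.exists_ne_zero_of_sum_ne_zero h
  rw [hX w u (left_ne_zero_of_mul hu), hY u z (right_ne_zero_of_mul hu), add_assoc]

lemma Raises.conjTranspose {k : ℤ} {X : Matrix (Fin N → Bool) (Fin N → Bool) ℂ}
    (h : Raises k X) : Raises (-k) Xᴴ := fun w z hw => by
  rw [conjTranspose_apply, star_ne_zero] at hw
  have := h z w hw
  omega

/-- The selection rule: it removes from the echo trace every product of blocks that changes the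
number of down nuclei. -/
lemma Raises.diag_eq_zero {k : ℤ} {X : Matrix (Fin N → Bool) (Fin N → Bool) ℂ}
    (h : Raises k X) (hk : k ≠ 0) (z : Fin N → Bool) : X z z = 0 := by
  by_contra hz
  have := h z z hz
  omega

lemma sector_mul_self (k : ℤ) : sector N k * sector N k = sector N k := by
  simp [sector]

lemma sector_conjTranspose (k : ℤ) : (sector N k)ᴴ = sector N k := by
  ext w z
  by_cases h : w = z
  · subst h; simp only [sector, diagonal_apply_eq, conjTranspose_apply]; split_ifs <;> simp
  · simp [sector, diagonal_apply_ne _ h, diagonal_apply_ne _ (Ne.symm h), conjTranspose_apply]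

lemma hs_mul_sector_sq (X : Matrix ι (Fin N → Bool) ℂ) (k : ℤ) :
    hs (X * sector N k) ^ 2 = ∑ z, if (downs z : ℤ) = k then ∑ w, ‖X w z‖ ^ 2 else 0 := by
  rw [hs_sq']
  refine Finset.sum_congr rfl fun z _ => ?_
  by_cases h : (downs z : ℤ) = k <;> simp [sector, h]

/-- The number of nuclear configurations with `k` down spins. -/
def sectorCard (N : ℕ) (k : ℤ) : ℕ :=
  (Finset.univ.filter fun z : Fin N → Bool => (downs z : ℤ) = k).card

lemma hs_sector_sq (k : ℤ) : hs (sector N k) ^ 2 = sectorCard N k := by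
  have h := hs_mul_sector_sq (1 : Matrix (Fin N → Bool) (Fin N → Bool) ℂ) k
  rw [Matrix.one_mul] at h
  rw [h, sectorCard, Finset.card_filter, Nat.cast_sum]
  refine Finset.sum_congr rfl fun z _ => ?_
  by_cases hz : (downs z : ℤ) = k
  · simp only [hz, if_true, Nat.cast_one, Matrix.one_apply]
    rw [Finset.sum_eq_single z] <;> simp +contextual
  · simp [hz]

lemma sectorCard_natCast (k : ℕ) : sectorCard N k = N.choose k := by
  rw [sectorCard, ← Finset.card_fin N, ← Finset.card_powersetCard, Finset.card_fin]
  refine Finset.card_nbij' (fun z => Finset.univ.filter fun j => z j = false)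
    (fun s j => decide (j ∉ s)) ?_ ?_ ?_ ?_
  · intro z hz
    simp only [Finset.coe_filter, Set.mem_ofPred_eq, Finset.mem_univ, true_and, Nat.cast_inj] at hz
    simpa [Finset.mem_powersetCard, downs] using hz
  · intro s hs
    simpa [Finset.mem_powersetCard, downs] using hs
  · intro z _; ext j; simp
  · intro s _; ext j; simp

end Sectors

namespace SpinBath

variable {N : ℕ} (P : SpinBath N)

/-! ### Sums of the largest couplings -/

lemma sum_le_Atop (s : Finset (Fin N)) : ∑ j ∈ s, P.A j ≤ P.Atop s.card :=
  le_ciSup (f := fun s' : {s' : Finset (Fin N) // s'.card = s.card} => ∑ j ∈ s'.1, P.A j)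
    (Set.finite_range _).bddAbove ⟨s, rfl⟩

lemma Atop_nonneg (hA : ∀ j, 0 ≤ P.A j) (k : ℕ) : 0 ≤ P.Atop k :=
  Real.iSup_nonneg fun _ => Finset.sum_nonneg fun j _ => hA j

lemma Amax_nonneg (hA : ∀ j, 0 ≤ P.A j) : 0 ≤ P.Amax := Finset.sum_nonneg fun j _ => hA j

lemma Atop_le_Amax (hA : ∀ j, 0 ≤ P.A j) (k : ℕ) : P.Atop k ≤ P.Amax :=
  Real.iSup_le (fun _ => Finset.sum_le_sum_of_subset_of_nonneg (Finset.subset_univ _)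
    fun j _ _ => hA j) (P.Amax_nonneg hA)

lemma Atop_mono (hA : ∀ j, 0 ≤ P.A j) {k l : ℕ} (hkl : k ≤ l) (hl : l ≤ N) :
    P.Atop k ≤ P.Atop l := by
  refine Real.iSup_le (fun s => ?_) (P.Atop_nonneg hA l)
  obtain ⟨t, hst, -, ht⟩ := Finset.exists_subsuperset_card_eq (Finset.subset_univ s.1)
    (s.2.trans_le hkl) (by simpa using hl)
  rw [← ht]
  exact (Finset.sum_le_sum_of_subset_of_nonneg hst fun j _ _ => hA j).trans (P.sum_le_Atop t)

/-- Choose two different members of s. Removing the first leaves k couplings, and the first itself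
is among the k couplings left after removing the second. -/
lemma sum_le_two_mul_Atop (hA : ∀ j, 0 ≤ P.A j) {k : ℕ} (hk : 1 ≤ k) {s : Finset (Fin N)}
    (hs : s.card = k + 1) : ∑ j ∈ s, P.A j ≤ 2 * P.Atop k := by
  obtain ⟨j, hj⟩ := Finset.card_pos.1 (by omega : 0 < s.card)
  have h1 : (s.erase j).card = k := by rw [Finset.card_erase_of_mem hj]; omega
  obtain ⟨i, hi⟩ := Finset.card_pos.1 (by omega : 0 < (s.erase j).card)
  have h2 : (s.erase i).card = k := by
    rw [Finset.card_erase_of_mem (Finset.mem_of_mem_erase hi)]; omega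
  have h3 := P.sum_le_Atop (s.erase j)
  have h4 := P.sum_le_Atop (s.erase i)
  have h5 : P.A j ≤ ∑ l ∈ s.erase i, P.A l :=
    Finset.single_le_sum (fun l _ => hA l)
      (Finset.mem_erase.2 ⟨(Finset.ne_of_mem_erase hi).symm, hj⟩)
  rw [h1] at h3
  rw [h2] at h4
  rw [← Finset.add_sum_erase s _ hj]
  linarith

/-- Let a be the largest coupling. Put it into a set of size L and also into the complement of that
set; the sums are a + S and a + T, and (a + S)(a + T) ≥ a(a + S + T), which is a times the sum of
all couplings. This lets `Vmax` control Hilbert-Schmidt norms as well as spectral norms. -/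
lemma sum_sq_le_Atop_mul_Atop (hA : ∀ j, 0 ≤ P.A j) {L : ℕ} (h1 : 1 ≤ L) (hL : L ≤ N) :
    ∑ j, P.A j ^ 2 ≤ P.Atop L * P.Atop (N + 1 - L) := by
  have : Nonempty (Fin N) := ⟨⟨0, by omega⟩⟩
  obtain ⟨i, hi⟩ := Finite.exists_max P.A
  obtain ⟨s, his, -, hs⟩ := Finset.exists_subsuperset_card_eq (Finset.subset_univ {i})
    (by simpa using h1) (by simpa using hL)
  rw [Finset.singleton_subset_iff] at his
  have hi' : i ∉ sᶜ := by simpa using his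
  have ht : (insert i sᶜ).card = N + 1 - L := by
    rw [Finset.card_insert_of_notMem hi', Finset.card_compl, Fintype.card_fin]; omega
  have h3 := P.sum_le_Atop s
  have h4 := P.sum_le_Atop (insert i sᶜ)
  rw [hs, ← Finset.add_sum_erase s _ his] at h3
  rw [ht, Finset.sum_insert hi'] at h4
  have h5 : ∑ j, P.A j ^ 2 ≤ P.A i * ∑ j, P.A j := by
    rw [Finset.mul_sum]
    exact Finset.sum_le_sum fun j _ => by
      rw [sq]; exact mul_le_mul_of_nonneg_right (hi j) (hA j)
  have h6 : ∑ j, P.A j = P.A i + ∑ j ∈ s.erase i, P.A j + ∑ j ∈ sᶜ, P.A j := by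
    rw [Finset.add_sum_erase s _ his, Finset.sum_add_sum_compl]
  have h7 : 0 ≤ ∑ j ∈ s.erase i, P.A j := Finset.sum_nonneg fun j _ => hA j
  have h8 : 0 ≤ ∑ j ∈ sᶜ, P.A j := Finset.sum_nonneg fun j _ => hA j
  have h9 := hA i
  refine h5.trans (le_trans ?_ (mul_le_mul h3 h4 (by positivity) (P.Atop_nonneg hA L)))
  rw [h6]
  nlinarith [mul_nonneg h7 h8]

/-! ### The flip-flop matrix -/

lemma card_up (z : Fin N → Bool) : (Finset.univ.filter fun j => z j = true).card + downs z = N := by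
  have h := Finset.card_filter_add_card_filter_not (s := (Finset.univ : Finset (Fin N)))
    fun j => z j = true
  simpa [downs] using h

/-- The indicator that `w` arises from `z` by turning the spin `j` down. -/
def flipAt (j : Fin N) (w z : Fin N → Bool) : ℝ :=
  if (∀ i, i ≠ j → w i = z i) ∧ w j = false ∧ z j = true then 1 else 0

lemma flip_eq (w z : Fin N → Bool) :
    P.flip w z = ((∑ j, P.hbar ^ 2 / 2 * P.A j * flipAt j w z : ℝ) : ℂ) := rfl

lemma flipAt_nonneg (j : Fin N) (w z : Fin N → Bool) : 0 ≤ flipAt j w z := by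
  unfold flipAt; split_ifs <;> norm_num

lemma flipAt_eq_left (j : Fin N) (w z : Fin N → Bool) :
    flipAt j w z = if w = Function.update z j false then (if z j = true then 1 else 0) else 0 := by
  unfold flipAt
  rw [← ite_and]
  congr 1
  rw [eq_iff_iff, Function.eq_update_iff]
  tauto

lemma flipAt_eq_right (j : Fin N) (w z : Fin N → Bool) :
    flipAt j w z = if z = Function.update w j true then (if w j = false then 1 else 0) else 0 := by
  unfold flipAt
  rw [← ite_and]
  congr 1
  rw [eq_iff_iff, Function.eq_update_iff]
  have : (∀ i, i ≠ j → w i = z i) ↔ ∀ i, i ≠ j → z i = w i := forall₂_congr fun _ _ => eq_comm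
  rw [this]
  tauto

lemma sum_flipAt_left (j : Fin N) (z : Fin N → Bool) :
    ∑ w, flipAt j w z = if z j = true then 1 else 0 := by
  simp_rw [flipAt_eq_left]; simp

lemma sum_flipAt_right (j : Fin N) (w : Fin N → Bool) :
    ∑ z, flipAt j w z = if w j = false then 1 else 0 := by
  simp_rw [flipAt_eq_right]; simp

/-- Two configurations joined by a flip differ in a single spin, so squaring an entry of `flip`
produces no cross terms. -/
lemma flipAt_mul_flipAt {j k : Fin N} (w z : Fin N → Bool) :
    flipAt j w z * flipAt k w z = if j = k then flipAt j w z else 0 := by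
  by_cases h : j = k
  · subst h; rw [if_pos rfl]; unfold flipAt; split_ifs <;> norm_num
  · rw [if_neg h]
    unfold flipAt
    by_cases h1 : (∀ i, i ≠ j → w i = z i) ∧ w j = false ∧ z j = true
    · rw [if_neg (c := (∀ i, i ≠ k → w i = z i) ∧ w k = false ∧ z k = true), mul_zero]
      rintro ⟨h2, -, -⟩
      have := h2 j h
      rw [h1.2.1, h1.2.2] at this
      exact Bool.false_ne_true this
    · rw [if_neg h1, zero_mul]

lemma norm_flip_sq (w z : Fin N → Bool) :
    ‖P.flip w z‖ ^ 2 = ∑ j, (P.hbar ^ 2 / 2 * P.A j) ^ 2 * flipAt j w z := by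
  rw [flip_eq, Complex.norm_real, Real.norm_eq_abs, sq_abs, sq, Finset.sum_mul_sum]
  refine Finset.sum_congr rfl fun j _ => ?_
  have : ∀ k, P.hbar ^ 2 / 2 * P.A j * flipAt j w z * (P.hbar ^ 2 / 2 * P.A k * flipAt k w z)
      = if j = k then (P.hbar ^ 2 / 2 * P.A j) ^ 2 * flipAt j w z else 0 := fun k => by
    have h := flipAt_mul_flipAt (j := j) (k := k) w z
    by_cases hjk : j = k
    · subst hjk
      rw [if_pos rfl] at h ⊢
      linear_combination (P.hbar ^ 2 / 2 * P.A j) ^ 2 * h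
    · rw [if_neg hjk] at h ⊢
      linear_combination (P.hbar ^ 2 / 2 * P.A j) * (P.hbar ^ 2 / 2 * P.A k) * h
  simp_rw [this]
  simp

lemma norm_flip (hA : ∀ j, 0 ≤ P.A j) (w z : Fin N → Bool) :
    ‖P.flip w z‖ = ∑ j, P.hbar ^ 2 / 2 * P.A j * flipAt j w z := by
  rw [flip_eq, Complex.norm_real, Real.norm_of_nonneg]
  exact Finset.sum_nonneg fun j _ =>
    mul_nonneg (mul_nonneg (by positivity) (hA j)) (flipAt_nonneg _ _ _)

/-- Each nucleus of a configuration can be turned in exactly one direction, so raising and lowering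
together use every coupling once, independently of the configuration. -/
lemma hs_flip_sq_add (k : ℤ) :
    hs (P.flip * sector N k) ^ 2 + hs (P.flipᴴ * sector N k) ^ 2
      = sectorCard N k * ((P.hbar ^ 2 / 2) ^ 2 * ∑ j, P.A j ^ 2) := by
  rw [hs_mul_sector_sq, hs_mul_sector_sq, ← Finset.sum_add_distrib, sectorCard,
    Finset.card_filter, Nat.cast_sum, Finset.sum_mul]
  refine Finset.sum_congr rfl fun z _ => ?_
  by_cases hz : (downs z : ℤ) = k
  · simp only [hz, if_true, conjTranspose_apply, norm_star, norm_flip_sq, Nat.cast_one, one_mul]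
    rw [Finset.sum_comm, Finset.sum_comm (s := Finset.univ) (t := Finset.univ)
      (f := fun x x_1 => (P.hbar ^ 2 / 2 * P.A x_1) ^ 2 * flipAt x_1 z x),
      ← Finset.sum_add_distrib, Finset.mul_sum]
    refine Finset.sum_congr rfl fun j _ => ?_
    rw [← Finset.mul_sum, ← Finset.mul_sum, sum_flipAt_left, sum_flipAt_right]
    cases z j <;> simp <;> ring
  · simp [hz]

lemma sum_norm_flip_left (hA : ∀ j, 0 ≤ P.A j) (z : Fin N → Bool) :
    ∑ w, ‖P.flip w z‖ = P.hbar ^ 2 / 2 * ∑ j with z j = true, P.A j := by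
  simp_rw [P.norm_flip hA]
  rw [Finset.sum_comm, Finset.mul_sum, Finset.sum_filter]
  refine Finset.sum_congr rfl fun j _ => ?_
  rw [← Finset.mul_sum, sum_flipAt_left]
  simp

lemma sum_norm_flip_right (hA : ∀ j, 0 ≤ P.A j) (w : Fin N → Bool) :
    ∑ z, ‖P.flip w z‖ = P.hbar ^ 2 / 2 * ∑ j with w j = false, P.A j := by
  simp_rw [P.norm_flip hA]
  rw [Finset.sum_comm, Finset.mul_sum, Finset.sum_filter]
  refine Finset.sum_congr rfl fun j _ => ?_
  rw [← Finset.mul_sum, sum_flipAt_right]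
  simp

lemma raises_flip : Raises 1 P.flip := fun w z h => by
  have := P.flip_apply_ne_zero h
  omega

lemma opn_flip_mul_sector_le (hA : ∀ j, 0 ≤ P.A j) {k : ℤ} {a b : ℝ} (ha : 0 ≤ a) (hb : 0 ≤ b)
    (hrow : ∀ w : Fin N → Bool, (downs w : ℤ) = k + 1 → ∑ j with w j = false, P.A j ≤ a)
    (hcol : ∀ z : Fin N → Bool, (downs z : ℤ) = k → ∑ j with z j = true, P.A j ≤ b) :
    opn (P.flip * sector N k) ≤ P.hbar ^ 2 / 2 * √(a * b) := by
  have hg : (0 : ℝ) ≤ P.hbar ^ 2 / 2 := by positivity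
  have h : P.hbar ^ 2 / 2 * √(a * b) = √((P.hbar ^ 2 / 2 * a) * (P.hbar ^ 2 / 2 * b)) := by
    rw [mul_mul_mul_comm, Real.sqrt_mul (mul_nonneg hg hg) (a * b), Real.sqrt_mul_self hg]
  have he : ∀ w z, ‖(P.flip * sector N k) w z‖ ≤ ‖P.flip w z‖ := fun w z => by
    rw [sector, mul_diagonal]; split_ifs <;> simp
  rw [h]
  refine opn_le_of_sum_le (by positivity) (fun w => ?_) fun z => ?_
  · by_cases hw : (downs w : ℤ) = k + 1
    · refine (Finset.sum_le_sum fun z _ => he w z).trans ?_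
      rw [P.sum_norm_flip_right hA]
      exact mul_le_mul_of_nonneg_left (hrow w hw) hg
    · rw [P.raises_flip.mul_sector]
      refine le_of_eq_of_le (Finset.sum_eq_zero fun z _ => ?_) (by positivity)
      simp [sector, hw]
  · by_cases hz : (downs z : ℤ) = k
    · refine (Finset.sum_le_sum fun w _ => he w z).trans ?_
      rw [P.sum_norm_flip_left hA]
      exact mul_le_mul_of_nonneg_left (hcol z hz) hg
    · refine le_of_eq_of_le (Finset.sum_eq_zero fun w _ => ?_) (by positivity)
      simp [sector, hz]

/-- Schur test: a nonzero row collects the couplings of the n + 1 down spins of the target, a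
nonzero column those of the N - n up spins of the source. -/
lemma opn_flip_le_Vmax (hA : ∀ j, 0 ≤ P.A j) {n : ℕ} (hn : n + 1 ≤ N) :
    opn (P.flip * sector N n) ≤ P.Vmax (n + 1) := by
  have h := P.opn_flip_mul_sector_le hA (k := n) (P.Atop_nonneg hA (n + 1))
    (P.Atop_nonneg hA (N + 1 - (n + 1))) (fun w hw => ?_) fun z hz => ?_
  · refine h.trans (le_of_eq ?_)
    rw [Vmax]; ring
  · have : (Finset.univ.filter fun j => w j = false).card = n + 1 := by
      have : downs w = n + 1 := by omega
      exact this
    rw [← this]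
    exact P.sum_le_Atop _
  · have : (Finset.univ.filter fun j => z j = true).card = N + 1 - (n + 1) := by
      have := card_up z
      omega
    rw [← this]
    exact P.sum_le_Atop _

/-- The neighbouring block is needed for the dressed states, but everything is to be measured by one
`Vmax`. Its columns have one up spin too many, which costs a factor 2 in the column sum and so √2 in
the norm. -/
lemma opn_flip_pred_le_Vmax (hA : ∀ j, 0 ≤ P.A j) {n : ℕ} (hn : n + 1 ≤ N) :
    opn (P.flip * sector N (n - 1)) ≤ √2 * P.Vmax (n + 1) := by
  have h0 := P.Atop_nonneg hA (N + 1 - (n + 1))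
  have h := P.opn_flip_mul_sector_le hA (k := n - 1) (P.Atop_nonneg hA (n + 1))
    (by positivity : 0 ≤ 2 * P.Atop (N + 1 - (n + 1))) (fun w hw => ?_) fun z hz => ?_
  · refine h.trans (le_of_eq ?_)
    rw [Vmax, mul_left_comm, Real.sqrt_mul zero_le_two]; ring
  · have : (Finset.univ.filter fun j => w j = false).card = n := by
      have : downs w = n := by omega
      exact this
    refine (P.sum_le_Atop _).trans ?_
    rw [this]
    exact P.Atop_mono hA (Nat.le_succ n) hn
  · refine P.sum_le_two_mul_Atop hA (by omega) ?_
    have := card_up z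
    omega

/-! ### Energies -/

/-- A lower bound for `upEnergy` with `k` nuclear spins down. -/
def lowUp (k : ℕ) : ℝ :=
  (P.gammaS - P.gammaI) * P.B * P.hbar / 2 + P.hbar ^ 2 / 4 * (P.Amax - 2 * P.Atop k)

lemma lowUp_le_upEnergy (z : Fin N → Bool) : P.lowUp (downs z) ≤ P.upEnergy z := by
  have h : ∑ j, P.A j * sgn (z j) = P.Amax - 2 * ∑ j with z j = false, P.A j := by
    rw [Amax, Finset.mul_sum, Finset.sum_filter, ← Finset.sum_sub_distrib]
    refine Finset.sum_congr rfl fun j _ => ?_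
    cases z j <;> simp [sgn]
    ring
  rw [lowUp, upEnergy, h]
  have := P.sum_le_Atop (Finset.univ.filter fun j => z j = false)
  gcongr
  exact this

lemma lowUp_anti (hA : ∀ j, 0 ≤ P.A j) {k l : ℕ} (hkl : k ≤ l) (hl : l ≤ N) :
    P.lowUp l ≤ P.lowUp k := by
  have := P.Atop_mono hA hkl hl
  rw [lowUp, lowUp]
  gcongr

/-- The gap of the theorem is a sum of two one-sided bounds because in the rotating frame a down
energy is minus an up energy. -/
lemma gap_eq (n : ℕ) :
    P.E0minUp (n + 1) - P.E0maxDown (n + 1) = P.lowUp (n + 1) + P.lowUp n := by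
  simp only [E0minUp, E0maxDown, lowUp, Nat.add_sub_cancel]
  push_cast
  ring

lemma Vmax_nonneg (L : ℕ) : 0 ≤ P.Vmax L := by unfold Vmax; positivity

/-- The field condition enters the proof only here: it makes the gap exceed ħ²A_max - ħ²A_max/2,
while V_max ≤ ħ²A_max/2. -/
lemma Vmax_lt_gap (hhbar : 0 < P.hbar) (hgamma : P.gammaI < P.gammaS) (hA : ∀ j, 0 ≤ P.A j)
    (hB : P.Bc < P.B) (n : ℕ) : P.Vmax (n + 1) < P.lowUp (n + 1) + P.lowUp n := by
  have h1 : P.hbar * P.Amax < (P.gammaS - P.gammaI) * P.B := by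
    rw [Bc, div_lt_iff₀ (sub_pos.2 hgamma)] at hB
    linarith
  have h2 : P.Vmax (n + 1) ≤ 1 / 2 * P.hbar ^ 2 * P.Amax := by
    rw [Vmax]
    refine mul_le_mul_of_nonneg_left ?_ (by positivity)
    rw [Real.sqrt_le_left (P.Amax_nonneg hA), sq]
    exact mul_le_mul (P.Atop_le_Amax hA _) (P.Atop_le_Amax hA _) (P.Atop_nonneg hA _)
      (P.Amax_nonneg hA)
  have h3 := P.Atop_le_Amax hA (n + 1)
  have h4 := P.Atop_le_Amax hA n
  have h5 := mul_lt_mul_of_pos_left h1 hhbar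
  have h6 : 0 ≤ P.hbar ^ 2 * (P.Amax - P.Atop (n + 1)) :=
    mul_nonneg (by positivity) (by linarith)
  have h7 : 0 ≤ P.hbar ^ 2 * (P.Amax - P.Atop n) := mul_nonneg (by positivity) (by linarith)
  rw [lowUp, lowUp]
  nlinarith

end SpinBath

end

end SpinEcho

namespace SpinEcho

open Matrix

noncomputable section

/-! ### Operators conserving the total number of down spins -/

section Conserving

variable {N : ℕ} {ι : Type*} [Fintype ι]

def Conserves (U : Op N) : Prop := ∀ s s', U s s' ≠ 0 → numDown s = numDown s'

lemma Conserves.raises_self {U : Op N} (h : Conserves U) (s : Bool) : Raises 0 (blk U s s) :=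
  fun w z hwz => by
    have := h _ _ hwz
    cases s <;> simp only [numDown_true, numDown_false] at this <;> omega

lemma Conserves.raises_up_down {U : Op N} (h : Conserves U) : Raises 1 (blk U true false) :=
  fun w z hwz => by
    have := h _ _ hwz
    simp only [numDown_true, numDown_false] at this
    omega

lemma Conserves.raises_down_up {U : Op N} (h : Conserves U) : Raises (-1) (blk U false true) :=
  fun w z hwz => by
    have := h _ _ hwz
    simp only [numDown_true, numDown_false] at this
    omega

lemma conserves_of_commute {U : Op N}
    (h : U * diagonal (fun s => (numDown s : ℂ)) = diagonal (fun s => (numDown s : ℂ)) * U) :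
    Conserves U := fun s s' hs => by
  have := congrFun (congrFun h s) s'
  rw [mul_diagonal, diagonal_mul, mul_comm] at this
  exact_mod_cast (mul_right_cancel₀ hs this).symm

lemma Conserves.commute {U : Op N} (h : Conserves U) :
    Commute U (diagonal (fun s => (numDown s : ℂ))) := by
  ext s s'
  rw [mul_diagonal, diagonal_mul, mul_comm]
  by_cases hs : U s s' = 0
  · simp [hs]
  · rw [h s s' hs]

/-- Isometries preserve the total Hilbert-Schmidt norm of a column of blocks. -/
lemma hs_blk_mul_sq_add {U : Op N} (hU : Uᴴ * U = 1) (s : Bool)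
    (X : Matrix (Fin N → Bool) ι ℂ) :
    hs (blk U true s * X) ^ 2 + hs (blk U false s * X) ^ 2 = hs X ^ 2 := by
  have h : (blk U true s)ᴴ * blk U true s + (blk U false s)ᴴ * blk U false s = 1 := by
    have h1 : blk (Uᴴ * U) s s = blk (1 : Op N) s s := by rw [hU]
    rw [blk_mul] at h1
    rw [← blk_conjTranspose, ← blk_conjTranspose, h1, ← diagonal_one, blk_diagonal_self,
      diagonal_one]
  rw [← Complex.ofReal_inj, Complex.ofReal_add, ← trace_conjTranspose_mul_self,
    ← trace_conjTranspose_mul_self, ← trace_conjTranspose_mul_self, ← Matrix.trace_add]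
  congr 1
  simp only [conjTranspose_mul, Matrix.mul_assoc]
  rw [← Matrix.mul_add, ← Matrix.mul_assoc, ← Matrix.mul_assoc (blk U false s)ᴴ, ← Matrix.add_mul,
    h, Matrix.one_mul]

lemma hs_blk_mul_le {U : Op N} (hU : Uᴴ * U = 1) (s s' : Bool) (X : Matrix (Fin N → Bool) ι ℂ) :
    hs (blk U s s' * X) ≤ hs X := by
  refine le_of_sq_le_sq ?_ (hs_nonneg _)
  have := hs_blk_mul_sq_add hU s' X
  have := sq_nonneg (hs (blk U true s' * X))
  have := sq_nonneg (hs (blk U false s' * X))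
  cases s <;> linarith

lemma opn_blk_le {U : Op N} (hU : Uᴴ * U = 1) (s s' : Bool) : opn (blk U s s') ≤ 1 := by
  refine opn_le zero_le_one fun v => ?_
  have h := hs_blk_mul_le hU s s' (Matrix.of fun i (_ : Unit) => v i)
  have h2 := pow_le_pow_left₀ (hs_nonneg _) h 2
  rw [hs_sq, hs_sq] at h2
  simpa [Matrix.mul_apply, Matrix.mulVec, dotProduct] using h2

end Conserving

/-! ### The echo signal in blocks -/

section Echo

variable {N : ℕ}

/-- The contribution of the nuclear configuration `z` to the echo signal of the evolution `Y`. -/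
def echoTerm (Y : Op N) (z : Fin N → Bool) : ℂ :=
  ∑ s, ∑ s', ((blk Y true s')ᴴ * blk Y false s) z z

/-- The π/2 pulse turns electron down into (up + down)/√2, so after it all four electron blocks of
the state are half the nuclear state. Hence the factor 1/2 and the unrestricted sum over
polarizations in `echoTerm`. -/
lemma trace_echo (Y rho : Op N) (q : (Fin N → Bool) → ℂ) (h0 : blk rho false false = diagonal q)
    (h1 : ∀ s s', s = true ∨ s' = true → blk rho s s' = 0) :
    ((Rhalf N).conjTranspose * Y.conjTranspose * onElectron N (ketBra ketUp ketDown)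
      * Y * Rhalf N * rho).trace = 1 / 2 * ∑ z, q z * echoTerm Y z := by
  have hR : ∀ s, blk (Rhalf N) s false = ((√2 : ℝ) : ℂ)⁻¹ • 1 := fun s => by
    rw [Rhalf, blk_onElectron]
    cases s <;> simp [ketBra, ketLeft, ketRight, ketUp, ketDown, vecMulVec_apply]
  have hrho : ∀ s s', blk (Rhalf N * rho * (Rhalf N)ᴴ) s s' = (1 / 2 : ℂ) • diagonal q :=
    fun s s' => by
      rw [blk_mul, blk_mul, blk_mul, h0, h1 true true (by simp), h1 true false (by simp),
        h1 false true (by simp), blk_conjTranspose, blk_conjTranspose, hR, hR]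
      simp [smul_smul]
      rw [← mul_inv, ← Complex.ofReal_mul, Real.mul_self_sqrt zero_le_two]
      simp
  have hY : ∀ s s', blk (Y.conjTranspose * onElectron N (ketBra ketUp ketDown) * Y) s s'
      = (blk Y true s)ᴴ * blk Y false s' := fun s s' => by
    rw [blk_mul, blk_mul, blk_mul, blk_conjTranspose, blk_conjTranspose]
    simp only [blk_onElectron]
    simp [ketBra, ketUp, ketDown, vecMulVec_apply]
  have hc : ((Rhalf N).conjTranspose * Y.conjTranspose * onElectron N (ketBra ketUp ketDown)
      * Y * Rhalf N * rho).trace = ((Y.conjTranspose * onElectron N (ketBra ketUp ketDown) * Y)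
      * (Rhalf N * rho * (Rhalf N)ᴴ)).trace := by
    have : (Rhalf N).conjTranspose * Y.conjTranspose * onElectron N (ketBra ketUp ketDown)
      * Y * Rhalf N * rho = (Rhalf N)ᴴ * ((Y.conjTranspose * onElectron N (ketBra ketUp ketDown)
      * Y) * (Rhalf N * rho)) := by simp only [Matrix.mul_assoc]
    rw [this, Matrix.trace_mul_comm]
    simp only [Matrix.mul_assoc]
  rw [hc, trace_eq_blk, blk_mul _ (Rhalf N * rho * (Rhalf N)ᴴ),
    blk_mul _ (Rhalf N * rho * (Rhalf N)ᴴ)]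
  simp only [hY, hrho, Matrix.mul_smul, Matrix.trace_smul, Matrix.trace_add, smul_eq_mul]
  have ht : ∀ X : Matrix (Fin N → Bool) (Fin N → Bool) ℂ,
      (X * diagonal q).trace = ∑ z, q z * X z z := fun X => by
    simp [Matrix.trace, mul_comm]
  rw [← mul_add, ← mul_add, ← mul_add]
  congr 1
  simp only [ht, echoTerm, Fintype.sum_bool, mul_add, Finset.sum_add_distrib]

lemma blk_echo (U : Op N) (s s' : Bool) : blk (U * Rpi N * U) s s'
    = blk U s false * blk U true s' + blk U s true * blk U false s' := by
  have h : ∀ s s', blk (Rpi N) s s' = if s = s' then 0 else 1 := fun s s' => by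
    rw [Rpi, blk_onElectron]
    cases s <;> cases s' <;> simp [ketBra, ketUp, ketDown, vecMulVec_apply]
  rw [blk_mul, blk_mul, blk_mul]
  simp [h]

/-- Diagonal blocks of U R_π U change the number of down nuclei by ±1. The up-down block consists of
changes by 0 and 2, the down-up block of changes by 0 and -2. Overlaps of parts with different
changes have zero diagonal. -/
lemma echoTerm_eq {U : Op N} (hU : Conserves U) (z : Fin N → Bool) :
    echoTerm (U * Rpi N * U) z
      = ((blk U true true * blk U false false)ᴴ * (blk U false false * blk U true true)) z z
        + ((blk (U * Rpi N * U) true true)ᴴ * blk (U * Rpi N * U) false false) z z := by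
  have ra := hU.raises_self true
  have rb := hU.raises_self false
  have rc := hU.raises_up_down
  have rd := hU.raises_down_up
  have key : ∀ {j k : ℤ} {X Y : Matrix (Fin N → Bool) (Fin N → Bool) ℂ}, Raises j X → Raises k Y →
      j ≠ k → (Xᴴ * Y) z z = 0 := fun hX hY hjk =>
    (hX.conjTranspose.mul hY).diag_eq_zero (by omega) z
  simp only [echoTerm, Fintype.sum_bool, blk_echo, conjTranspose_add, Matrix.mul_add,
    Matrix.add_mul, Matrix.add_apply]
  rw [key (rc.mul ra) (rb.mul ra) (by norm_num), key (rc.mul ra) (rd.mul rd) (by norm_num),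
    key (ra.mul rd) (rb.mul ra) (by norm_num), key (ra.mul rd) (rd.mul rd) (by norm_num),
    key (rc.mul rc) (rb.mul ra) (by norm_num), key (rc.mul rc) (rd.mul rd) (by norm_num),
    key (ra.mul rb) (rd.mul rd) (by norm_num),
    key (rc.mul rc) (rb.mul rc) (by norm_num), key (rc.mul rc) (rd.mul rb) (by norm_num),
    key (ra.mul rb) (rb.mul rc) (by norm_num), key (ra.mul rb) (rd.mul rb) (by norm_num)]
  ring

/-- The commutator of the diagonal blocks of the evolution. -/
def blkComm (U : Op N) : Matrix (Fin N → Bool) (Fin N → Bool) ℂ :=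
  blk U true true * blk U false false - blk U false false * blk U true true

lemma trace_mul_sector (X Y : Matrix (Fin N → Bool) (Fin N → Bool) ℂ) (k : ℤ) :
    ((X * sector N k)ᴴ * (Y * sector N k)).trace
      = ∑ z with (downs z : ℤ) = k, (Xᴴ * Y) z z := by
  rw [conjTranspose_mul, sector_conjTranspose, Matrix.mul_assoc, Matrix.trace_mul_comm,
    Matrix.mul_assoc, Matrix.mul_assoc, sector_mul_self, ← Matrix.mul_assoc, Finset.sum_filter]
  simp only [Matrix.trace, diag_apply, sector, mul_diagonal]
  exact Finset.sum_congr rfl fun z _ => by split_ifs <;> simp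

/-- The echo evolution is an isometry, so a column of its blocks has total weight equal to the
number of configurations. Its off-diagonal block is the product of diagonal blocks of U plus an
orthogonal double transfer, so it weighs at least as much as that product. -/
lemma hs_offdiag_echo_sq_le {U : Op N} (hU : Uᴴ * U = 1) (hc : Conserves U) (s : Bool) (k : ℤ) :
    hs (blk (U * Rpi N * U) s s * sector N k) ^ 2
        + hs (blk U (!s) (!s) * blk U s s * sector N k) ^ 2 ≤ sectorCard N k := by
  have hR : (Rpi N)ᴴ * Rpi N = 1 := by
    ext ⟨a, z⟩ ⟨b, w⟩
    change blk ((Rpi N)ᴴ * Rpi N) a b z w = _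
    rw [blk_mul, blk_conjTranspose, blk_conjTranspose, Rpi]
    simp only [blk_onElectron]
    cases a <;> cases b <;>
      simp [ketBra, ketUp, ketDown, vecMulVec_apply, Matrix.one_apply]
  have hY : (U * Rpi N * U)ᴴ * (U * Rpi N * U) = 1 := by
    rw [conjTranspose_mul, conjTranspose_mul]
    calc Uᴴ * ((Rpi N)ᴴ * Uᴴ) * (U * Rpi N * U)
        = Uᴴ * ((Rpi N)ᴴ * (Uᴴ * U) * Rpi N) * U := by simp only [Matrix.mul_assoc]
      _ = 1 := by rw [hU, Matrix.mul_one, hR, Matrix.mul_one, hU]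
  have h1 := hs_blk_mul_sq_add hY s (sector N k)
  rw [hs_sector_sq] at h1
  have h2 : hs (blk U (!s) (!s) * blk U s s * sector N k) ^ 2
      ≤ hs (blk (U * Rpi N * U) (!s) s * sector N k) ^ 2 := by
    have hb : blk (U * Rpi N * U) (!s) s = blk U (!s) (!s) * blk U s s
        + blk U (!s) s * blk U (!s) s := by
      rw [blk_echo]; cases s
      · exact add_comm _ _
      · rfl
    have ht : ((blk U (!s) (!s) * blk U s s * sector N k)ᴴ
        * (blk U (!s) s * blk U (!s) s * sector N k)).trace = 0 := by
      rw [trace_mul_sector]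
      refine Finset.sum_eq_zero fun z _ => ?_
      cases s
      · exact (((hc.raises_self true).mul (hc.raises_self false)).conjTranspose.mul
          (hc.raises_up_down.mul hc.raises_up_down)).diag_eq_zero (by norm_num) z
      · exact (((hc.raises_self false).mul (hc.raises_self true)).conjTranspose.mul
          (hc.raises_down_up.mul hc.raises_down_up)).diag_eq_zero (by norm_num) z
    rw [hb, Matrix.add_mul, hs_sq_add_of_trace_eq_zero ht]
    have := sq_nonneg (hs (blk U (!s) s * blk U (!s) s * sector N k))
    linarith
  cases s <;> simp only [Bool.not_false, Bool.not_true] at h2 ⊢ <;> linarith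

/-- Each of the two diagonal factors loses only the weight transferred to the other polarization.
The first factor is a contraction preserving the sector, so the second loss is no larger than from
the bare sector. -/
lemma hs_diag_mul_diag_sq_ge {U : Op N} (hU : Uᴴ * U = 1) (hc : Conserves U) (s : Bool) (k : ℤ) :
    sectorCard N k - hs (blk U true false * sector N k) ^ 2 - hs (blk U false true * sector N k) ^ 2
      ≤ hs (blk U (!s) (!s) * blk U s s * sector N k) ^ 2 := by
  have h1 := hs_blk_mul_sq_add hU s (sector N k)
  rw [hs_sector_sq] at h1
  have h2 := hs_blk_mul_sq_add hU (!s) (blk U s s * sector N k)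
  have h3 : blk U s s * sector N k = sector N k * blk U s s := by
    have := (hc.raises_self s).mul_sector k
    rwa [add_zero] at this
  have h4 : ∀ X : Matrix (Fin N → Bool) (Fin N → Bool) ℂ,
      hs (X * (blk U s s * sector N k)) ^ 2 ≤ hs (X * sector N k) ^ 2 := fun X => by
    refine pow_le_pow_left₀ (hs_nonneg _) ?_ 2
    rw [h3, ← Matrix.mul_assoc]
    exact (hs_mul_le' _ _).trans (mul_le_of_le_one_right (hs_nonneg _) (opn_blk_le hU s s))
  rw [Matrix.mul_assoc]
  have h5 := h4 (blk U true false)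
  have h6 := h4 (blk U false true)
  cases s <;> simp only [Bool.not_false, Bool.not_true] at h2 ⊢ <;> linarith

/-- The echo signal of a sector is bounded below through the transfer between the electron
polarizations and the commutator of the diagonal blocks. -/
lemma re_sum_echoTerm_ge {U : Op N} (hU : Uᴴ * U = 1) (hc : Conserves U) (k : ℤ) :
    sectorCard N k - 2 * (hs (blk U true false * sector N k) ^ 2
        + hs (blk U false true * sector N k) ^ 2) - hs (blkComm U * sector N k) ^ 2 / 2
      ≤ (∑ z with (downs z : ℤ) = k, echoTerm (U * Rpi N * U) z).re := by
  simp_rw [echoTerm_eq hc]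
  rw [Finset.sum_add_distrib, ← trace_mul_sector, ← trace_mul_sector, Complex.add_re,
    re_trace_conjTranspose_mul, ← Matrix.sub_mul, ← blkComm]
  have h1 := hs_offdiag_echo_sq_le hU hc true k
  have h2 := hs_offdiag_echo_sq_le hU hc false k
  have h3 := hs_diag_mul_diag_sq_ge hU hc true k
  have h4 := hs_diag_mul_diag_sq_ge hU hc false k
  simp only [Bool.not_false, Bool.not_true] at h1 h2 h3 h4
  -- This overlap has no definite sign; Cauchy-Schwarz and unitarity bound its modulus by the weight
  -- missing from ab and ba.
  have h5 := norm_trace_conjTranspose_mul_le (blk (U * Rpi N * U) true true * sector N k)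
    (blk (U * Rpi N * U) false false * sector N k)
  have h6 := neg_le_of_abs_le ((Complex.abs_re_le_norm _).trans h5)
  have h7 := two_mul_le_add_sq (hs (blk (U * Rpi N * U) true true * sector N k))
    (hs (blk (U * Rpi N * U) false false * sector N k))
  linarith

end Echo

end

end SpinEcho

namespace SpinEcho

open Matrix

noncomputable section

/-- Energies may be raised to p and q where X vanishes without changing the equation, so bounds on
the support of X are enough for the global Sylvester estimate. -/
lemma opn_le_of_add_mul_eq {n : Type*} [Fintype n] [DecidableEq n] {X K : Matrix n n ℂ}
    {a : n → ℝ} {p q : ℝ} (hpq : 0 < p + q) (h : ∀ w z, ((a w : ℂ) + a z) * X w z = K w z)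
    (hX : ∀ w z, X w z ≠ 0 → p ≤ a w ∧ q ≤ a z) : (p + q) * opn X ≤ opn K := by
  have := sub_mul_opn_le_of_sylvester (X := X) (K := K) (d₁ := fun w => max (a w) p)
    (d₂ := fun z => -max (a z) q) (p := p) (q := -q) (by linarith) (fun _ => le_max_right _ _)
    (fun _ => neg_le_neg (le_max_right _ _)) fun w z => ?_
  · rwa [sub_neg_eq_add] at this
  · rw [← h]
    by_cases h0 : X w z = 0
    · simp [h0]
    · rw [max_eq_left (hX w z h0).1, max_eq_left (hX w z h0).2]
      push_cast
      ring

namespace SpinBath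

variable {N : ℕ} (P : SpinBath N)

/-! ### Transfer between the electron polarizations -/

/-- The Hamiltonian without the conserved `γ_I B J_z`. -/
def Hrot : Op N := P.H0rot + P.V

lemma blk_Hrot_up_up : blk P.Hrot true true = diagonal fun z => (P.upEnergy z : ℂ) := by
  rw [Hrot, blk_add, blk_V_self, add_zero, H0rot_eq, blk_diagonal_self]
  simp [sgn]

lemma blk_Hrot_down_down : blk P.Hrot false false = diagonal fun z => -(P.upEnergy z : ℂ) := by
  rw [Hrot, blk_add, blk_V_self, add_zero, H0rot_eq, blk_diagonal_self]
  simp [sgn]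

lemma blk_Hrot_up_down : blk P.Hrot true false = P.flip := by
  rw [Hrot, blk_add, blk_V_up_down, H0rot_eq, blk_diagonal_ne _ (by simp), zero_add]

lemma blk_Hrot_down_up : blk P.Hrot false true = P.flipᴴ := by
  rw [Hrot, blk_add, blk_V_down_up, H0rot_eq, blk_diagonal_ne _ (by simp), zero_add]

lemma conserves_Hrot : Conserves P.Hrot := by
  rintro ⟨s, w⟩ ⟨s', z⟩ h
  change blk P.Hrot s s' w z ≠ 0 at h
  cases s <;> cases s'
  · rw [blk_Hrot_down_down, diagonal_apply] at h
    rw [ite_ne_right_iff.1 h |>.1]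
  · rw [blk_Hrot_down_up, conjTranspose_apply, star_ne_zero] at h
    have := P.flip_apply_ne_zero h
    rw [numDown_true, numDown_false, this]
  · rw [blk_Hrot_up_down] at h
    have := P.flip_apply_ne_zero h
    rw [numDown_true, numDown_false, this]
  · rw [blk_Hrot_up_up, diagonal_apply] at h
    rw [ite_ne_right_iff.1 h |>.1]

lemma H_eq_Hrot : P.H = P.Hrot + diagonal fun s =>
    ((P.gammaI * P.B * (P.hbar / 2 * (N + 1 - 2 * numDown s)) : ℝ) : ℂ) := by
  rw [H_eq, Jz_eq, Hrot]
  congr 1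
  ext s s'
  by_cases h : s = s'
  · subst h; simp
  · simp [diagonal_apply_ne _ h]

lemma isHermitian_Hrot : P.Hrot.IsHermitian := by
  refine IsHermitian.add ?_ P.V_isHermitian
  rw [H0rot_eq]
  exact isHermitian_diagonal_of_self_adjoint _ (by ext s; simp)

lemma isHermitian_H : P.H.IsHermitian := by
  rw [H_eq_Hrot]
  exact P.isHermitian_Hrot.add (isHermitian_diagonal_of_self_adjoint _ (by ext s; simp))

lemma conserves_H : Conserves P.H := by
  rw [H_eq_Hrot]
  refine conserves_of_commute ?_
  rw [Matrix.add_mul, Matrix.mul_add, P.conserves_Hrot.commute.eq, diagonal_mul_diagonal,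
    diagonal_mul_diagonal]
  simp only [mul_comm]

lemma conserves_U (t : ℝ) : Conserves (P.U t) :=
  conserves_of_commute (evolution_commute P.conserves_H.commute _)

lemma U_isometry (t : ℝ) : (P.U t)ᴴ * P.U t = 1 := evolution_isometry P.isHermitian_H _

lemma U_mul_Hrot (t : ℝ) : P.U t * P.Hrot = P.Hrot * P.U t := by
  refine evolution_commute ?_ _
  rw [H_eq_Hrot]
  refine (Commute.refl _).add_left ?_
  ext s s'
  rw [mul_diagonal, diagonal_mul]
  by_cases hs : P.Hrot s s' = 0
  · simp [hs]
  · rw [P.conserves_Hrot s s' hs, mul_comm]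

/-- The up-down block of the commutation of U with the rotating-frame Hamiltonian. The energies add
because the two polarizations carry opposite signs, and this sum is the gap. -/
lemma transfer_up_down (t : ℝ) (w z : Fin N → Bool) :
    ((P.upEnergy w : ℂ) + P.upEnergy z) * blk (P.U t) true false w z
      = (blk (P.U t) true true * P.flip - P.flip * blk (P.U t) false false) w z := by
  have h := congrArg (fun X => blk X true false w z) (P.U_mul_Hrot t)
  simp only [blk_mul, blk_Hrot_up_up, blk_Hrot_down_down, blk_Hrot_up_down,
    Matrix.add_apply, mul_diagonal, diagonal_mul] at h
  rw [Matrix.sub_apply]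
  linear_combination -h

lemma transfer_down_up (t : ℝ) (w z : Fin N → Bool) :
    ((P.upEnergy w : ℂ) + P.upEnergy z) * blk (P.U t) false true w z
      = (P.flipᴴ * blk (P.U t) true true - blk (P.U t) false false * P.flipᴴ) w z := by
  have h := congrArg (fun X => blk X false true w z) (P.U_mul_Hrot t)
  simp only [blk_mul, blk_Hrot_up_up, blk_Hrot_down_down, blk_Hrot_down_up,
    Matrix.add_apply, mul_diagonal, diagonal_mul] at h
  rw [Matrix.sub_apply]
  linear_combination h

lemma raises_flip_conjTranspose : Raises (-1) P.flipᴴ := P.raises_flip.conjTranspose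

lemma mul_sector_apply_ne_zero {k : ℤ} {X : Matrix (Fin N → Bool) (Fin N → Bool) ℂ}
    {w z : Fin N → Bool} (h : (X * sector N k) w z ≠ 0) :
    (downs z : ℤ) = k ∧ X w z ≠ 0 := by
  rw [sector, mul_diagonal] at h
  exact ⟨by_contra fun hz => h (by rw [if_neg hz, mul_zero]), left_ne_zero_of_mul h⟩

/-- If `X` solves `D X + X D = A G - G B` with contractions `A`, `B` conserving the sectors. -/
lemma hs_transfer_le {A B G X : Matrix (Fin N → Bool) (Fin N → Bool) ℂ} {k j : ℤ} {Δ : ℝ}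
    (hA : opn A ≤ 1) (hB : opn B ≤ 1) (hB0 : Raises 0 B) (hX : Raises j X) (hΔ : 0 < Δ)
    (h : ∀ w z, ((P.upEnergy w : ℂ) + P.upEnergy z) * X w z = (A * G - G * B) w z)
    (hgap : ∀ w z : Fin N → Bool, (downs z : ℤ) = k → (downs w : ℤ) = k + j →
      Δ ≤ P.upEnergy w + P.upEnergy z) :
    hs (X * sector N k) ≤ 2 * hs (G * sector N k) / Δ := by
  have h1 : hs (X * sector N k) ≤ Δ⁻¹ * hs ((A * G - G * B) * sector N k) := by
    refine hs_le_of_norm_le (inv_nonneg.2 hΔ.le) fun w z => ?_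
    by_cases h0 : (X * sector N k) w z = 0
    · rw [h0, norm_zero]; positivity
    · obtain ⟨hz, hwz⟩ := mul_sector_apply_ne_zero h0
      have hg := hgap w z hz (by rw [hX w z hwz, hz])
      rw [le_inv_mul_iff₀ hΔ, sector, mul_diagonal, mul_diagonal, if_pos hz, mul_one, mul_one,
        ← h, norm_mul,
        ← Complex.ofReal_add, Complex.norm_real, Real.norm_of_nonneg (hΔ.le.trans hg)]
      exact mul_le_mul_of_nonneg_right hg (norm_nonneg _)
  have h2 : hs ((A * G - G * B) * sector N k) ≤ 2 * hs (G * sector N k) := by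
    have hc := hB0.mul_sector k
    rw [add_zero] at hc
    rw [Matrix.sub_mul, Matrix.mul_assoc, Matrix.mul_assoc, hc, ← Matrix.mul_assoc G]
    refine (hs_sub_le _ _).trans ?_
    have h3 := (hs_mul_le A (G * sector N k)).trans
      (mul_le_of_le_one_left (hs_nonneg _) hA)
    have h4 := (hs_mul_le' (G * sector N k) B).trans (mul_le_of_le_one_right (hs_nonneg _) hB)
    linarith
  rw [le_div_iff₀ hΔ, mul_comm]
  rw [le_inv_mul_iff₀ hΔ] at h1
  exact h1.trans h2

/-- Entrywise division by the energy sums controls the Hilbert-Schmidt norm but not directly the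
spectral norm. Separate bounds p for rows and q for columns put the equation in Sylvester form, with
no loss in the constant. -/
lemma opn_transfer_le {A B G X : Matrix (Fin N → Bool) (Fin N → Bool) ℂ} {k j : ℤ} {p q : ℝ}
    (hA : opn A ≤ 1) (hB : opn B ≤ 1) (hB0 : Raises 0 B) (hX : Raises j X) (hpq : 0 < p + q)
    (h : ∀ w z, ((P.upEnergy w : ℂ) + P.upEnergy z) * X w z = (A * G - G * B) w z)
    (hp : ∀ w : Fin N → Bool, (downs w : ℤ) = k + j → p ≤ P.upEnergy w)
    (hq : ∀ z : Fin N → Bool, (downs z : ℤ) = k → q ≤ P.upEnergy z) :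
    opn (X * sector N k) ≤ 2 * opn (G * sector N k) / (p + q) := by
  have h1 : (p + q) * opn (X * sector N k) ≤ opn ((A * G - G * B) * sector N k) := by
    refine opn_le_of_add_mul_eq (a := P.upEnergy) hpq (fun w z => ?_) fun w z h0 => ?_
    · rw [sector, mul_diagonal, mul_diagonal, ← h, mul_assoc]
    · obtain ⟨hz, hwz⟩ := mul_sector_apply_ne_zero h0
      exact ⟨hp w (by rw [hX w z hwz, hz]), hq z hz⟩
  have h2 : opn ((A * G - G * B) * sector N k) ≤ 2 * opn (G * sector N k) := by
    have hc := hB0.mul_sector k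
    rw [add_zero] at hc
    rw [Matrix.sub_mul, Matrix.mul_assoc, Matrix.mul_assoc, hc, ← Matrix.mul_assoc G]
    refine (opn_sub_le _ _).trans ?_
    have h3 := (opn_mul_le A (G * sector N k)).trans
      (mul_le_of_le_one_left (opn_nonneg _) hA)
    have h4 := (opn_mul_le (G * sector N k) B).trans (mul_le_of_le_one_right (opn_nonneg _) hB)
    linarith
  rw [le_div_iff₀ hpq, mul_comm]
  exact h1.trans h2

lemma transfer_down_up' (t : ℝ) (w z : Fin N → Bool) :
    ((P.upEnergy w : ℂ) + P.upEnergy z) * (-blk (P.U t) false true) w z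
      = (blk (P.U t) false false * P.flipᴴ - P.flipᴴ * blk (P.U t) true true) w z := by
  have := P.transfer_down_up t w z
  rw [Matrix.sub_apply] at this ⊢
  rw [Matrix.neg_apply]
  linear_combination -this

lemma raises_neg_down_up (t : ℝ) : Raises (-1) (-blk (P.U t) false true) := fun w z h =>
  (P.conserves_U t).raises_down_up w z (by rwa [Matrix.neg_apply, neg_ne_zero] at h)

/-! ### Transfer bounds uniform in time -/

section Bounds

variable {P} {k : ℤ} {Δ p q : ℝ}

lemma hs_up_down_le (t : ℝ) (hΔ : 0 < Δ)
    (hgap : ∀ w z : Fin N → Bool, (downs z : ℤ) = k → (downs w : ℤ) = k + 1 →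
      Δ ≤ P.upEnergy w + P.upEnergy z) :
    hs (blk (P.U t) true false * sector N k) ≤ 2 * hs (P.flip * sector N k) / Δ :=
  P.hs_transfer_le (opn_blk_le (P.U_isometry t) _ _) (opn_blk_le (P.U_isometry t) _ _)
    ((P.conserves_U t).raises_self false) (P.conserves_U t).raises_up_down hΔ
    (P.transfer_up_down t) hgap

lemma hs_down_up_le (t : ℝ) (hΔ : 0 < Δ)
    (hgap : ∀ w z : Fin N → Bool, (downs z : ℤ) = k → (downs w : ℤ) = k + -1 →
      Δ ≤ P.upEnergy w + P.upEnergy z) :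
    hs (blk (P.U t) false true * sector N k) ≤ 2 * hs (P.flipᴴ * sector N k) / Δ := by
  have := P.hs_transfer_le (opn_blk_le (P.U_isometry t) _ _) (opn_blk_le (P.U_isometry t) _ _)
    ((P.conserves_U t).raises_self true) (P.raises_neg_down_up t) hΔ
    (P.transfer_down_up' t) hgap
  rwa [Matrix.neg_mul, hs_neg] at this

lemma opn_up_down_le (t : ℝ) (hpq : 0 < p + q)
    (hp : ∀ w : Fin N → Bool, (downs w : ℤ) = k + 1 → p ≤ P.upEnergy w)
    (hq : ∀ z : Fin N → Bool, (downs z : ℤ) = k → q ≤ P.upEnergy z) :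
    opn (blk (P.U t) true false * sector N k) ≤ 2 * opn (P.flip * sector N k) / (p + q) :=
  P.opn_transfer_le (opn_blk_le (P.U_isometry t) _ _) (opn_blk_le (P.U_isometry t) _ _)
    ((P.conserves_U t).raises_self false) (P.conserves_U t).raises_up_down hpq
    (P.transfer_up_down t) hp hq

/-- The sector is k + 1 so that the transition joins the same two sectors as the reverse one: the
gap is the same, and taking the adjoint of the flip-flop matrix gives the same norm. -/
lemma opn_down_up_le (t : ℝ) (hpq : 0 < p + q)
    (hp : ∀ w : Fin N → Bool, (downs w : ℤ) = k + 1 → p ≤ P.upEnergy w)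
    (hq : ∀ z : Fin N → Bool, (downs z : ℤ) = k → q ≤ P.upEnergy z) :
    opn (blk (P.U t) false true * sector N (k + 1))
      ≤ 2 * opn (P.flip * sector N k) / (p + q) := by
  have h := P.opn_transfer_le (k := k + 1) (opn_blk_le (P.U_isometry t) _ _)
    (opn_blk_le (P.U_isometry t) _ _) ((P.conserves_U t).raises_self true)
    (P.raises_neg_down_up t) (by rwa [add_comm] at hpq : 0 < q + p)
    (P.transfer_down_up' t) (fun w hw => hq w (by omega)) hp
  have h1 : opn (-blk (P.U t) false true * sector N (k + 1))
      = opn (blk (P.U t) false true * sector N (k + 1)) := by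
    rw [Matrix.neg_mul, opn, map_neg, norm_neg, opn]
  have h2 : opn (P.flipᴴ * sector N (k + 1)) = opn (P.flip * sector N k) := by
    rw [P.raises_flip.mul_sector, ← opn_conjTranspose (sector N (k + 1) * P.flip),
      conjTranspose_mul, sector_conjTranspose]
  rwa [h1, h2, add_comm q p] at h

end Bounds

end SpinBath

end

end SpinEcho

namespace SpinEcho

open Matrix

noncomputable section

/-! ### Eigenvectors of a block -/

section Frame

variable {N : ℕ} {ι : Type*}

/-- The components of a family of joint states for a given electron polarization. -/
def part (s : Bool) (X : Matrix (State N) ι ℂ) : Matrix (Fin N → Bool) ι ℂ := fun z i => X (s, z) i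

lemma part_mul (s : Bool) (X : Op N) (Y : Matrix (State N) ι ℂ) :
    part s (X * Y) = blk X s true * part true Y + blk X s false * part false Y := by
  ext z i
  simp [part, blk, Matrix.mul_apply, Fintype.sum_prod_type]

lemma part_sub (s : Bool) (X Y : Matrix (State N) ι ℂ) : part s (X - Y) = part s X - part s Y := rfl

variable [Fintype ι]

lemma part_mul_right (s : Bool) (X : Matrix (State N) ι ℂ) (D : Matrix ι ι ℂ) :
    part s (X * D) = part s X * D := rfl

lemma hs_sq_eq_part (X : Matrix (State N) ι ℂ) :
    hs X ^ 2 = hs (part true X) ^ 2 + hs (part false X) ^ 2 := by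
  rw [hs_sq, hs_sq, hs_sq, Fintype.sum_prod_type, Fintype.sum_bool]; rfl

lemma hs_part_le (s : Bool) (X : Matrix (State N) ι ℂ) : hs (part s X) ≤ hs X := by
  refine le_of_sq_le_sq ?_ (hs_nonneg _)
  have := hs_sq_eq_part X
  have := sq_nonneg (hs (part true X))
  have := sq_nonneg (hs (part false X))
  cases s <;> linarith

lemma opn_blk_le_opn (X : Op N) (s s' : Bool) : opn (blk X s s') ≤ opn X := by
  refine opn_le (opn_nonneg _) fun v => ?_
  have h := sum_sq_mulVec_le X fun p => if p.1 = s' then v p.2 else 0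
  have h1 : ∑ p : State N, ‖(if p.1 = s' then v p.2 else 0 : ℂ)‖ ^ 2 = ∑ z, ‖v z‖ ^ 2 := by
    rw [Fintype.sum_prod_type, Fintype.sum_bool]
    cases s' <;> simp
  rw [h1] at h
  refine le_trans ?_ h
  rw [Fintype.sum_prod_type]
  refine le_trans (le_of_eq ?_) (Finset.single_le_sum (f := fun a => ∑ y,
    ‖(X *ᵥ fun p : State N => if p.1 = s' then v p.2 else 0) (a, y)‖ ^ 2)
    (fun a _ => Finset.sum_nonneg fun y _ => by positivity) (Finset.mem_univ s))
  refine Finset.sum_congr rfl fun z _ => ?_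
  congr 2
  simp only [Matrix.mulVec, dotProduct, blk, Fintype.sum_prod_type, Fintype.sum_bool]
  cases s' <;> simp

/-- ‖XY‖² is the trace of X(YYᴴ)Xᴴ. This allows a sector projection to be replaced by the components
of an orthonormal eigenbasis of a block. -/
lemma hs_mul_eq_of_mul_conjTranspose_eq {m n k l : Type*} [Fintype m] [Fintype n] [Fintype k]
    [Fintype l] (X : Matrix m n ℂ) {Y : Matrix n k ℂ} {Z : Matrix n l ℂ} (h : Y * Yᴴ = Z * Zᴴ) :
    hs (X * Y) = hs (X * Z) := by
  have h2 : hs (X * Y) ^ 2 = hs (X * Z) ^ 2 := by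
    have h1 : ((hs (X * Y) ^ 2 : ℝ) : ℂ) = ((hs (X * Z) ^ 2 : ℝ) : ℂ) := by
      rw [← hs_conjTranspose (X * Y), ← trace_conjTranspose_mul_self, conjTranspose_conjTranspose,
        conjTranspose_mul, ← hs_conjTranspose (X * Z), ← trace_conjTranspose_mul_self,
        conjTranspose_conjTranspose, conjTranspose_mul, Matrix.mul_assoc, ← Matrix.mul_assoc Y, h]
      simp only [Matrix.mul_assoc]
    exact_mod_cast h1
  exact (sq_eq_sq₀ (hs_nonneg _) (hs_nonneg _)).1 h2

variable [DecidableEq ι]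

/-- The projection onto the columns in `p`. -/
def mask (p : ι → Prop) [DecidablePred p] : Matrix ι ι ℂ := diagonal fun i => if p i then 1 else 0

lemma mul_mask_apply {m : Type*} (X : Matrix m ι ℂ) (p : ι → Prop) [DecidablePred p] (a : m)
    (i : ι) : (X * mask p) a i = if p i then X a i else 0 := by
  rw [mask, mul_diagonal]; split_ifs <;> simp

lemma hs_mul_mask_sq_add {m : Type*} [Fintype m] (X : Matrix m ι ℂ) (p : ι → Prop)
    [DecidablePred p] :
    hs (X * mask p) ^ 2 + hs (X * mask fun i => ¬ p i) ^ 2 = hs X ^ 2 := by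
  rw [hs_sq, hs_sq, hs_sq, ← Finset.sum_add_distrib]
  refine Finset.sum_congr rfl fun a _ => ?_
  rw [← Finset.sum_add_distrib]
  refine Finset.sum_congr rfl fun i _ => ?_
  rw [mul_mask_apply, mul_mask_apply]
  by_cases h : p i <;> simp [h]

lemma hs_mul_mask_le {m : Type*} [Fintype m] (X : Matrix m ι ℂ) (p : ι → Prop)
    [DecidablePred p] : hs (X * mask p) ≤ hs X := by
  refine le_of_sq_le_sq ?_ (hs_nonneg _)
  have := hs_mul_mask_sq_add X p
  have := sq_nonneg (hs (X * mask fun i => ¬ p i))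
  linarith

end Frame

namespace SpinBath

variable {N : ℕ} (P : SpinBath N)

/-- The columns of `Ψ` are an orthonormal eigenbasis of the block of `L` down spins. -/
structure IsEigenframe (L : ℕ) {ι : Type*} [Fintype ι] [DecidableEq ι] (Ψ : Matrix (State N) ι ℂ)
    (E : ι → ℝ) : Prop where
  isometry : Ψᴴ * Ψ = 1
  range : Ψ * Ψᴴ = diagonal fun s => if numDown s = L then 1 else 0
  eigen : P.Hrot * Ψ = Ψ * diagonal fun i => (E i : ℂ)

/-- Include the block by an isometry J, diagonalize the compressed Hamiltonian, and carry its
eigenvectors back; conservation makes J intertwine the two Hamiltonians. -/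
lemma exists_isEigenframe (L : ℕ) :
    ∃ (Ψ : Matrix (State N) {s : State N // numDown s = L} ℂ) (E : _ → ℝ),
      P.IsEigenframe L Ψ E := by
  set J : Matrix (State N) {s : State N // numDown s = L} ℂ :=
    (1 : Op N).submatrix id Subtype.val with hJ
  set h : Matrix {s : State N // numDown s = L} {s : State N // numDown s = L} ℂ :=
    P.Hrot.submatrix Subtype.val Subtype.val with hh
  have hherm : h.IsHermitian := P.isHermitian_Hrot.submatrix _
  obtain ⟨T, E, h1, h2, h3, -⟩ := exists_diagonal_evolution hherm 0
  have hJJ : Jᴴ * J = 1 := by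
    ext i j
    simp [hJ, Matrix.mul_apply, Matrix.one_apply, Subtype.ext_iff]
  have hJJ' : J * Jᴴ = diagonal fun s => if numDown s = L then 1 else 0 := by
    ext s s'
    simp only [hJ, Matrix.mul_apply, conjTranspose_apply, submatrix_apply, id, Matrix.one_apply,
      diagonal_apply]
    by_cases hs : numDown s = L
    · rw [Finset.sum_eq_single ⟨s, hs⟩]
      · by_cases hss : s = s'
        · subst hss; simp [hs]
        · simp [hss, Ne.symm hss]
      · intro b _ hb
        have : s ≠ b.1 := fun h => hb (Subtype.ext h.symm)
        simp [this]
      · simp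
    · have : ∀ b : {s : State N // numDown s = L}, s ≠ b.1 := fun b h => hs (h ▸ b.2)
      simp [this, hs]
  have hHJ : P.Hrot * J = J * h := by
    have e1 : Jᴴ * P.Hrot * J = h := by
      ext i j
      simp [hJ, hh, Matrix.mul_apply, Matrix.one_apply]
    have e2 : P.Hrot * J = J * Jᴴ * (P.Hrot * J) := by
      ext s i
      rw [hJJ', diagonal_mul]
      have : (P.Hrot * J) s i = P.Hrot s i.1 := by
        simp [hJ, Matrix.mul_apply, Matrix.one_apply]
      rw [this]
      by_cases hs : P.Hrot s i.1 = 0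
      · simp [hs]
      · have := P.conserves_Hrot _ _ hs
        rw [if_pos (this.trans i.2), one_mul]
    rw [← e1, e2]
    simp only [Matrix.mul_assoc]
  refine ⟨J * T, E, ?_, ?_, ?_⟩
  · rw [conjTranspose_mul, Matrix.mul_assoc, ← Matrix.mul_assoc Jᴴ, hJJ, Matrix.one_mul, h1]
  · rw [conjTranspose_mul, Matrix.mul_assoc, ← Matrix.mul_assoc T, h2, Matrix.one_mul, hJJ']
  · rw [← Matrix.mul_assoc, hHJ, Matrix.mul_assoc, Matrix.mul_assoc]
    congr 1
    conv_lhs => rw [h3]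
    rw [Matrix.mul_assoc, h1, Matrix.mul_one]

/-! ### Components and spectral gap of the eigenvectors -/

namespace IsEigenframe

variable {P} {n : ℕ} {ι : Type*} [Fintype ι] [DecidableEq ι] {Ψ : Matrix (State N) ι ℂ} {E : ι → ℝ}

lemma part_false_mul (h : P.IsEigenframe (n + 1) Ψ E) :
    part false Ψ * (part false Ψ)ᴴ = sector N n := by
  ext w z
  change (Ψ * Ψᴴ) (false, w) (false, z) = _
  rw [h.range, sector, diagonal_apply, diagonal_apply, numDown_false]
  simp

lemma part_true_mul (h : P.IsEigenframe (n + 1) Ψ E) :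
    part true Ψ * (part true Ψ)ᴴ = sector N (n + 1) := by
  ext w z
  change (Ψ * Ψᴴ) (true, w) (true, z) = _
  rw [h.range, sector, diagonal_apply, diagonal_apply, numDown_true]
  simp
  norm_cast

lemma hs_mul_part_false (h : P.IsEigenframe (n + 1) Ψ E) {m : Type*} [Fintype m]
    (X : Matrix m (Fin N → Bool) ℂ) : hs (X * part false Ψ) = hs (X * sector N n) :=
  hs_mul_eq_of_mul_conjTranspose_eq X (by
    rw [h.part_false_mul, sector_conjTranspose, sector_mul_self])

lemma hs_mul_part_true (h : P.IsEigenframe (n + 1) Ψ E) {m : Type*} [Fintype m]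
    (X : Matrix m (Fin N → Bool) ℂ) : hs (X * part true Ψ) = hs (X * sector N (n + 1)) :=
  hs_mul_eq_of_mul_conjTranspose_eq X (by
    rw [h.part_true_mul, sector_conjTranspose, sector_mul_self])

lemma numDown_eq {L : ℕ} (h : P.IsEigenframe L Ψ E) {s : State N} {i : ι} (hs : Ψ s i ≠ 0) :
    numDown s = L := by
  by_contra hL
  have h1 := congrFun (congrFun h.range s) s
  rw [diagonal_apply_eq, if_neg hL, Matrix.mul_apply] at h1
  simp only [conjTranspose_apply] at h1
  have h2 : ∑ j, ‖Ψ s j‖ ^ 2 = 0 := by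
    have : ∀ j, Ψ s j * star (Ψ s j) = ((‖Ψ s j‖ ^ 2 : ℝ) : ℂ) := fun j => by
      rw [RCLike.star_def, Complex.mul_conj, Complex.normSq_eq_norm_sq]
    simp_rw [this] at h1
    exact_mod_cast h1
  rw [Finset.sum_eq_zero_iff_of_nonneg fun j _ => by positivity] at h2
  have := h2 i (Finset.mem_univ i)
  simp at this
  exact hs this

lemma sum_sq (h : P.IsEigenframe (n + 1) Ψ E) (i : ι) : ∑ s, ‖Ψ s i‖ ^ 2 = 1 := by
  have h1 := congrFun (congrFun h.isometry i) i
  rw [Matrix.mul_apply, one_apply_eq] at h1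
  simp only [conjTranspose_apply] at h1
  have : ∀ s, star (Ψ s i) * Ψ s i = ((‖Ψ s i‖ ^ 2 : ℝ) : ℂ) := fun j => by
    rw [mul_comm, RCLike.star_def, Complex.mul_conj, Complex.normSq_eq_norm_sq]
  simp_rw [this] at h1
  exact_mod_cast h1

lemma eigen_false (h : P.IsEigenframe (n + 1) Ψ E) (z : Fin N → Bool) (i : ι) :
    ((E i : ℂ) + P.upEnergy z) * part false Ψ z i = (P.flipᴴ * part true Ψ) z i := by
  have := congrArg (fun X => part false X z i) h.eigen
  simp only [part_mul, blk_Hrot_down_up, blk_Hrot_down_down, part_mul_right, Matrix.add_apply,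
    diagonal_mul, mul_diagonal] at this
  linear_combination -this

lemma eigen_true (h : P.IsEigenframe (n + 1) Ψ E) (z : Fin N → Bool) (i : ι) :
    ((E i : ℂ) - P.upEnergy z) * part true Ψ z i = (P.flip * part false Ψ) z i := by
  have := congrArg (fun X => part true X z i) h.eigen
  simp only [part_mul, blk_Hrot_up_down, blk_Hrot_up_up, part_mul_right, Matrix.add_apply,
    diagonal_mul, mul_diagonal] at this
  linear_combination -this

/-- Pair each component of the eigenvalue equation with itself. Both sides become the matrix element
of the flip-flop term between the two components, up to complex conjugation, and both are real. -/
lemma weighted_sum_eq (h : P.IsEigenframe (n + 1) Ψ E) (i : ι) :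
    ∑ z, (E i + P.upEnergy z) * ‖part false Ψ z i‖ ^ 2
      = ∑ z, (E i - P.upEnergy z) * ‖part true Ψ z i‖ ^ 2 := by
  have hn : ∀ x : ℂ, x * star x = ((‖x‖ ^ 2 : ℝ) : ℂ) := fun x => by
    rw [RCLike.star_def, Complex.mul_conj, Complex.normSq_eq_norm_sq]
  have h1 : ((∑ z, (E i + P.upEnergy z) * ‖part false Ψ z i‖ ^ 2 : ℝ) : ℂ)
      = ∑ z, ∑ w, star (P.flip w z) * part true Ψ w i * star (part false Ψ z i) := by
    rw [Complex.ofReal_sum]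
    refine Finset.sum_congr rfl fun z _ => ?_
    rw [Complex.ofReal_mul, ← hn, ← mul_assoc, Complex.ofReal_add, h.eigen_false, Matrix.mul_apply,
      Finset.sum_mul]
    rfl
  have h2 : ((∑ w, (E i - P.upEnergy w) * ‖part true Ψ w i‖ ^ 2 : ℝ) : ℂ)
      = ∑ w, ∑ z, P.flip w z * part false Ψ z i * star (part true Ψ w i) := by
    rw [Complex.ofReal_sum]
    refine Finset.sum_congr rfl fun z _ => ?_
    rw [Complex.ofReal_mul, ← hn, ← mul_assoc, Complex.ofReal_sub, h.eigen_true, Matrix.mul_apply,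
      Finset.sum_mul]
  have h3 : ((∑ w, (E i - P.upEnergy w) * ‖part true Ψ w i‖ ^ 2 : ℝ) : ℂ)
      = ∑ z, ∑ w, star (P.flip w z * part false Ψ z i * star (part true Ψ w i)) := by
    rw [← Complex.conj_ofReal, h2, map_sum, Finset.sum_comm]
    exact Finset.sum_congr rfl fun w _ => map_sum _ _ _
  rw [← Complex.ofReal_inj, h1, h3]
  refine Finset.sum_congr rfl fun z _ => Finset.sum_congr rfl fun w _ => ?_
  rw [star_mul', star_mul', star_star]
  ring

variable {p q : ℝ}

/-- For an energy strictly between -q and p the two sides of `weighted_sum_eq` have opposite signs,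
so both vanish and with them the eigenvector. The spectrum of the block thus splits into low and
high energies although the coupling is not assumed small. -/
lemma eq_zero_of_lt (h : P.IsEigenframe (n + 1) Ψ E)
    (hp : ∀ z : Fin N → Bool, (downs z : ℤ) = n + 1 → p ≤ P.upEnergy z)
    (hq : ∀ z : Fin N → Bool, (downs z : ℤ) = n → q ≤ P.upEnergy z) (i : ι) :
    E i ≤ -q ∨ p ≤ E i := by
  by_contra! hE
  have h0 := h.weighted_sum_eq i
  have h1 : ∀ z, 0 ≤ (E i + P.upEnergy z) * ‖part false Ψ z i‖ ^ 2 := fun z => by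
    by_cases hz : part false Ψ z i = 0
    · simp [hz]
    · have := h.numDown_eq hz
      rw [numDown_false] at this
      have := hq z (by omega)
      exact mul_nonneg (by linarith) (by positivity)
  have h2 : ∀ z, (E i - P.upEnergy z) * ‖part true Ψ z i‖ ^ 2 ≤ 0 := fun z => by
    by_cases hz : part true Ψ z i = 0
    · simp [hz]
    · have := h.numDown_eq hz
      rw [numDown_true] at this
      have := hp z (by omega)
      exact mul_nonpos_of_nonpos_of_nonneg (by linarith) (by positivity)
  have h3 := Finset.sum_nonneg fun z (_ : z ∈ Finset.univ) => h1 z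
  have h4 := Finset.sum_nonpos fun z (_ : z ∈ Finset.univ) => h2 z
  have h5 := (Finset.sum_eq_zero_iff_of_nonneg fun z _ => h1 z).1 (by linarith)
  have h6 := (Finset.sum_eq_zero_iff_of_nonpos fun z _ => h2 z).1 (by linarith)
  have h7 : ∀ z, part false Ψ z i = 0 := fun z => by
    by_contra hz
    have := h.numDown_eq hz
    rw [numDown_false] at this
    have := hq z (by omega)
    have := h5 z (Finset.mem_univ z)
    rcases mul_eq_zero.1 this with h8 | h8
    · linarith
    · exact hz (by simpa using h8)
  have h8 : ∀ z, part true Ψ z i = 0 := fun z => by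
    by_contra hz
    have := h.numDown_eq hz
    rw [numDown_true] at this
    have := hp z (by omega)
    have := h6 z (Finset.mem_univ z)
    rcases mul_eq_zero.1 this with h8 | h8
    · linarith
    · exact hz (by simpa using h8)
  have h9 := h.sum_sq i
  rw [Fintype.sum_prod_type, Fintype.sum_bool] at h9
  have h10 : ∀ z, Ψ (true, z) i = 0 := h8
  have h11 : ∀ z, Ψ (false, z) i = 0 := h7
  simp [h10, h11] at h9

end IsEigenframe

end SpinBath

end

end SpinEcho

namespace SpinEcho

open Matrix

noncomputable section

namespace SpinBath

variable {N : ℕ} (P : SpinBath N)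

/-! ### The operator `W` -/

lemma finite_minusEnergies (L : ℕ) : (P.minusEnergies L).Finite := by
  have hf : {μ : ℂ | Module.End.HasEigenvalue (Matrix.toLin' P.Hrot) μ}.Finite :=
    Module.End.finite_hasEigenvalue _
  refine (hf.preimage Complex.ofReal_injective.injOn).subset ?_
  rintro E ⟨psi, -, h1, h2, -⟩
  refine Module.End.hasEigenvalue_of_hasEigenvector (x := psi)
    (Module.End.hasEigenvector_iff.2 ⟨Module.End.mem_eigenspace_iff.2 ?_, ?_⟩)
  · rw [Matrix.toLin'_apply]; exact h2
  · rintro rfl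
    simp at h1

lemma opn_W_le_normW {L : ℕ} {E : ℝ} (hE : E ∈ P.minusEnergies L) : opn (P.W L E) ≤ P.normW L :=
  le_csSup ((P.finite_minusEnergies L).image _).bddAbove ⟨E, hE, rfl⟩

lemma normW_nonneg (L : ℕ) : 0 ≤ P.normW L :=
  Real.sSup_nonneg (by rintro x ⟨E, -, rfl⟩; exact norm_nonneg _)

/-- The π pulses around the first term move its intermediate states to electron up with n + 1 down
nuclei; those of the second have electron down and n - 1 down nuclei. -/
lemma blk_W (n : ℕ) (E : ℝ) : blk (P.W (n + 1) E) true true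
    = sector N n * (P.flipᴴ * diagonal (fun z => ((E : ℂ) - P.upEnergy z)⁻¹) * P.flip
      + P.flip * diagonal (fun z => (-(E : ℂ) + P.upEnergy z)⁻¹) * P.flipᴴ) * sector N n := by
  have hR : ∀ s s', blk (Rpi N) s s' = if s = s' then 0 else 1 := fun s s' => by
    rw [Rpi, blk_onElectron]
    cases s <;> cases s' <;> simp [ketBra, ketUp, ketDown, vecMulVec_apply]
  have hQ : blk (projUp N (n + 1)) true true = sector N n := by
    rw [projUp, blk_diagonal_self]
    simp [sector, numDown_true]
  have hQ' : blk (projUp N (n + 1)) true false = 0 := blk_diagonal_ne _ (by simp)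
  have hQ'' : blk (projUp N (n + 1)) false true = 0 := blk_diagonal_ne _ (by simp)
  have h1 : ∀ E, blk (P.resolvent E) true true = diagonal (fun z => ((E : ℂ) - P.upEnergy z)⁻¹) :=
    fun E => by rw [resolvent, blk_diagonal_self, H0rot_eq]; simp [sgn]
  have h2 : ∀ E, blk (P.resolvent E) false false = diagonal (fun z => ((E : ℂ) + P.upEnergy z)⁻¹) :=
    fun E => by rw [resolvent, blk_diagonal_self, H0rot_eq]; simp [sgn]
  have h3 : ∀ E, blk (P.resolvent E) true false = 0 := fun E => blk_diagonal_ne _ (by simp)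
  have h4 : ∀ E, blk (P.resolvent E) false true = 0 := fun E => blk_diagonal_ne _ (by simp)
  rw [W, Matrix.mul_assoc]
  simp only [blk_mul, blk_add, hQ, hQ', hQ'', hR, h1, h2, h3, h4, blk_V_self, blk_V_up_down,
    blk_V_down_up]
  simp [Matrix.mul_assoc]

/-! ### Low-energy eigenvectors and their dressed reflections -/

namespace IsEigenframe

variable {P} {n : ℕ} {ι : Type*} [Fintype ι] [DecidableEq ι] {Ψ : Matrix (State N) ι ℂ} {E : ι → ℝ}
  {p q : ℝ}

/-- The up component of an eigenvector is the flip-flop image of its down component divided by an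
energy difference, which is at least the gap for energies up to -q. -/
lemma hs_mask_up_le (h : P.IsEigenframe (n + 1) Ψ E) (hpq : 0 < p + q)
    (hp : ∀ z : Fin N → Bool, (downs z : ℤ) = n + 1 → p ≤ P.upEnergy z) :
    hs (part true Ψ * mask fun i => E i ≤ -q) ≤ hs (P.flip * sector N n) / (p + q) := by
  rw [← h.hs_mul_part_false, div_eq_inv_mul]
  refine hs_le_of_norm_le (inv_nonneg.2 hpq.le) fun z i => ?_
  rw [mul_mask_apply]
  by_cases hi : E i ≤ -q
  · rw [if_pos hi, ← h.eigen_true, norm_mul, ← Complex.ofReal_sub, Complex.norm_real]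
    by_cases hz : part true Ψ z i = 0
    · simp [hz]
    · have := h.numDown_eq hz
      rw [numDown_true] at this
      have := hp z (by omega)
      rw [le_inv_mul_iff₀ hpq]
      refine mul_le_mul_of_nonneg_right ?_ (norm_nonneg _)
      rw [Real.norm_eq_abs, abs_sub_comm]
      exact le_trans (by linarith) (le_abs_self _)
  · rw [if_neg hi, norm_zero]
    positivity

/-- An eigenvalue above -q is at least p, so the same division by the gap works for the down
components of the high-energy eigenvectors. -/
lemma hs_mask_down_le (h : P.IsEigenframe (n + 1) Ψ E) (hpq : 0 < p + q)
    (hp : ∀ z : Fin N → Bool, (downs z : ℤ) = n + 1 → p ≤ P.upEnergy z)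
    (hq : ∀ z : Fin N → Bool, (downs z : ℤ) = n → q ≤ P.upEnergy z) :
    hs (part false Ψ * mask fun i => ¬ E i ≤ -q) ≤ hs (P.flip * sector N n) / (p + q) := by
  have h1 : hs (P.flip * sector N n) = hs (P.flipᴴ * part true Ψ) := by
    rw [h.hs_mul_part_true, P.raises_flip.mul_sector, ← hs_conjTranspose, conjTranspose_mul,
      sector_conjTranspose]
  rw [h1, div_eq_inv_mul]
  refine hs_le_of_norm_le (inv_nonneg.2 hpq.le) fun z i => ?_
  rw [mul_mask_apply]
  by_cases hi : E i ≤ -q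
  · rw [if_neg (by simpa using hi), norm_zero]
    positivity
  · rw [if_pos hi, ← h.eigen_false, norm_mul, ← Complex.ofReal_add, Complex.norm_real]
    by_cases hz : part false Ψ z i = 0
    · simp [hz]
    · have := h.numDown_eq hz
      rw [numDown_false] at this
      have := hq z (by omega)
      have := (h.eq_zero_of_lt hp hq i).resolve_left hi
      rw [le_inv_mul_iff₀ hpq]
      refine mul_le_mul_of_nonneg_right ?_ (norm_nonneg _)
      rw [Real.norm_eq_abs]
      exact le_trans (by linarith) (le_abs_self _)

/-- The norm of the up component is at most V/(p + q) < 1 times that of the down component, so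
electron down has the majority. This connects the spectral splitting used here with the majority
condition in `normW`. -/
lemma mem_minusEnergies (h : P.IsEigenframe (n + 1) Ψ E) {V : ℝ}
    (hV : opn (P.flip * sector N n) ≤ V) (hVpq : V < p + q)
    (hp : ∀ z : Fin N → Bool, (downs z : ℤ) = n + 1 → p ≤ P.upEnergy z)
    {i : ι} (hi : E i ≤ -q) : E i ∈ P.minusEnergies (n + 1) := by
  have hV0 : 0 ≤ V := (opn_nonneg _).trans hV
  refine ⟨fun s => Ψ s i, fun s hs => by_contra fun h0 => hs (h.numDown_eq h0), h.sum_sq i, ?_, ?_⟩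
  · ext s
    have := congrFun (congrFun h.eigen s) i
    rw [mul_diagonal, mul_comm] at this
    exact this
  · by_contra! hlt
    have hsum := h.sum_sq i
    rw [Fintype.sum_prod_type, Fintype.sum_bool] at hsum
    have h1 : (p + q) ^ 2 * ∑ z, ‖Ψ (true, z) i‖ ^ 2 ≤ V ^ 2 * ∑ z, ‖Ψ (false, z) i‖ ^ 2 := by
      have h2 := sum_sq_mulVec_le (P.flip * sector N n) fun z => Ψ (false, z) i
      have h3 : opn (P.flip * sector N n) ^ 2 ≤ V ^ 2 := pow_le_pow_left₀ (opn_nonneg _) hV 2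
      refine le_trans ?_ (h2.trans (mul_le_mul_of_nonneg_right h3
        (Finset.sum_nonneg fun _ _ => by positivity)))
      rw [Finset.mul_sum]
      refine Finset.sum_le_sum fun w _ => ?_
      have h4 : ((P.flip * sector N n) *ᵥ fun z => Ψ (false, z) i) w
          = (P.flip * part false Ψ) w i := by
        have h5 : sector N n *ᵥ (fun z => Ψ (false, z) i) = fun z => Ψ (false, z) i := by
          ext z
          rw [sector, mulVec_diagonal]
          by_cases hz : Ψ (false, z) i = 0
          · simp [hz]
          · have := h.numDown_eq hz
            rw [numDown_false] at this
            rw [if_pos (by omega), one_mul]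
        rw [← mulVec_mulVec, h5]
        rfl
      rw [h4, ← h.eigen_true, norm_mul, mul_pow, ← Complex.ofReal_sub, Complex.norm_real]
      by_cases hz : part true Ψ w i = 0
      · have hz' : Ψ (true, w) i = 0 := hz
        simp [hz, hz']
      · have := h.numDown_eq hz
        rw [numDown_true] at this
        have := hp w (by omega)
        refine mul_le_mul_of_nonneg_right ?_ (by positivity)
        rw [Real.norm_eq_abs, sq_abs]
        nlinarith
    have h6 : V ^ 2 < (p + q) ^ 2 := pow_lt_pow_left₀ hVpq hV0 two_ne_zero
    have h7 : 0 ≤ V ^ 2 := sq_nonneg V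
    have hlt' : ∑ z, ‖Ψ (false, z) i‖ ^ 2 ≤ 1 / 2 := hlt
    nlinarith

/-- The minus eigenvectors, restricted to electron down. -/
def minusPart (Ψ : Matrix (State N) ι ℂ) (E : ι → ℝ) (q : ℝ) : Matrix (Fin N → Bool) ι ℂ :=
  part false Ψ * mask fun i => E i ≤ -q

lemma minusPart_apply (Ψ : Matrix (State N) ι ℂ) (E : ι → ℝ) (q : ℝ) (z : Fin N → Bool) (i : ι) :
    minusPart Ψ E q z i = if E i ≤ -q then Ψ (false, z) i else 0 := mul_mask_apply _ _ _ _

/-- The dressed reflections of the minus eigenvectors. -/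
def dressed (P : SpinBath N) (Ψ : Matrix (State N) ι ℂ) (E : ι → ℝ) (q : ℝ) :
    Matrix (State N) ι ℂ := fun s i =>
  if s.1 = true then minusPart Ψ E q s.2 i
    else (-(E i : ℂ) + P.upEnergy s.2)⁻¹ * (P.flipᴴ * minusPart Ψ E q) s.2 i

lemma part_true_dressed : part true (dressed P Ψ E q) = minusPart Ψ E q := by
  ext z i; simp [part, dressed]

lemma part_false_dressed (z : Fin N → Bool) (i : ι) : part false (dressed P Ψ E q) z i
    = (-(E i : ℂ) + P.upEnergy z)⁻¹ * (P.flipᴴ * minusPart Ψ E q) z i := by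
  simp [part, dressed]

lemma downs_of_minusPart (h : P.IsEigenframe (n + 1) Ψ E) {z : Fin N → Bool} {i : ι}
    (hz : minusPart Ψ E q z i ≠ 0) : downs z = n ∧ E i ≤ -q := by
  rw [minusPart_apply] at hz
  obtain ⟨hi, hz⟩ := ite_ne_right_iff.1 hz
  have := h.numDown_eq hz
  rw [numDown_false] at this
  exact ⟨by omega, hi⟩

lemma downs_of_flip_minusPart (h : P.IsEigenframe (n + 1) Ψ E) {z : Fin N → Bool} {i : ι}
    (hz : (P.flipᴴ * minusPart Ψ E q) z i ≠ 0) : (downs z : ℤ) = n - 1 ∧ E i ≤ -q := by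
  rw [Matrix.mul_apply] at hz
  obtain ⟨w, -, hw⟩ := Finset.exists_ne_zero_of_sum_ne_zero hz
  have h1 := P.raises_flip_conjTranspose z w (left_ne_zero_of_mul hw)
  have h2 := h.downs_of_minusPart (right_ne_zero_of_mul hw)
  exact ⟨by omega, h2.2⟩

lemma sector_mul_minusPart (h : P.IsEigenframe (n + 1) Ψ E) :
    sector N n * minusPart Ψ E q = minusPart Ψ E q := by
  ext z i
  rw [sector, diagonal_mul]
  by_cases hz : minusPart Ψ E q z i = 0
  · simp [hz]
  · rw [if_pos (by exact_mod_cast (h.downs_of_minusPart hz).1), one_mul]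

/-- The dressed reflections are approximate eigenvectors, up to `W`. -/
lemma hs_dressed_le (h : P.IsEigenframe (n + 1) Ψ E) {V : ℝ}
    (hV : opn (P.flip * sector N n) ≤ V) (hVpq : V < p + q) (hpq : 0 < p + q)
    (hp : ∀ z : Fin N → Bool, (downs z : ℤ) = n + 1 → p ≤ P.upEnergy z)
    (hp' : ∀ z : Fin N → Bool, (downs z : ℤ) = n - 1 → p ≤ P.upEnergy z) :
    hs (P.Hrot * dressed P Ψ E q - dressed P Ψ E q * diagonal fun i => ((-E i : ℝ) : ℂ))
      ≤ P.normW (n + 1) * hs (minusPart Ψ E q) := by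
  set Φ := minusPart Ψ E q with hΦ
  -- The admixture is the exact solution of the down component of the eigenvalue equation at energy
  -- -E.
  have hfalse : part false (P.Hrot * dressed P Ψ E q
      - dressed P Ψ E q * diagonal fun i => ((-E i : ℝ) : ℂ)) = 0 := by
    ext z i
    rw [part_sub, part_mul, part_mul_right, blk_Hrot_down_up, blk_Hrot_down_down, part_true_dressed,
      Matrix.sub_apply, Matrix.add_apply, diagonal_mul, mul_diagonal, part_false_dressed]
    by_cases hz : (P.flipᴴ * Φ) z i = 0
    · simp [← hΦ, hz]
    · obtain ⟨hz1, hi⟩ := h.downs_of_flip_minusPart hz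
      have hz2 := hp' z hz1
      have hne : (-(E i : ℂ) + P.upEnergy z) ≠ 0 := by
        have : (0 : ℝ) < -E i + P.upEnergy z := by linarith
        exact_mod_cast this.ne'
      rw [← hΦ, Matrix.zero_apply]
      push_cast
      field_simp
      ring
  -- The residual in the up component is (E + energy) Φ plus the flip-flop image of the admixture;
  -- these are the first and second terms of W applied to Φ.
  have htrue : ∀ z i, part true (P.Hrot * dressed P Ψ E q
      - dressed P Ψ E q * diagonal fun i => ((-E i : ℝ) : ℂ)) z i
        = (blk (P.W (n + 1) (E i)) true true *ᵥ fun z => Φ z i) z := by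
    intro z i
    have hs1 : sector N n *ᵥ (fun z => Φ z i) = fun z => Φ z i := by
      have := h.sector_mul_minusPart (q := q)
      exact funext fun z => congrFun (congrFun this z) i
    have hfl : (fun z => (-(E i : ℂ) + P.upEnergy z)⁻¹ * (P.flipᴴ * Φ) z i)
        = fun z => part false (dressed P Ψ E q) z i := by
      ext z; rw [part_false_dressed]
    have hfl2 : P.flipᴴ *ᵥ (fun z => Φ z i) = fun z => (P.flipᴴ * Φ) z i := rfl
    -- As W uses the exact eigenvalue, its first resolvent recovers the exact up component of the
    -- eigenvector.
    have hup : E i ≤ -q → (diagonal (fun z => ((E i : ℂ) - P.upEnergy z)⁻¹) *ᵥ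
        (P.flip *ᵥ fun z => Φ z i)) = fun z => part true Ψ z i := fun hi => by
      ext w
      have h1 : (fun z => Φ z i) = fun z => part false Ψ z i := by
        ext z; rw [hΦ, minusPart_apply, if_pos hi]; rfl
      have h2 : (P.flip *ᵥ fun z => part false Ψ z i) w = (P.flip * part false Ψ) w i := rfl
      rw [mulVec_diagonal, h1, h2, ← h.eigen_true, ← mul_assoc]
      by_cases hw : part true Ψ w i = 0
      · simp [hw]
      · have := h.numDown_eq hw
        rw [numDown_true] at this
        have := hp w (by omega)
        have hne : ((E i : ℂ) - P.upEnergy w) ≠ 0 := by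
          have : E i - P.upEnergy w < 0 := by linarith
          exact_mod_cast this.ne
        rw [inv_mul_cancel₀ hne, one_mul]
    rw [part_sub, part_mul, part_mul_right, blk_Hrot_up_down, blk_Hrot_up_up, part_true_dressed,
      Matrix.sub_apply, Matrix.add_apply, diagonal_mul, mul_diagonal, blk_W]
    rw [← mulVec_mulVec, hs1, ← mulVec_mulVec, Matrix.add_mulVec, Matrix.mulVec_add]
    by_cases hi : E i ≤ -q
    · rw [← mulVec_mulVec, ← mulVec_mulVec, hup hi, ← mulVec_mulVec, ← mulVec_mulVec, hfl2]
      have h3 : (diagonal fun z => (-(E i : ℂ) + P.upEnergy z)⁻¹) *ᵥ (fun z => (P.flipᴴ * Φ) z i)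
          = fun z => part false (dressed P Ψ E q) z i := by
        rw [← hfl]; ext z; rw [mulVec_diagonal]
      rw [h3, Pi.add_apply, sector, mulVec_diagonal, mulVec_diagonal]
      have h4 : (P.flipᴴ *ᵥ fun z => part true Ψ z i) z
          = ((E i : ℂ) + P.upEnergy z) * part false Ψ z i := (h.eigen_false z i).symm
      have h5 : (P.flip *ᵥ fun z => part false (dressed P Ψ E q) z i) z
          = (P.flip * part false (dressed P Ψ E q)) z i := rfl
      have h6 : Φ z i = part false Ψ z i := by
        rw [hΦ, minusPart_apply, if_pos hi]; rfl
      have h7 : (P.flip * part false (dressed P Ψ E q)) z i ≠ 0 → (downs z : ℤ) = n := fun h0 => by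
        rw [Matrix.mul_apply] at h0
        obtain ⟨w, -, hw⟩ := Finset.exists_ne_zero_of_sum_ne_zero h0
        have h8 := P.raises_flip z w (left_ne_zero_of_mul hw)
        have h9 := right_ne_zero_of_mul hw
        rw [part_false_dressed] at h9
        have h10 := (h.downs_of_flip_minusPart (right_ne_zero_of_mul h9)).1
        omega
      rw [h4, h5, ← hΦ, h6]
      by_cases hz : (downs z : ℤ) = n
      · rw [if_pos hz]; push_cast; ring
      · have h11 : part false Ψ z i = 0 := by
          by_contra h0
          have := h.numDown_eq h0
          rw [numDown_false] at this
          omega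
        have h12 : (P.flip * part false (dressed P Ψ E q)) z i = 0 := by
          by_contra h0; exact hz (h7 h0)
        simp [h11, h12]
    · have h0 : (fun z => Φ z i) = 0 := by
        ext z; rw [hΦ, minusPart_apply, if_neg hi]; rfl
      have h1 : ∀ z, Φ z i = 0 := congrFun h0
      have h2 : ∀ z, part false (dressed P Ψ E q) z i = 0 := fun z => by
        rw [part_false_dressed, Matrix.mul_apply]
        simp [← hΦ, h1]
      rw [h0, ← hΦ, h1]
      simp [Matrix.mul_apply, h2]
  refine le_of_sq_le_sq ?_ (mul_nonneg (P.normW_nonneg _) (hs_nonneg _))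
  rw [hs_sq_eq_part, hfalse, hs_zero, zero_pow two_ne_zero, add_zero, mul_pow, hs_sq', hs_sq',
    Finset.mul_sum]
  refine Finset.sum_le_sum fun i _ => ?_
  simp_rw [htrue]
  by_cases hi : E i ≤ -q
  · refine (sum_sq_mulVec_le _ _).trans (mul_le_mul_of_nonneg_right
      (pow_le_pow_left₀ (opn_nonneg _) ((opn_blk_le_opn _ _ _).trans
      (P.opn_W_le_normW (h.mem_minusEnergies hV hVpq hp hi))) 2) ?_)
    exact Finset.sum_nonneg fun _ _ => by positivity
  · have h0 : (fun z => Φ z i) = 0 := by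
      ext z; rw [hΦ, minusPart_apply, if_neg hi]; rfl
    have h1 : ∀ z, Φ z i = 0 := congrFun h0
    rw [h0]
    simp [h1]

end IsEigenframe

end SpinBath

end

end SpinEcho

namespace SpinEcho

open Matrix

noncomputable section

namespace SpinBath

variable {N : ℕ} (P : SpinBath N)

/-! ### The commutator of the diagonal blocks -/

/-- The value of `γ_I B J_z` with `L` down spins in total. -/
def zeeman (L : ℕ) : ℝ := P.gammaI * P.B * (P.hbar / 2 * (N + 1 - 2 * L))

/-- The phases of the evolution of states of energies `l`. -/
def phases {ι : Type*} [DecidableEq ι] (t : ℝ) (l : ι → ℝ) : Matrix ι ι ℂ :=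
  diagonal fun i => Complex.exp (Complex.I * ((t / P.hbar * l i : ℝ) : ℂ))

/-! ### Phases of free evolution within a block -/

section Phases

variable {P} {ι : Type*} [Fintype ι] [DecidableEq ι]

lemma opn_phases_le (t : ℝ) (l : ι → ℝ) : opn (P.phases t l) ≤ 1 :=
  opn_diagonal_le zero_le_one fun i => by
    rw [mul_comm, Complex.norm_exp_ofReal_mul_I]

lemma hs_mul_phases_le {m : Type*} [Fintype m] (X : Matrix m ι ℂ) (t : ℝ) (l : ι → ℝ) :
    hs (X * P.phases t l) ≤ hs X :=
  (hs_mul_le' _ _).trans (mul_le_of_le_one_right (hs_nonneg _) (opn_phases_le _ _))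

lemma hs_U_mul_sub_le {L : ℕ} {X : Matrix (State N) ι ℂ}
    (hX : ∀ s i, X s i ≠ 0 → numDown s = L) (t : ℝ) (l : ι → ℝ) :
    hs (P.U t * X - X * P.phases t fun i => l i + P.zeeman L)
      ≤ |t / P.hbar| * hs (P.Hrot * X - X * diagonal fun i => (l i : ℂ)) := by
  have h : P.H * X - X * diagonal (fun i => ((l i + P.zeeman L : ℝ) : ℂ))
      = P.Hrot * X - X * diagonal fun i => (l i : ℂ) := by
    rw [H_eq_Hrot, Matrix.add_mul]
    ext s i
    simp only [Matrix.sub_apply, Matrix.add_apply, mul_diagonal, diagonal_mul]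
    by_cases hs : X s i = 0
    · simp [hs]
    · rw [hX s i hs, zeeman]
      push_cast
      ring
  rw [← h]
  exact hs_evolution_sub_le P.isHermitian_H _ _ _

end Phases

/-! ### Approximate stationarity under the diagonal blocks -/

namespace IsEigenframe

variable {P} {n : ℕ} {ι : Type*} [Fintype ι] [DecidableEq ι] {Ψ : Matrix (State N) ι ℂ} {E : ι → ℝ}
  {p q : ℝ}

lemma U_mul (h : P.IsEigenframe (n + 1) Ψ E) (t : ℝ) :
    P.U t * Ψ = Ψ * P.phases t fun i => E i + P.zeeman (n + 1) := by
  have h1 := hs_U_mul_sub_le (P := P) (X := Ψ) (fun _ _ hs => h.numDown_eq hs) t E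
  rw [h.eigen, sub_self, hs_zero, mul_zero] at h1
  have h2 : hsVec (P.U t * Ψ - Ψ * P.phases t fun i => E i + P.zeeman (n + 1)) = 0 :=
    norm_le_zero_iff.1 h1
  ext s i
  have h3 := congrFun (congrArg WithLp.ofLp h2) (s, i)
  exact sub_eq_zero.1 h3

lemma hs_minusPart_sq_le (h : P.IsEigenframe (n + 1) Ψ E) :
    hs (minusPart Ψ E q) ≤ √(sectorCard N n) := by
  refine (hs_mul_mask_le _ _).trans (Real.le_sqrt_of_sq_le (le_of_eq ?_))
  rw [← hs_sector_sq, ← Matrix.one_mul (part false Ψ), h.hs_mul_part_false, Matrix.one_mul]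

/-- Minus eigenvectors are almost stationary under the electron-down block of the evolution. -/
lemma hs_down_minusPart_le (h : P.IsEigenframe (n + 1) Ψ E) (hpq : 0 < p + q)
    (hp : ∀ z : Fin N → Bool, (downs z : ℤ) = n + 1 → p ≤ P.upEnergy z) (t : ℝ) :
    hs (blk (P.U t) false false * minusPart Ψ E q
        - minusPart Ψ E q * P.phases t fun i => E i + P.zeeman (n + 1))
      ≤ opn (blk (P.U t) false true * sector N (n + 1))
        * (hs (P.flip * sector N n) / (p + q)) := by
  have h1 := congrArg (fun X => part false X * mask fun i => E i ≤ -q) (h.U_mul t)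
  simp only [part_mul, part_mul_right, Matrix.add_mul] at h1
  have h2 : sector N (n + 1) * part true Ψ = part true Ψ := by
    ext z i
    rw [sector, diagonal_mul]
    by_cases hz : part true Ψ z i = 0
    · simp [hz]
    · have := h.numDown_eq hz
      rw [numDown_true] at this
      rw [if_pos (by omega), one_mul]
  have h3 : P.phases t (fun i => E i + P.zeeman (n + 1)) * mask (fun i => E i ≤ -q)
      = mask (fun i => E i ≤ -q) * P.phases t (fun i => E i + P.zeeman (n + 1)) := by
    rw [phases, mask, diagonal_mul_diagonal, diagonal_mul_diagonal]
    simp only [mul_comm]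
  -- In the exact evolution of the eigenvector, the only other contribution to electron down is
  -- transfer from its up component, a product of two small factors.
  have h4 : blk (P.U t) false false * minusPart Ψ E q
        - minusPart Ψ E q * P.phases t (fun i => E i + P.zeeman (n + 1))
      = -((blk (P.U t) false true * sector N (n + 1))
        * (part true Ψ * mask fun i => E i ≤ -q)) := by
    rw [Matrix.mul_assoc (part false Ψ), h3] at h1
    rw [minusPart, Matrix.mul_assoc (part false Ψ), ← h1, ← Matrix.mul_assoc (blk _ _ _ * _),
      Matrix.mul_assoc _ (sector N (n + 1)), h2, Matrix.mul_assoc (blk (P.U t) false false)]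
    abel
  rw [h4, hs_neg]
  exact (hs_mul_le _ _).trans (mul_le_mul_of_nonneg_left (h.hs_mask_up_le hpq hp) (opn_nonneg _))

/-- Minus eigenvectors are almost stationary under the electron-up block of the evolution. -/
lemma hs_up_minusPart_le (h : P.IsEigenframe (n + 1) Ψ E) {V : ℝ}
    (hV : opn (P.flip * sector N n) ≤ V) (hVpq : V < p + q) (hpq : 0 < p + q)
    (hp : ∀ z : Fin N → Bool, (downs z : ℤ) = n + 1 → p ≤ P.upEnergy z)
    (hp' : ∀ z : Fin N → Bool, (downs z : ℤ) = n - 1 → p ≤ P.upEnergy z) (t : ℝ) :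
    hs (blk (P.U t) true true * minusPart Ψ E q
        - minusPart Ψ E q * P.phases t fun i => -E i + P.zeeman n)
      ≤ |t / P.hbar| * (P.normW (n + 1) * √(sectorCard N n))
        + opn (blk (P.U t) true false * sector N (n - 1))
          * (hs (P.flipᴴ * sector N n) / (p + q)) := by
  -- Reflecting the electron lowers the total from n + 1 to n, whence the Zeeman phase of the block
  -- n.
  have hsupp : ∀ s i, dressed P Ψ E q s i ≠ 0 → numDown s = n := by
    rintro ⟨s, z⟩ i hs
    cases s
    · have h1 : part false (dressed P Ψ E q) z i ≠ 0 := hs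
      rw [part_false_dressed] at h1
      have := (h.downs_of_flip_minusPart (right_ne_zero_of_mul h1)).1
      rw [numDown_false]
      omega
    · have h1 : part true (dressed P Ψ E q) z i ≠ 0 := hs
      rw [part_true_dressed] at h1
      rw [numDown_true]
      exact (h.downs_of_minusPart h1).1
  have h1 := (hs_part_le true _).trans (hs_U_mul_sub_le (P := P) hsupp t fun i => -E i)
  rw [part_sub, part_mul, part_mul_right, part_true_dressed] at h1
  have h2 := h1.trans (mul_le_mul_of_nonneg_left
    ((h.hs_dressed_le hV hVpq hpq hp hp').trans (mul_le_mul_of_nonneg_left h.hs_minusPart_sq_le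
      (P.normW_nonneg _))) (abs_nonneg _))
  have h3 : sector N (n - 1) * part false (dressed P Ψ E q) = part false (dressed P Ψ E q) := by
    ext z i
    rw [sector, diagonal_mul]
    by_cases hz : part false (dressed P Ψ E q) z i = 0
    · simp [hz]
    · have := hsupp (false, z) i hz
      rw [numDown_false] at this
      rw [if_pos (by omega), one_mul]
  have h4 : hs (part false (dressed P Ψ E q)) ≤ hs (P.flipᴴ * sector N n) / (p + q) := by
    have h5 : hs (P.flipᴴ * minusPart Ψ E q) ≤ hs (P.flipᴴ * sector N n) := by
      rw [minusPart, ← Matrix.mul_assoc, ← h.hs_mul_part_false]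
      exact hs_mul_mask_le _ _
    have h6 : hs (part false (dressed P Ψ E q)) ≤ (p + q)⁻¹ * hs (P.flipᴴ * minusPart Ψ E q) := by
      refine hs_le_of_norm_le (inv_nonneg.2 hpq.le) fun z i => ?_
      rw [part_false_dressed, norm_mul]
      by_cases hz : (P.flipᴴ * minusPart Ψ E q) z i = 0
      · simp [hz]
      · obtain ⟨hz1, hi⟩ := h.downs_of_flip_minusPart hz
        have := hp' z hz1
        refine mul_le_mul_of_nonneg_right ?_ (norm_nonneg _)
        rw [norm_inv, ← Complex.ofReal_neg, ← Complex.ofReal_add, Complex.norm_real,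
          Real.norm_of_nonneg (by linarith)]
        exact inv_anti₀ hpq (by linarith)
    rw [div_eq_inv_mul]
    exact h6.trans (mul_le_mul_of_nonneg_left h5 (inv_nonneg.2 hpq.le))
  have h7 : hs (blk (P.U t) true false * part false (dressed P Ψ E q))
      ≤ opn (blk (P.U t) true false * sector N (n - 1))
        * (hs (P.flipᴴ * sector N n) / (p + q)) := by
    rw [← h3, ← Matrix.mul_assoc]
    exact (hs_mul_le _ _).trans (mul_le_mul_of_nonneg_left h4 (opn_nonneg _))
  have h8 : blk (P.U t) true true * minusPart Ψ E q
        - minusPart Ψ E q * P.phases t (fun i => -E i + P.zeeman n)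
      = (blk (P.U t) true true * minusPart Ψ E q
        + blk (P.U t) true false * part false (dressed P Ψ E q)
        - minusPart Ψ E q * P.phases t fun i => -E i + P.zeeman n)
        - blk (P.U t) true false * part false (dressed P Ψ E q) := by abel
  rw [h8]
  exact (hs_sub_le _ _).trans (add_le_add h2 h7)

end IsEigenframe

/-- If aΦ ≈ ΦD' and bΦ ≈ ΦD with diagonal phases, then abΦ and baΦ are both close to ΦDD'. Each
approximation error enters twice, through contractions. -/
lemma hs_blkComm_mul_minusPart_le {ι : Type*} [Fintype ι] [DecidableEq ι] (t : ℝ)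
    (Φ : Matrix (Fin N → Bool) ι ℂ) (l l' : ι → ℝ) :
    hs (blkComm (P.U t) * Φ) ≤ 2 * hs (blk (P.U t) false false * Φ - Φ * P.phases t l)
      + 2 * hs (blk (P.U t) true true * Φ - Φ * P.phases t l') := by
  set a := blk (P.U t) true true
  set b := blk (P.U t) false false
  set D := P.phases t l
  set D' := P.phases t l'
  have hD : D * D' = D' * D := by
    simp only [D, D', phases, diagonal_mul_diagonal, mul_comm]
  have h : blkComm (P.U t) * Φ = (a * (b * Φ - Φ * D) + (a * Φ - Φ * D') * D)
      - (b * (a * Φ - Φ * D') + (b * Φ - Φ * D) * D') := by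
    simp only [blkComm, Matrix.mul_sub, Matrix.sub_mul, Matrix.mul_assoc, hD]
    abel
  have hU := P.U_isometry t
  have h1 := hs_blk_mul_le hU true true (b * Φ - Φ * D)
  have h2 := hs_blk_mul_le hU false false (a * Φ - Φ * D')
  have h3 := hs_mul_phases_le (P := P) (a * Φ - Φ * D') t l
  have h4 := hs_mul_phases_le (P := P) (b * Φ - Φ * D) t l'
  rw [h]
  have h5 := hs_sub_le (a * (b * Φ - Φ * D) + (a * Φ - Φ * D') * D)
    (b * (a * Φ - Φ * D') + (b * Φ - Φ * D) * D')
  have h6 := hs_add_le (a * (b * Φ - Φ * D)) ((a * Φ - Φ * D') * D)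
  have h7 := hs_add_le (b * (a * Φ - Φ * D')) ((b * Φ - Φ * D) * D')
  linarith

lemma opn_blkComm_le (t : ℝ) : opn (blkComm (P.U t)) ≤ 2 := by
  have hU := P.U_isometry t
  have h1 := opn_mul_le (blk (P.U t) true true) (blk (P.U t) false false)
  have h2 := opn_mul_le (blk (P.U t) false false) (blk (P.U t) true true)
  have h3 := mul_le_one₀ (opn_blk_le hU true true) (opn_nonneg _) (opn_blk_le hU false false)
  have h4 := mul_le_one₀ (opn_blk_le hU false false) (opn_nonneg _) (opn_blk_le hU true true)
  have h5 := opn_sub_le (blk (P.U t) true true * blk (P.U t) false false)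
    (blk (P.U t) false false * blk (P.U t) true true)
  unfold blkComm
  linarith

/-- The sector is resolved into the down components of the eigenvectors of block n + 1, and low and
high energies contribute separately to the square. The low ones are almost stationary; for the high
ones the commutator is bounded by 2 and their down components are small. -/
lemma hs_blkComm_sq_le {n : ℕ} {p q V : ℝ}
    (hV : opn (P.flip * sector N n) ≤ V) (hVpq : V < p + q)
    (hp : ∀ z : Fin N → Bool, (downs z : ℤ) = n + 1 → p ≤ P.upEnergy z)
    (hq : ∀ z : Fin N → Bool, (downs z : ℤ) = n → q ≤ P.upEnergy z)
    (hp' : ∀ z : Fin N → Bool, (downs z : ℤ) = n - 1 → p ≤ P.upEnergy z) (t : ℝ) :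
    hs (blkComm (P.U t) * sector N n) ^ 2
      ≤ (2 * (opn (blk (P.U t) false true * sector N (n + 1))
          * (hs (P.flip * sector N n) / (p + q)))
        + 2 * (|t / P.hbar| * (P.normW (n + 1) * √(sectorCard N n))
          + opn (blk (P.U t) true false * sector N (n - 1))
            * (hs (P.flipᴴ * sector N n) / (p + q)))) ^ 2
        + 4 * (hs (P.flip * sector N n) / (p + q)) ^ 2 := by
  have hpq : 0 < p + q := ((opn_nonneg _).trans hV).trans_lt hVpq
  obtain ⟨Ψ, E, h⟩ := P.exists_isEigenframe (n + 1)
  rw [← h.hs_mul_part_false, ← hs_mul_mask_sq_add _ fun i => E i ≤ -q, Matrix.mul_assoc,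
    Matrix.mul_assoc]
  refine add_le_add (pow_le_pow_left₀ (hs_nonneg _) ?_ 2) ?_
  · refine (P.hs_blkComm_mul_minusPart_le t (IsEigenframe.minusPart Ψ E q)
      (fun i => E i + P.zeeman (n + 1)) (fun i => -E i + P.zeeman n)).trans
      (add_le_add ?_ ?_)
    · exact mul_le_mul_of_nonneg_left (h.hs_down_minusPart_le hpq hp t) zero_le_two
    · exact mul_le_mul_of_nonneg_left (h.hs_up_minusPart_le hV hVpq hpq hp hp' t) zero_le_two
  · have h1 := (hs_mul_le (blkComm (P.U t)) (part false Ψ * mask fun i => ¬ E i ≤ -q)).trans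
      (mul_le_mul (P.opn_blkComm_le t) (h.hs_mask_down_le hpq hp hq) (hs_nonneg _) zero_le_two)
    refine (pow_le_pow_left₀ (hs_nonneg _) h1 2).trans (le_of_eq ?_)
    ring

end SpinBath

end

end SpinEcho

namespace SpinEcho

open Matrix

noncomputable section

/-! ### Elementary estimates -/

lemma cFun_sq {hbar alpha w t : ℝ} (ha : 1 < alpha) : cFun hbar alpha w t ^ 2
    = 1 - (1 - 1 / alpha ^ 2) * Real.cos (alpha * w * t / hbar) + 1 / alpha ^ 2 := by
  rw [cFun, Real.sq_sqrt]
  have h1 : 1 / alpha ^ 2 ≤ 1 := by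
    rw [div_le_one (by positivity)]
    nlinarith
  have h2 : 0 ≤ 1 / alpha ^ 2 := by positivity
  have h3 := Real.cos_le_one (alpha * w * t / hbar)
  nlinarith

lemma cFun_mono {hbar alpha w w' t : ℝ} (hh : 0 < hbar) (ha : 1 < alpha) (hw : 0 ≤ w)
    (hww : w ≤ w') (ht : 0 ≤ t) (hlt : 2 * alpha * w' * t < hbar * Real.pi) :
    cFun hbar alpha w t ≤ cFun hbar alpha w' t := by
  refine Real.sqrt_le_sqrt ?_
  have h1 : 1 / alpha ^ 2 ≤ 1 := by
    rw [div_le_one (by positivity)]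
    nlinarith
  have h2 : Real.cos (alpha * w' * t / hbar) ≤ Real.cos (alpha * w * t / hbar) := by
    refine Real.cos_le_cos_of_nonneg_of_le_pi (by positivity) ?_ (by gcongr)
    rw [div_le_iff₀ hh]
    nlinarith [mul_pos hh Real.pi_pos]
  gcongr

/-- A linear lower bound for `c²`. -/
lemma le_cFun_sq {hbar alpha w t : ℝ} (hh : 0 < hbar) (ha : 1 < alpha) (hw : 0 ≤ w) (ht : 0 ≤ t)
    (hlt : 2 * alpha * w * t < hbar * Real.pi) (hc : 2 * cFun hbar alpha w t ^ 2 ≤ 1) :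
    11 / 10 * (w * t / hbar) ≤ cFun hbar alpha w t ^ 2 := by
  rw [cFun_sq ha] at hc ⊢
  set x : ℝ := w * t / hbar with hx
  have hx0 : 0 ≤ x := by positivity
  have hy : alpha * w * t / hbar = alpha * x := by rw [hx]; ring
  rw [hy] at hc ⊢
  have hlt' : alpha * x < Real.pi / 2 := by
    rw [← hy, div_lt_iff₀ hh]; linarith
  have hy0 : 0 ≤ alpha * x := by positivity
  -- The quadratic bound on cosine has constant 2/π², which exceeds 1/5.
  have hcos : Real.cos (alpha * x) ≤ 1 - (alpha * x) ^ 2 / 5 := by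
    have h1 := Real.cos_le_one_sub_mul_cos_sq (x := alpha * x)
      (by rw [abs_of_nonneg hy0]; linarith [Real.pi_pos])
    have h2 : (1 : ℝ) / 5 ≤ 2 / Real.pi ^ 2 := by
      rw [div_le_div_iff₀ (by norm_num) (by positivity)]
      nlinarith [Real.pi_lt_d2, Real.pi_pos]
    have h3 : 1 / 5 * (alpha * x) ^ 2 ≤ 2 / Real.pi ^ 2 * (alpha * x) ^ 2 :=
      mul_le_mul_of_nonneg_right h2 (sq_nonneg _)
    linarith
  set β : ℝ := 1 / alpha ^ 2 with hβ
  have hβ0 : 0 < β := by positivity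
  have hβ1 : β < 1 := by
    rw [hβ, div_lt_one (by positivity)]
    nlinarith
  have hβα : β * alpha ^ 2 = 1 := by rw [hβ]; field_simp
  have hge : 2 * β + alpha ^ 2 * x ^ 2 / 5 - x ^ 2 / 5
      ≤ 1 - (1 - β) * Real.cos (alpha * x) + β := by
    have h1 : (1 - β) * Real.cos (alpha * x) ≤ (1 - β) * (1 - (alpha * x) ^ 2 / 5) :=
      mul_le_mul_of_nonneg_left hcos (by linarith)
    have h2 : (1 - β) * (1 - (alpha * x) ^ 2 / 5)
        = 1 - β - alpha ^ 2 * x ^ 2 / 5 + β * alpha ^ 2 * x ^ 2 / 5 := by ring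
    rw [h2, hβα] at h1
    linarith
  -- AM-GM eliminates α since β α² = 1; the sharp constant is 2√(2/5) > 1.26.
  have hamgm : 126 / 100 * x ≤ 2 * β + alpha ^ 2 * x ^ 2 / 5 := by
    refine le_of_sq_le_sq ?_ (by positivity)
    have h1 : 4 * (2 * β) * (alpha ^ 2 * x ^ 2 / 5) = 8 / 5 * x ^ 2 := by
      have : 4 * (2 * β) * (alpha ^ 2 * x ^ 2 / 5) = 8 / 5 * (β * alpha ^ 2) * x ^ 2 := by ring
      rw [this, hβα, mul_one]
    nlinarith [sq_nonneg (2 * β - alpha ^ 2 * x ^ 2 / 5), sq_nonneg x]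
  -- Using c² ≤ 1/2, the crude bound on x improves to x ≤ 0.6; then x²/5 ≤ 0.12x, leaving more than
  -- 1.1x.
  have hx1 : x < 16 / 10 := by
    have : x ≤ alpha * x := le_mul_of_one_le_left hx0 ha.le
    linarith [Real.pi_lt_d2]
  have hx2 : x ≤ 6 / 10 := by nlinarith
  nlinarith

lemma lowerBound_anti {xi xi' eps eps' c c' : ℝ} (hxi : 0 ≤ xi) (heps : 0 ≤ eps) (hc : 0 ≤ c)
    (h1 : xi ≤ xi') (h2 : eps ≤ eps') (h3 : c ≤ c') :
    lowerBound xi' eps' c' ≤ lowerBound xi eps c := by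
  unfold lowerBound
  have a1 : eps ^ 2 ≤ eps' ^ 2 := pow_le_pow_left₀ heps h2 2
  have a2 : eps * √xi ≤ eps' * √xi' :=
    mul_le_mul h2 (Real.sqrt_le_sqrt h1) (Real.sqrt_nonneg _) (heps.trans h2)
  have a3 : eps ^ 2 * xi ≤ eps' ^ 2 * xi' := mul_le_mul a1 h1 hxi (by positivity)
  have a4 : eps * c ≤ eps' * c' := mul_le_mul h2 h3 hc (heps.trans h2)
  have a5 : c ^ 2 ≤ c' ^ 2 := pow_le_pow_left₀ hc h3 2
  linarith

/-- From ε ≥ r(1 + r) and √ξ ≥ r, the terms 2ξ + 4ε² + 4ε√ξ are at least 10r² + 12r³ + 4r⁴, whose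
leading part is exactly the allowed loss. Positivity keeps r and x small, so 2c² pays for 2x(x +
7r²) and the higher-order terms for 49r⁴/2. -/
lemma two_mul_lowerBound_le {r xi eps c x : ℝ} (hr : 0 ≤ r) (hr2 : 2 * r ≤ 1) (hxi : r ^ 2 ≤ xi)
    (heps : r / (1 - r) ≤ eps) (hc : 0 ≤ c) (hx : 0 ≤ x)
    (hcx : 2 * c ^ 2 ≤ 1 → 11 / 10 * x ≤ c ^ 2) (hpos : 0 < lowerBound xi eps c) :
    2 * lowerBound xi eps c ≤ 1 - 10 * r ^ 2 - 2 * (x + 7 / 2 * r ^ 2) ^ 2 := by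
  have hs : r ≤ √xi := Real.le_sqrt_of_sq_le hxi
  have he : r * (1 + r) ≤ eps := by
    refine le_trans ?_ heps
    rw [le_div_iff₀ (by linarith)]
    nlinarith [pow_nonneg hr 3]
  have he0 : 0 ≤ eps := le_trans (by positivity) he
  have h1 : (r * (1 + r)) ^ 2 ≤ eps ^ 2 := pow_le_pow_left₀ (by positivity) he 2
  have h2 : r * (1 + r) * r ≤ eps * √xi := mul_le_mul he hs hr he0
  have h3 : 0 ≤ eps ^ 2 * xi := mul_nonneg (sq_nonneg _) (le_trans (sq_nonneg _) hxi)
  have h4 : 0 ≤ eps * c := mul_nonneg he0 hc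
  have h5 : 0 ≤ r ^ 3 := pow_nonneg hr 3
  unfold lowerBound at hpos ⊢
  have h6 : 10 * r ^ 2 + 2 * c ^ 2 ≤ 1 := by nlinarith [pow_nonneg hr 4]
  have hcx' := hcx (by nlinarith)
  have h7 : r ^ 4 ≤ r ^ 3 / 2 := by nlinarith
  have h8 : x * (x + 7 * r ^ 2) ≤ x * 1 := mul_le_mul_of_nonneg_left (by linarith) hx
  nlinarith

namespace SpinBath

variable {N : ℕ} (P : SpinBath N)

lemma eps_nonneg (L : ℕ) : 0 ≤ P.eps L := le_trans (Real.sqrt_nonneg _) (le_max_left _ _)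

/-- Dropping the energy spread from the numerator of ε_⇓² leaves (V_max/(Δ - V_max))². -/
lemma gap_ratio_le_eps {n : ℕ} (hV : P.Vmax (n + 1) < P.lowUp (n + 1) + P.lowUp n) :
    P.Vmax (n + 1) / (P.lowUp (n + 1) + P.lowUp n)
      / (1 - P.Vmax (n + 1) / (P.lowUp (n + 1) + P.lowUp n)) ≤ P.eps (n + 1) := by
  have hV0 := P.Vmax_nonneg (n + 1)
  have hΔ : 0 < P.lowUp (n + 1) + P.lowUp n := hV0.trans_lt hV
  refine le_trans ?_ (le_max_right _ _)
  refine Real.le_sqrt_of_sq_le ?_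
  have h1 : P.EminPlus (n + 1) - P.E0maxDown (n + 1)
      = P.lowUp (n + 1) + P.lowUp n - P.Vmax (n + 1) := by
    rw [EminPlus, ← gap_eq]; ring
  have h2 : P.Vmax (n + 1) / (P.lowUp (n + 1) + P.lowUp n)
      / (1 - P.Vmax (n + 1) / (P.lowUp (n + 1) + P.lowUp n))
      = P.Vmax (n + 1) / (P.lowUp (n + 1) + P.lowUp n - P.Vmax (n + 1)) := by
    have : P.lowUp (n + 1) + P.lowUp n - P.Vmax (n + 1) ≠ 0 := by linarith
    field_simp
  rw [epsDownSq, h1, h2, div_pow]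
  gcongr
  have := sq_nonneg (P.E0maxDown (n + 1) - P.E0minDown (n + 1))
  linarith

lemma xi2_eq (n : ℕ) : P.xi2 (n + 1)
    = 1 / 2 - 1 / 2 * √(1 - 4 * (P.Vmax (n + 1) / (P.lowUp (n + 1) + P.lowUp n)) ^ 2) := by
  rw [xi2, gap_eq, div_pow, mul_div_assoc]

lemma sq_gap_ratio_le_xi2 (n : ℕ)
    (h : 2 * (P.Vmax (n + 1) / (P.lowUp (n + 1) + P.lowUp n)) ≤ 1)
    (h0 : 0 ≤ P.Vmax (n + 1) / (P.lowUp (n + 1) + P.lowUp n)) :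
    (P.Vmax (n + 1) / (P.lowUp (n + 1) + P.lowUp n)) ^ 2 ≤ P.xi2 (n + 1) := by
  rw [xi2_eq]
  set r := P.Vmax (n + 1) / (P.lowUp (n + 1) + P.lowUp n)
  have : √(1 - 4 * r ^ 2) ≤ 1 - 2 * r ^ 2 := by
    rw [Real.sqrt_le_left (by nlinarith)]
    nlinarith [sq_nonneg (r ^ 2)]
  linarith

lemma xi2_nonneg (n : ℕ) : 0 ≤ P.xi2 (n + 1) := by
  rw [xi2_eq]
  have : √(1 - 4 * (P.Vmax (n + 1) / (P.lowUp (n + 1) + P.lowUp n)) ^ 2) ≤ 1 := by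
    rw [Real.sqrt_le_one]
    nlinarith [sq_nonneg (P.Vmax (n + 1) / (P.lowUp (n + 1) + P.lowUp n))]
  linarith

/-- A positive lower bound is dominated by the loss estimate in terms of the ratio of `V_max` to
the gap. -/
lemma two_mul_lowerBound_le_loss (hhbar : 0 < P.hbar) {n : ℕ}
    (hV : P.Vmax (n + 1) < P.lowUp (n + 1) + P.lowUp n) {alpha t : ℝ} (ha : 1 < alpha) (ht : 0 ≤ t)
    (hlt : 2 * alpha * P.normW (n + 1) * t < P.hbar * Real.pi)
    (hpos : 0 < lowerBound (P.xi2 (n + 1)) (P.eps (n + 1))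
      (cFun P.hbar alpha (P.normW (n + 1)) t)) :
    2 * lowerBound (P.xi2 (n + 1)) (P.eps (n + 1)) (cFun P.hbar alpha (P.normW (n + 1)) t)
      ≤ 1 - 10 * (P.Vmax (n + 1) / (P.lowUp (n + 1) + P.lowUp n)) ^ 2
        - 2 * (P.normW (n + 1) * t / P.hbar
          + 7 / 2 * (P.Vmax (n + 1) / (P.lowUp (n + 1) + P.lowUp n)) ^ 2) ^ 2 := by
  have hΔ : 0 < P.lowUp (n + 1) + P.lowUp n := (P.Vmax_nonneg _).trans_lt hV
  have hr0 : 0 ≤ P.Vmax (n + 1) / (P.lowUp (n + 1) + P.lowUp n) :=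
    div_nonneg (P.Vmax_nonneg _) hΔ.le
  have hr2 : 2 * (P.Vmax (n + 1) / (P.lowUp (n + 1) + P.lowUp n)) ≤ 1 := by
    -- Above 1/2 the radicand in ξ₂ is negative, so ξ₂ = 1/2 and the lower bound cannot be positive.
    by_contra! h
    have hxi : P.xi2 (n + 1) = 1 / 2 := by
      rw [xi2_eq, Real.sqrt_eq_zero_of_nonpos (by nlinarith)]; norm_num
    have he := P.eps_nonneg (n + 1)
    have hc : 0 ≤ cFun P.hbar alpha (P.normW (n + 1)) t := Real.sqrt_nonneg _
    have h1 := mul_nonneg he hc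
    have h2 := mul_nonneg he (Real.sqrt_nonneg (P.xi2 (n + 1)))
    have h3 := mul_nonneg (sq_nonneg (P.eps (n + 1))) (P.xi2_nonneg n)
    have h4 := sq_nonneg (cFun P.hbar alpha (P.normW (n + 1)) t)
    have h5 := sq_nonneg (P.eps (n + 1))
    rw [lowerBound] at hpos
    linarith
  have hw := P.normW_nonneg (n + 1)
  exact two_mul_lowerBound_le hr0 hr2 (P.sq_gap_ratio_le_xi2 n hr2 hr0) (P.gap_ratio_le_eps hV)
    (Real.sqrt_nonneg _) (by positivity) (le_cFun_sq hhbar ha hw ht hlt) hpos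

/-! ### The echo of a sector -/

/-- M counts configurations; u and v are norms of the flip-flop matrix and its adjoint over the gap;
b₁, b₂ are spectral and fm, fp Hilbert-Schmidt norms of transfer blocks; C is the commutator norm.
Transfer costs 8r² and the high-energy part of the commutator 2r², per configuration. -/
lemma loss_le {M s r x u v b₁ b₂ fm fp C : ℝ} (hs : 0 ≤ s) (hM : s ^ 2 = M) (hr : 0 ≤ r)
    (hx : 0 ≤ x) (hu : 0 ≤ u) (hv : 0 ≤ v) (huv : u ^ 2 + v ^ 2 ≤ M * r ^ 2)
    (hb₁ : b₁ ≤ 2 * r) (hb₁' : 0 ≤ b₁) (hb₂ : b₂ ≤ 2 * √2 * r) (hb₂' : 0 ≤ b₂)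
    (hfm : fm ≤ 2 * u) (hfm' : 0 ≤ fm) (hfp : fp ≤ 2 * v) (hfp' : 0 ≤ fp)
    (hC : C ^ 2 ≤ (2 * (b₁ * u) + 2 * (x * s + b₂ * v)) ^ 2 + 4 * u ^ 2) :
    2 * (fm ^ 2 + fp ^ 2) + C ^ 2 / 2 ≤ M * (10 * r ^ 2 + 2 * (x + 7 / 2 * r ^ 2) ^ 2) := by
  have h1 : fm ^ 2 ≤ (2 * u) ^ 2 := pow_le_pow_left₀ hfm' hfm 2
  have h2 : fp ^ 2 ≤ (2 * v) ^ 2 := pow_le_pow_left₀ hfp' hfp 2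
  -- Cauchy-Schwarz gives the constant √(4 + 8) = √12 < 7/2.
  have h3 : 2 * u + 2 * √2 * v ≤ 7 / 2 * (s * r) := by
    refine le_of_sq_le_sq ?_ (by positivity)
    have h4 : √2 ^ 2 = 2 := Real.sq_sqrt zero_le_two
    have h5 : (2 * u + 2 * √2 * v) ^ 2 ≤ 12 * (u ^ 2 + v ^ 2) := by
      nlinarith [sq_nonneg (√2 * u - v)]
    have h6 : (7 / 2 * (s * r)) ^ 2 = 49 / 4 * (M * r ^ 2) := by rw [← hM]; ring
    nlinarith [sq_nonneg (s * r)]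
  have h7 : b₁ * u + b₂ * v ≤ r * (2 * u + 2 * √2 * v) := by
    have := mul_le_mul_of_nonneg_right hb₁ hu
    have := mul_le_mul_of_nonneg_right hb₂ hv
    nlinarith
  have h8 : r * (2 * u + 2 * √2 * v) ≤ r * (7 / 2 * (s * r)) := mul_le_mul_of_nonneg_left h3 hr
  have h9 : (2 * (b₁ * u) + 2 * (x * s + b₂ * v)) ^ 2 ≤ (2 * (s * (x + 7 / 2 * r ^ 2))) ^ 2 := by
    refine pow_le_pow_left₀ (by positivity) ?_ 2
    linarith
  have h10 : (2 * (s * (x + 7 / 2 * r ^ 2))) ^ 2 = 4 * (M * (x + 7 / 2 * r ^ 2) ^ 2) := by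
    rw [← hM]; ring
  rw [h10] at h9
  nlinarith

lemma hs_flip_sq_le (hA : ∀ j, 0 ≤ P.A j) {L : ℕ} (h1 : 1 ≤ L) (hL : L ≤ N) (k : ℤ) :
    hs (P.flip * sector N k) ^ 2 + hs (P.flipᴴ * sector N k) ^ 2
      ≤ sectorCard N k * P.Vmax L ^ 2 := by
  rw [hs_flip_sq_add, Vmax, mul_pow, Real.sq_sqrt
    (mul_nonneg (P.Atop_nonneg hA _) (P.Atop_nonneg hA _))]
  have := P.sum_sq_le_Atop_mul_Atop hA h1 hL
  have h2 : (1 / 2 * P.hbar ^ 2) ^ 2 = (P.hbar ^ 2 / 2) ^ 2 := by ring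
  rw [h2]
  gcongr

lemma lowUp_le (hA : ∀ j, 0 ≤ P.A j) {k l : ℕ} (hl : l ≤ N) (z : Fin N → Bool) (hz : downs z = k)
    (hkl : k ≤ l) : P.lowUp l ≤ P.upEnergy z :=
  (P.lowUp_anti hA hkl hl).trans (hz ▸ P.lowUp_le_upEnergy z)

lemma re_sum_echoTerm_ge_loss (hhbar : 0 < P.hbar) (hA : ∀ j, 0 ≤ P.A j) {n : ℕ} (hn : n + 1 ≤ N)
    (hV : P.Vmax (n + 1) < P.lowUp (n + 1) + P.lowUp n) {t : ℝ} (ht : 0 ≤ t) :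
    sectorCard N n * (1 - 10 * (P.Vmax (n + 1) / (P.lowUp (n + 1) + P.lowUp n)) ^ 2
        - 2 * (P.normW (n + 1) * t / P.hbar
          + 7 / 2 * (P.Vmax (n + 1) / (P.lowUp (n + 1) + P.lowUp n)) ^ 2) ^ 2)
      ≤ (∑ z with (downs z : ℤ) = n, echoTerm (P.Uecho t) z).re := by
  have hΔ : 0 < P.lowUp (n + 1) + P.lowUp n := (P.Vmax_nonneg _).trans_lt hV
  have hp : ∀ z : Fin N → Bool, (downs z : ℤ) = n + 1 → P.lowUp (n + 1) ≤ P.upEnergy z :=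
    fun z hz => P.lowUp_le hA hn z rfl (by omega)
  have hq : ∀ z : Fin N → Bool, (downs z : ℤ) = n → P.lowUp n ≤ P.upEnergy z :=
    fun z hz => P.lowUp_le hA (by omega) z rfl (by omega)
  -- Monotonicity of `lowUp` lets the bound for n + 1 down spins serve n - 1 as well, so a single
  -- gap covers both neighbouring transitions.
  have hp' : ∀ z : Fin N → Bool, (downs z : ℤ) = n - 1 → P.lowUp (n + 1) ≤ P.upEnergy z :=
    fun z hz => P.lowUp_le hA hn z rfl (by omega)
  have h0 := re_sum_echoTerm_ge (P.U_isometry t) (P.conserves_U t) n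
  have hC := P.hs_blkComm_sq_le (P.opn_flip_le_Vmax hA hn) hV hp hq hp' t
  have hfm := hs_up_down_le t hΔ fun w z hz hw => add_le_add (hp w hw) (hq z hz)
  have hfp := hs_down_up_le (k := n) t hΔ fun w z hz hw => add_le_add
    (hp' w (by omega)) (hq z hz)
  have hb₁ := opn_down_up_le t hΔ hp hq
  have hb₂ := opn_up_down_le (P := P) (k := n - 1) (p := P.lowUp n) (q := P.lowUp (n + 1)) t
    (by linarith) (fun w hw => hq w (by omega)) hp'
  have hF := P.hs_flip_sq_le hA (by omega : 1 ≤ n + 1) hn n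
  have hw := P.normW_nonneg (n + 1)
  have hloss := loss_le (M := sectorCard N n) (s := √(sectorCard N n))
    (r := P.Vmax (n + 1) / (P.lowUp (n + 1) + P.lowUp n)) (x := P.normW (n + 1) * t / P.hbar)
    (u := hs (P.flip * sector N n) / (P.lowUp (n + 1) + P.lowUp n))
    (v := hs (P.flipᴴ * sector N n) / (P.lowUp (n + 1) + P.lowUp n))
    (b₁ := opn (blk (P.U t) false true * sector N (n + 1)))
    (b₂ := opn (blk (P.U t) true false * sector N (n - 1)))
    (fm := hs (blk (P.U t) true false * sector N n))
    (fp := hs (blk (P.U t) false true * sector N n))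
    (C := hs (blkComm (P.U t) * sector N n))
    (Real.sqrt_nonneg _) (Real.sq_sqrt (Nat.cast_nonneg _)) (div_nonneg (P.Vmax_nonneg _) hΔ.le)
    (by positivity) (div_nonneg (hs_nonneg _) hΔ.le) (div_nonneg (hs_nonneg _) hΔ.le) ?_ ?_
    (opn_nonneg _) ?_ (opn_nonneg _) (by rw [← mul_div_assoc]; exact hfm) (hs_nonneg _)
    (by rw [← mul_div_assoc]; exact hfp) (hs_nonneg _) ?_
  · have : P.Uecho t = P.U t * Rpi N * P.U t := rfl
    rw [this]
    linarith
  · rw [div_pow, div_pow, div_pow, ← add_div, ← mul_div_assoc]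
    gcongr
  · refine hb₁.trans ?_
    rw [← mul_div_assoc]
    gcongr
    exact P.opn_flip_le_Vmax hA hn
  · refine hb₂.trans ?_
    rw [← mul_div_assoc, add_comm (P.lowUp n), mul_assoc]
    gcongr
    exact P.opn_flip_pred_le_Vmax hA hn
  · refine hC.trans (le_of_eq ?_)
    rw [abs_of_nonneg (by positivity)]
    ring

/-- Only one configuration has all nuclei down, and there the diagonal blocks are scalars. -/
lemma blkComm_mul_sector_top {U : Op N} (hU : Conserves U) : blkComm U * sector N N = 0 := by
  have hz : ∀ z : Fin N → Bool, (downs z : ℤ) = N → z = fun _ => false := fun z hz => by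
    have h1 : (Finset.univ.filter fun j => z j = false).card = (Finset.univ : Finset (Fin N)).card := by
      rw [Finset.card_fin]; exact_mod_cast hz
    have h2 := Finset.eq_of_subset_of_card_le (Finset.filter_subset _ _) h1.ge
    ext j
    have := Finset.mem_univ j
    rw [← h2, Finset.mem_filter] at this
    exact this.2 ▸ rfl
  have hX : ∀ X : Matrix (Fin N → Bool) (Fin N → Bool) ℂ, Raises 0 X →
      X * sector N N = X (fun _ => false) (fun _ => false) • sector N N := fun X hX => by
    ext w z
    rw [Matrix.smul_apply, sector, mul_diagonal, diagonal_apply]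
    by_cases h1 : (downs z : ℤ) = N
    · by_cases h2 : w = z
      · subst h2
        simp only [h1, if_true, smul_eq_mul, ← hz w h1]
      · rw [if_pos h1, if_neg h2, smul_zero, mul_one]
        by_contra h3
        have := hX w z h3
        exact h2 ((hz w (by omega)).trans (hz z h1).symm)
    · rw [if_neg h1, mul_zero]
      by_cases h2 : w = z
      · rw [if_pos h2, if_neg (h2 ▸ h1), smul_zero]
      · rw [if_neg h2, smul_zero]
  have ha := hX _ (hU.raises_self true)
  have hb := hX _ (hU.raises_self false)
  rw [blkComm, Matrix.sub_mul, Matrix.mul_assoc, Matrix.mul_assoc, ha, hb, Matrix.mul_smul,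
    Matrix.mul_smul, ha, hb, smul_smul, smul_smul, mul_comm, sub_self]

/-- With electron down this configuration lies in the block N + 1, outside the range of the
constants. Without a commutator only transfer is lost, and it is measured with the gap and V_max of
the block N. -/
lemma re_sum_echoTerm_top_ge (hA : ∀ j, 0 ≤ P.A j) {n : ℕ} (hn : n + 1 = N)
    (hV : P.Vmax (n + 1) < P.lowUp (n + 1) + P.lowUp n) (t : ℝ) :
    sectorCard N N * (1 - 8 * (P.Vmax (n + 1) / (P.lowUp (n + 1) + P.lowUp n)) ^ 2)
      ≤ (∑ z with (downs z : ℤ) = N, echoTerm (P.Uecho t) z).re := by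
  have hΔ : 0 < P.lowUp (n + 1) + P.lowUp n := (P.Vmax_nonneg _).trans_lt hV
  have h0 := re_sum_echoTerm_ge (P.U_isometry t) (P.conserves_U t) N
  rw [blkComm_mul_sector_top (P.conserves_U t), hs_zero] at h0
  have hle : ∀ w : Fin N → Bool, downs w ≤ N := fun w => by
    have := card_up w; omega
  -- Vacuous gap condition: no configuration has N + 1 down nuclei.
  have hfm := hs_up_down_le (P := P) (k := N) t hΔ fun w z hz hw => by
    have := hle w; omega
  have hfp := hs_down_up_le (P := P) (k := N) t hΔ fun w z hz hw => by
    have h1 := P.lowUp_le hA hn.le z rfl (by omega)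
    have h2 := P.lowUp_le hA (by omega : n ≤ N) w rfl (by omega)
    linarith
  have hF := P.hs_flip_sq_le hA (by omega : 1 ≤ n + 1) hn.le N
  have h1 := pow_le_pow_left₀ (hs_nonneg _) hfm 2
  have h2 := pow_le_pow_left₀ (hs_nonneg _) hfp 2
  have h3 : (2 * hs (P.flip * sector N N) / (P.lowUp (n + 1) + P.lowUp n)) ^ 2
      + (2 * hs (P.flipᴴ * sector N N) / (P.lowUp (n + 1) + P.lowUp n)) ^ 2
      ≤ 4 * (sectorCard N N * (P.Vmax (n + 1) / (P.lowUp (n + 1) + P.lowUp n)) ^ 2) := by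
    rw [div_pow, div_pow, div_pow, ← add_div, ← mul_div_assoc, ← mul_div_assoc]
    gcongr
    linarith
  have : P.Uecho t = P.U t * Rpi N * P.U t := rfl
  rw [this]
  linarith

end SpinBath

end

end SpinEcho

namespace SpinEcho

open Matrix

noncomputable section

/-! ### The time bound -/

/-- The times `boundTimes` have a largest element. -/
lemma exists_isGreatest_boundTimes {hbar w cmax : ℝ} (hh : 0 < hbar) (hw : 0 < w) (hc : 0 < cmax)
    (hc1 : cmax ^ 2 < 1) : ∃ tb, IsGreatest (boundTimes hbar w cmax) tb := by
  set S : Set ℝ := {alpha | 1 < alpha ∧ 2 / alpha ^ 2 ≤ cmax ^ 2} with hS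
  set g : ℝ → ℝ := fun alpha => hbar / (w * alpha) *
      Real.arccos ((1 - cmax ^ 2 + 1 / alpha ^ 2) / (1 - 1 / alpha ^ 2)) with hg
  -- The smallest admissible α, where the argument of arccos equals 1.
  set a₀ : ℝ := √2 / cmax with ha₀
  have hs2 : √2 ^ 2 = 2 := Real.sq_sqrt zero_le_two
  have ha₀1 : 1 < a₀ := by
    rw [ha₀, one_lt_div hc]
    refine lt_of_pow_lt_pow_left₀ 2 (by positivity) ?_
    linarith
  have hmem : ∀ a, a₀ ≤ a → a ∈ S := fun a ha => by
    have h1 : a₀ ^ 2 ≤ a ^ 2 := pow_le_pow_left₀ (by positivity) ha 2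
    have h2 : a₀ ^ 2 * cmax ^ 2 = 2 := by rw [ha₀, div_pow, hs2]; field_simp
    refine ⟨by linarith, ?_⟩
    rw [div_le_iff₀ (by nlinarith)]
    nlinarith [sq_nonneg cmax]
  have hmem' : ∀ a ∈ S, a₀ ≤ a := fun a ha => by
    obtain ⟨h1, h2⟩ := ha
    rw [div_le_iff₀ (by positivity)] at h2
    rw [ha₀, div_le_iff₀ hc]
    refine le_of_sq_le_sq ?_ (by positivity)
    rw [hs2, mul_pow, mul_comm]
    exact h2
  have hpos : 0 < g (2 * a₀) := by
    have h2 : a₀ ^ 2 * cmax ^ 2 = 2 := by rw [ha₀, div_pow, hs2]; field_simp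
    have hβ : 1 / (2 * a₀) ^ 2 = cmax ^ 2 / 8 := by
      rw [div_eq_div_iff (by positivity) (by norm_num)]
      linarith
    refine mul_pos (by positivity) (Real.arccos_pos.2 ?_)
    rw [hβ, div_lt_one (by linarith)]
    nlinarith [pow_pos hc 2]
  -- Since arccos ≤ π, beyond this R every time lies below the positive one at 2a₀; the supremum is
  -- therefore attained on a compact interval.
  set R : ℝ := max (2 * a₀) (hbar * Real.pi / (w * g (2 * a₀))) with hR
  have hcont : ContinuousOn g (Set.Icc a₀ R) := by
    have h0 : ∀ a ∈ Set.Icc a₀ R, 1 < a := fun a ha => ha₀1.trans_le ha.1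
    refine ContinuousOn.mul (ContinuousOn.div continuousOn_const (by fun_prop)
      fun a ha => ?_) (Real.continuous_arccos.comp_continuousOn (ContinuousOn.div ?_ ?_ fun a ha => ?_))
    · have := h0 a ha
      positivity
    · refine continuousOn_const.add (continuousOn_const.div (by fun_prop) fun a ha => ?_)
      have := h0 a ha
      positivity
    · refine continuousOn_const.sub (continuousOn_const.div (by fun_prop) fun a ha => ?_)
      have := h0 a ha
      positivity
    · have h1 := h0 a ha
      have : 1 / a ^ 2 < 1 := by
        rw [div_lt_one (by positivity)]
        nlinarith
      linarith
  have hmem2 : 2 * a₀ ∈ Set.Icc a₀ R := ⟨by linarith, le_max_left _ _⟩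
  obtain ⟨a, ha, hmax⟩ := isCompact_Icc.exists_isMaxOn ⟨_, hmem2⟩ hcont
  refine ⟨g a, ⟨a, hmem a ha.1, rfl⟩, ?_⟩
  rintro _ ⟨b, hb, rfl⟩
  change g b ≤ g a
  by_cases hbR : b ≤ R
  · exact hmax ⟨hmem' b hb, hbR⟩
  · refine le_trans ?_ (hmax hmem2)
    change g b ≤ g (2 * a₀)
    have hb1 := hb.1
    have h1 : g b ≤ hbar / (w * b) * Real.pi :=
      mul_le_mul_of_nonneg_left (Real.arccos_le_pi _) (by positivity)
    refine h1.trans ?_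
    have h2 : hbar * Real.pi / (w * g (2 * a₀)) ≤ b := (le_max_right _ _).trans (not_le.1 hbR).le
    rw [div_le_iff₀ (by positivity)] at h2
    rw [div_mul_eq_mul_div, div_le_iff₀ (by positivity)]
    linarith

lemma exp_one_inv_bounds : 0 < 1 / (2 * Real.exp 1) ∧ 1 / (2 * Real.exp 1) < 1 / 2 := by
  have := Real.exp_one_gt_d9
  refine ⟨by positivity, ?_⟩
  rw [div_lt_div_iff₀ (by positivity) (by norm_num)]
  linarith

lemma sq_cMax_lt {xi eps cmax : ℝ} (hxi : 0 ≤ xi) (heps : 0 ≤ eps) (h : IsCMax xi eps cmax) :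
    cmax ^ 2 < 1 / 2 := by
  obtain ⟨h0, h1⟩ := h
  have h2 := exp_one_inv_bounds.1
  have h3 := mul_nonneg heps h0.le
  have h4 := mul_nonneg heps (Real.sqrt_nonneg xi)
  have h5 := mul_nonneg (sq_nonneg eps) hxi
  have h6 := sq_nonneg eps
  linarith

/-- Before the times in `boundTimes`, the lower bound exceeds `1 / (2e)`. -/
lemma lt_lowerBound_of_lt_boundTimes {hbar w xi eps cmax alpha t : ℝ} (hh : 0 < hbar) (hw : 0 < w)
    (hxi : 0 ≤ xi) (heps : 0 ≤ eps) (h : IsCMax xi eps cmax) (ha : 1 < alpha)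
    (ht : 0 ≤ t) (hlt : t < hbar / (w * alpha) *
      Real.arccos ((1 - cmax ^ 2 + 1 / alpha ^ 2) / (1 - 1 / alpha ^ 2))) :
    2 * alpha * w * t < hbar * Real.pi ∧
      1 / (2 * Real.exp 1) < lowerBound xi eps (cFun hbar alpha w t) := by
  have hc2 := sq_cMax_lt hxi heps h
  set a := (1 - cmax ^ 2 + 1 / alpha ^ 2) / (1 - 1 / alpha ^ 2) with hadef
  have hβ : 1 / alpha ^ 2 < 1 := by
    rw [div_lt_one (by positivity)]
    nlinarith
  have hβ0 : 0 < 1 / alpha ^ 2 := by positivity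
  have ha0 : 0 ≤ a := div_nonneg (by linarith) (by linarith)
  have hy : alpha * w * t / hbar < Real.arccos a := by
    rw [div_mul_eq_mul_div, lt_div_iff₀ (by positivity)] at hlt
    rw [div_lt_iff₀ hh]
    linarith
  -- Nonnegativity of a, from c_max² < 1/2, keeps these times within the range where the signal
  -- bound applies.
  have hy2 : Real.arccos a ≤ Real.pi / 2 := Real.arccos_le_pi_div_two.2 ha0
  have hy0 : 0 ≤ alpha * w * t / hbar := by positivity
  refine ⟨?_, ?_⟩
  · have := hy.trans_le hy2
    rw [div_lt_iff₀ hh] at this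
    linarith
  · have ha1 : a < 1 := Real.arccos_pos.1 (hy0.trans_lt hy)
    have hcos : a < Real.cos (alpha * w * t / hbar) := by
      have := Real.strictAntiOn_cos ⟨hy0, by linarith [Real.pi_pos]⟩
        ⟨Real.arccos_nonneg a, Real.arccos_le_pi a⟩ hy
      rwa [Real.cos_arccos (by linarith) ha1.le] at this
    have hc : cFun hbar alpha w t ^ 2 < cmax ^ 2 := by
      rw [cFun_sq ha]
      rw [hadef, div_lt_iff₀ (by linarith)] at hcos
      linarith
    have hc' : cFun hbar alpha w t < cmax := lt_of_pow_lt_pow_left₀ 2 h.1.le hc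
    have h1 := mul_le_mul_of_nonneg_left hc'.le heps
    have h2 := mul_nonneg heps h.1.le
    have h3 := h.2
    have h4 : 1 / Real.exp 1 = 2 * (1 / (2 * Real.exp 1)) := by field_simp
    unfold lowerBound
    linarith

namespace SpinBath

variable {N : ℕ} (P : SpinBath N)

/-- A crossing before tb would contradict the strict bound above 1/(2e) there, so tb bounds all
crossings from below; continuity of the signal plays no role. -/
lemma le_T2 {rho : Op N} {xi eps w cmax tb : ℝ} (hh : 0 < P.hbar) (hw : 0 < w) (hxi : 0 ≤ xi)
    (heps : 0 ≤ eps) (hc : IsCMax xi eps cmax) (htb : tb ∈ boundTimes P.hbar w cmax)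
    (h : ∀ alpha t : ℝ, 1 < alpha → 0 ≤ t → 2 * alpha * w * t < P.hbar * Real.pi →
      lowerBound xi eps (cFun P.hbar alpha w t) ≤ P.echo rho t) : (tb : EReal) ≤ P.T2 rho := by
  refine le_sInf ?_
  rintro _ ⟨t, ⟨ht0, ht⟩, rfl⟩
  rw [EReal.coe_le_coe_iff]
  by_contra! hlt
  obtain ⟨alpha, ⟨ha, -⟩, rfl⟩ := htb
  obtain ⟨h1, h2⟩ := lt_lowerBound_of_lt_boundTimes hh hw hxi heps hc ha ht0 hlt
  have := h alpha t ha ht0 h1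
  linarith

/-! ### The echo of the two initial states -/

lemma echo_eq {rho : Op N} {q : (Fin N → Bool) → ℂ} (h0 : blk rho false false = diagonal q)
    (h1 : ∀ s s', s = true ∨ s' = true → blk rho s s' = 0) (t : ℝ) :
    P.echo rho t = 1 / 2 * ‖∑ z, q z * echoTerm (P.Uecho t) z‖ := by
  rw [echo, trace_echo _ _ q h0 h1, norm_mul]
  norm_num

lemma echo_rhoBlock (n : ℕ) (t : ℝ) : P.echo (rhoBlock N (n + 1)) t
    = 1 / 2 * ((sectorCard N n : ℝ)⁻¹ * ‖∑ z with (downs z : ℤ) = n, echoTerm (P.Uecho t) z‖) := by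
  rw [P.echo_eq (q := fun z => (sectorCard N n : ℂ)⁻¹ * if (downs z : ℤ) = n then 1 else 0)]
  · simp_rw [mul_assoc]
    rw [← Finset.mul_sum, norm_mul, norm_inv, Complex.norm_natCast, Finset.sum_filter]
    congr 4
    ext z
    split_ifs <;> simp
  · rw [rhoBlock, Nat.add_sub_cancel, ← sectorCard_natCast]
    ext z z'
    by_cases h : z = z'
    · subst h; simp [blk, numDown_false]
    · simp [blk, h]
  · intro s s' hs
    ext z z'
    by_cases h : (s, z) = (s', z')
    · cases h
      have : s = true := by simpa using hs
      simp [rhoBlock, blk, this]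
    · simp [rhoBlock, blk, diagonal_apply_ne _ h]

lemma echo_rhoMixed (t : ℝ) : P.echo (rhoMixed N) t
    = 1 / 2 * (((2 : ℝ) ^ N)⁻¹ * ‖∑ z, echoTerm (P.Uecho t) z‖) := by
  rw [P.echo_eq (q := fun _ => ((2 : ℂ) ^ N)⁻¹)]
  · rw [← Finset.mul_sum, norm_mul, norm_inv, norm_pow, Complex.norm_ofNat]
  · ext z z'
    simp [rhoMixed, blk, onElectron_apply, ketBra, ketDown, vecMulVec_apply, diagonal_apply]
  · intro s s' hs
    ext z z'
    rcases hs with rfl | rfl <;>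
      simp [rhoMixed, blk, onElectron_apply, ketBra, ketDown, vecMulVec_apply]

lemma echo_nonneg (rho : Op N) (t : ℝ) : 0 ≤ P.echo rho t := norm_nonneg _

lemma sectorCard_pos {n : ℕ} (hn : n ≤ N) : (0 : ℝ) < sectorCard N n := by
  rw [sectorCard_natCast]
  exact_mod_cast Nat.choose_pos hn

theorem lowerBound_le_echo_rhoBlock (hhbar : 0 < P.hbar) (hgamma : P.gammaI < P.gammaS)
    (hA : ∀ j, 0 ≤ P.A j) (hB : P.Bc < P.B) {n : ℕ} (hn : n + 1 ≤ N) {alpha t : ℝ}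
    (ha : 1 < alpha) (ht : 0 ≤ t) (hlt : 2 * alpha * P.normW (n + 1) * t < P.hbar * Real.pi) :
    lowerBound (P.xi2 (n + 1)) (P.eps (n + 1)) (cFun P.hbar alpha (P.normW (n + 1)) t)
      ≤ P.echo (rhoBlock N (n + 1)) t := by
  by_cases hpos : 0 < lowerBound (P.xi2 (n + 1)) (P.eps (n + 1))
      (cFun P.hbar alpha (P.normW (n + 1)) t)
  swap
  · exact (not_lt.1 hpos).trans (P.echo_nonneg _ _)
  have hV := P.Vmax_lt_gap hhbar hgamma hA hB n
  have h1 := P.two_mul_lowerBound_le_loss hhbar hV ha ht hlt hpos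
  have h2 := P.re_sum_echoTerm_ge_loss hhbar hA hn hV ht
  have hM := sectorCard_pos (N := N) (n := n) (by omega)
  have h3 := (mul_le_mul_of_nonneg_left h1 hM.le).trans (h2.trans (Complex.re_le_norm _))
  rw [← le_inv_mul_iff₀ hM] at h3
  rw [echo_rhoBlock]
  linarith

lemma xi2_le_xi2All {L : ℕ} (h1 : 1 ≤ L) (hL : L ≤ N) : P.xi2 L ≤ P.xi2All :=
  le_ciSup (f := fun L : Set.Icc 1 N => P.xi2 L) (Set.finite_range _).bddAbove ⟨L, h1, hL⟩

lemma eps_le_epsAll {L : ℕ} (h1 : 1 ≤ L) (hL : L ≤ N) : P.eps L ≤ P.epsAll :=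
  le_ciSup (f := fun L : Set.Icc 1 N => P.eps L) (Set.finite_range _).bddAbove ⟨L, h1, hL⟩

lemma normW_le_normWAll {L : ℕ} (h1 : 1 ≤ L) (hL : L ≤ N) : P.normW L ≤ P.normWAll :=
  le_ciSup (f := fun L : Set.Icc 1 N => P.normW L) (Set.finite_range _).bddAbove ⟨L, h1, hL⟩

/-- The real parts of the sector sums add without cancellation, and the sector sizes sum to 2^N.
Each sector obeys the common bound, since the lower bound decreases when its constants are replaced
by their maxima. -/
theorem lowerBound_le_echo_rhoMixed (hhbar : 0 < P.hbar) (hgamma : P.gammaI < P.gammaS)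
    (hA : ∀ j, 0 ≤ P.A j) (hB : P.Bc < P.B) (hN : 1 ≤ N) {alpha t : ℝ}
    (ha : 1 < alpha) (ht : 0 ≤ t) (hlt : 2 * alpha * P.normWAll * t < P.hbar * Real.pi) :
    lowerBound P.xi2All P.epsAll (cFun P.hbar alpha P.normWAll t) ≤ P.echo (rhoMixed N) t := by
  set lb := lowerBound P.xi2All P.epsAll (cFun P.hbar alpha P.normWAll t) with hlb
  by_cases hpos : 0 < lb
  swap
  · exact (not_lt.1 hpos).trans (P.echo_nonneg _ _)
  have hblock : ∀ n, n + 1 ≤ N → 2 * lb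
      ≤ 1 - 10 * (P.Vmax (n + 1) / (P.lowUp (n + 1) + P.lowUp n)) ^ 2
        - 2 * (P.normW (n + 1) * t / P.hbar
          + 7 / 2 * (P.Vmax (n + 1) / (P.lowUp (n + 1) + P.lowUp n)) ^ 2) ^ 2 := fun n hn => by
    have hw := P.normW_le_normWAll (by omega : 1 ≤ n + 1) hn
    have hlt' : 2 * alpha * P.normW (n + 1) * t < P.hbar * Real.pi :=
      lt_of_le_of_lt (by gcongr) hlt
    have hle : lb ≤ lowerBound (P.xi2 (n + 1)) (P.eps (n + 1))
        (cFun P.hbar alpha (P.normW (n + 1)) t) :=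
      lowerBound_anti (P.xi2_nonneg n) (P.eps_nonneg _) (Real.sqrt_nonneg _)
        (P.xi2_le_xi2All (by omega) hn) (P.eps_le_epsAll (by omega) hn)
        (cFun_mono hhbar ha (P.normW_nonneg _) hw ht hlt)
    have := P.two_mul_lowerBound_le_loss hhbar (P.Vmax_lt_gap hhbar hgamma hA hB n) ha ht hlt'
      (hpos.trans_le hle)
    linarith
  have hsector : ∀ n ∈ Finset.range (N + 1), sectorCard N n * (2 * lb)
      ≤ (∑ z with (downs z : ℤ) = n, echoTerm (P.Uecho t) z).re := fun n hn => by
    rw [Finset.mem_range] at hn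
    by_cases hnN : n + 1 ≤ N
    · exact (mul_le_mul_of_nonneg_left (hblock n hnN) (Nat.cast_nonneg _)).trans
        (P.re_sum_echoTerm_ge_loss hhbar hA hnN (P.Vmax_lt_gap hhbar hgamma hA hB n) ht)
    -- The all-down sector borrows the estimate of the block N: its loss 8r² is smaller than the
    -- 10r² already granted there.
    · obtain ⟨m, hm⟩ : ∃ m, m + 1 = N := ⟨N - 1, by omega⟩
      obtain rfl : n = N := by omega
      refine le_trans (mul_le_mul_of_nonneg_left ((hblock m hm.le).trans ?_) (Nat.cast_nonneg _))
        (P.re_sum_echoTerm_top_ge hA hm (P.Vmax_lt_gap hhbar hgamma hA hB m) t)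
      have h1 := sq_nonneg (P.Vmax (m + 1) / (P.lowUp (m + 1) + P.lowUp m))
      have h2 := sq_nonneg (P.normW (m + 1) * t / P.hbar
          + 7 / 2 * (P.Vmax (m + 1) / (P.lowUp (m + 1) + P.lowUp m)) ^ 2)
      linarith
  have hmaps : ∀ z ∈ (Finset.univ : Finset (Fin N → Bool)), downs z ∈ Finset.range (N + 1) :=
    fun z _ => by
      have := card_up z
      rw [Finset.mem_range]; omega
  have hsum : ∑ n ∈ Finset.range (N + 1), ∑ z with (downs z : ℤ) = n, echoTerm (P.Uecho t) z
      = ∑ z, echoTerm (P.Uecho t) z := by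
    rw [← Finset.sum_fiberwise_of_maps_to hmaps]
    simp only [Nat.cast_inj]
  have hcard : ∑ n ∈ Finset.range (N + 1), (sectorCard N n : ℝ) = 2 ^ N := by
    simp_rw [sectorCard_natCast]
    exact_mod_cast Nat.sum_range_choose N
  have h1 := Finset.sum_le_sum hsector
  rw [← Finset.sum_mul, hcard, ← Complex.re_sum, hsum] at h1
  have h2 := h1.trans (Complex.re_le_norm _)
  rw [← le_inv_mul_iff₀ (by positivity)] at h2
  rw [echo_rhoMixed]
  linarith

end SpinBath

end

end SpinEcho

/-! ### The theorem for both initial states -/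

open SpinEcho in
theorem mainTheorem2 {N : ℕ} (P : SpinBath N) (hhbar : 0 < P.hbar) (hgamma : P.gammaI < P.gammaS)
    (hA : ∀ j, 0 ≤ P.A j) (hB : P.Bc < P.B) :
    (∀ L : ℕ, 1 ≤ L → L ≤ N →
      (∀ alpha t : ℝ, 1 < alpha → 0 ≤ t → 2 * alpha * P.normW L * t < P.hbar * Real.pi →
        lowerBound (P.xi2 L) (P.eps L) (cFun P.hbar alpha (P.normW L) t)
          ≤ P.echo (rhoBlock N L) t) ∧
      (∀ cmax : ℝ, 0 < P.normW L → IsCMax (P.xi2 L) (P.eps L) cmax →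
        ∃ tb : ℝ, IsGreatest (boundTimes P.hbar (P.normW L) cmax) tb ∧
          (tb : EReal) ≤ P.T2 (rhoBlock N L))) ∧
    (1 ≤ N →
      (∀ alpha t : ℝ, 1 < alpha → 0 ≤ t → 2 * alpha * P.normWAll * t < P.hbar * Real.pi →
        lowerBound P.xi2All P.epsAll (cFun P.hbar alpha P.normWAll t)
          ≤ P.echo (rhoMixed N) t) ∧
      (∀ cmax : ℝ, 0 < P.normWAll → IsCMax P.xi2All P.epsAll cmax →
        ∃ tb : ℝ, IsGreatest (boundTimes P.hbar P.normWAll cmax) tb ∧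
          (tb : EReal) ≤ P.T2 (rhoMixed N))) := by
  refine ⟨fun L h1 hL => ?_, fun hN => ?_⟩
  · obtain ⟨n, rfl⟩ : ∃ n, L = n + 1 := ⟨L - 1, by omega⟩
    have hlow : ∀ alpha t : ℝ, 1 < alpha → 0 ≤ t →
        2 * alpha * P.normW (n + 1) * t < P.hbar * Real.pi →
        lowerBound (P.xi2 (n + 1)) (P.eps (n + 1)) (cFun P.hbar alpha (P.normW (n + 1)) t)
          ≤ P.echo (rhoBlock N (n + 1)) t := fun alpha t ha ht hlt =>
      P.lowerBound_le_echo_rhoBlock hhbar hgamma hA hB hL ha ht hlt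
    refine ⟨hlow, fun cmax hw hc => ?_⟩
    have hc2 := sq_cMax_lt (P.xi2_nonneg n) (P.eps_nonneg _) hc
    obtain ⟨tb, htb⟩ := exists_isGreatest_boundTimes hhbar hw hc.1 (by linarith)
    exact ⟨tb, htb, P.le_T2 hhbar hw (P.xi2_nonneg n) (P.eps_nonneg _) hc htb.1 hlow⟩
  · have hlow : ∀ alpha t : ℝ, 1 < alpha → 0 ≤ t →
        2 * alpha * P.normWAll * t < P.hbar * Real.pi →
        lowerBound P.xi2All P.epsAll (cFun P.hbar alpha P.normWAll t) ≤ P.echo (rhoMixed N) t :=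
      fun alpha t ha ht hlt => P.lowerBound_le_echo_rhoMixed hhbar hgamma hA hB hN ha ht hlt
    refine ⟨hlow, fun cmax hw hc => ?_⟩
    have hxi : 0 ≤ P.xi2All := (P.xi2_nonneg 0).trans (P.xi2_le_xi2All le_rfl hN)
    have heps : 0 ≤ P.epsAll := (P.eps_nonneg 1).trans (P.eps_le_epsAll le_rfl hN)
    have hc2 := sq_cMax_lt hxi heps hc
    obtain ⟨tb, htb⟩ := exists_isGreatest_boundTimes hhbar hw hc.1 (by linarith)
    exact ⟨tb, htb, P.le_T2 hhbar hw hxi heps hc htb.1 hlow⟩
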